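/- Let $R$ be a commutative $\mathbb{Q}$-algebra, let $X^0$ be a smooth scheme over $R$, and let $\mathcal{E},\mathcal{F}$ be vector bundles of finite rank on $X^0$. Let $\mathcal{O}_{X,\#}=\mathcal{O}_{X^0}[\mathcal{E}[1]\oplus\mathcal{F}[2]]=\Lambda(\mathcal{E})\otimes_{\mathcal{O}_{X^0}}\mathrm{Sym}(\mathcal{F})$ be the free sheaf of graded-commutative algebras over $\mathcal{O}_{X^0}$ generated by $\mathcal{E}$ in homological degree $1$ and $\mathcal{F}$ in homological degree $2$. A differential $\delta$ on it is an $R$-linear square-zero derivation of homological degree $-1$; then $X=(X^0,\mathcal{O}_{X,\#},\delta)$ is a dg scheme over $R$. A strict $(-2)$-shifted Poisson structure $\pi$ on $X$ is an $R$-bilinear bracket $[-,-]$ on $\mathcal{O}_X$ which lowers the homological degree by $2$, is a graded biderivation, is graded antisymmetric, satisfies the graded Jacobi identity, and is compatible with $\delta$. It is strictly non-degenerate if the contraction $\pi^{\flat}\colon\Omega^1_X\to \mathcal{H}om_{\mathcal{O}_X}(\Omega^1_X,\mathcal{O}_X)[2]$, $a\,db\mapsto a[b,-]$, is an isomorphism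 (all differentials being relative to $R$). Consider triples $(\alpha,\nabla_{\mathcal{E}},Q)$ consisting of 1. an isomorphism $\alpha\colon\mathcal{F}\cong\mathcal{T}_{X^0}$ to the tangent sheaf of $X^0$ over $R$, 2. a (not necessarily flat) left connection $\nabla_{\mathcal{E}}\colon\mathcal{E}\to\mathcal{E}\otimes_{\mathcal{O}_{X^0}}\Omega^1_{X^0}$, 3. a non-degenerate inner product $Q\colon\mathrm{Sym}^2_{\mathcal{O}_{X^0}}\mathcal{E}\to\mathcal{O}_{X^0}$ (i.e. $\mathcal{E}\to\mathcal{E}^*$ is an isomorphism) compatible with $\nabla_{\mathcal{E}}$, i.e. $dQ(e_1,e_2)=Q(\nabla_{\mathcal{E}}e_1,e_2)+Q(e_1,\nabla_{\mathcal{E}}e_2)$. Say that $\pi$ corresponds to $(\alpha,\nabla_{\mathcal{E}},Q)$ if $[f,a]=\alpha(f)\lrcorner da$, $[e_1,e_2]=Q(e_1,e_2)$ and $[f,e]=\alpha(f)\lrcorner\nabla_{\mathcal{E}}(e)$ for all local sections $f$ of $\mathcal{F}$, $a$ of $\mathcal{O}_{X^0}$ and $e,e_1,e_2$ of $\mathcal{E}$.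 Say that $\delta$ is determined by $\phi\in\Gamma(X^0,\mathcal{E})$ (and the triple) if $\delta e=Q(\phi,e)$ and $\delta f=-\alpha(f)\lrcorner\nabla_{\mathcal{E}}(\phi)$ for all local sections $e$ of $\mathcal{E}$ and $f$ of $\mathcal{F}$. Then: (a) For every differential $\delta$, every strictly non-degenerate strict $(-2)$-shifted Poisson structure $\pi$ on $X$ corresponds to exactly one triple $(\alpha,\nabla_{\mathcal{E}},Q)$ as above; and there is exactly one $\phi\in\Gamma(X^0,\mathcal{E})$ with $dQ(\phi,\phi)=0$ such that $\delta$ is determined by $\phi$. (b) Conversely, for every such triple and every $\phi\in\Gamma(X^0,\mathcal{E})$ with $dQ(\phi,\phi)=0$ there is exactly one differential $\delta$ determined by $\phi$, and on the resulting dg scheme there is exactly one strictly non-degenerate strict $(-2)$-shifted Poisson structure corresponding to $(\alpha,\nabla_{\mathcal{E}},Q)$. -/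

import Mathlib

open CategoryTheory AlgebraicGeometry TensorProduct

universe u

noncomputable section

/-!
## Free graded-commutative algebras `B[E[1] ⊕ F[2]]`

Homological grading: `B` is in degree `0`, `E` in degree `1`, `F` in degree `2`.
-/

/-- The free graded-commutative `B`-algebra `B[E[1] ⊕ F[2]] = Λ_B(E) ⊗_B Sym_B(F)` on a module `E`
in degree `1` and a module `F` in degree `2`.  As `Sym_B(F)` lies in even degrees, the product
carries no extra signs. -/
def GSym (B E F : Type*) [CommRing B] [AddCommGroup E] [Module B E] [AddCommGroup F] [Module B F] :
    Type _ :=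
  ExteriorAlgebra B E ⊗[B] SymmetricAlgebra B F

namespace GSym

section Basic

variable (B E F : Type*) [CommRing B] [AddCommGroup E] [Module B E] [AddCommGroup F] [Module B F]

instance : Ring (GSym B E F) :=
  inferInstanceAs (Ring (ExteriorAlgebra B E ⊗[B] SymmetricAlgebra B F))

instance : Algebra B (GSym B E F) :=
  inferInstanceAs (Algebra B (ExteriorAlgebra B E ⊗[B] SymmetricAlgebra B F))

/-- The inclusion of the degree `0` generators. -/
def ι₀ : B →+* GSym B E F := algebraMap B (GSym B E F)

/-- The inclusion of the exterior algebra. -/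
def inl : ExteriorAlgebra B E →ₐ[B] GSym B E F :=
  (Algebra.TensorProduct.includeLeft :
    ExteriorAlgebra B E →ₐ[B] ExteriorAlgebra B E ⊗[B] SymmetricAlgebra B F)

/-- The inclusion of the symmetric algebra. -/
def inr : SymmetricAlgebra B F →ₐ[B] GSym B E F :=
  (Algebra.TensorProduct.includeRight :
    SymmetricAlgebra B F →ₐ[B] ExteriorAlgebra B E ⊗[B] SymmetricAlgebra B F)

/-- The inclusion of the degree `1` generators. -/
def ι₁ : E →ₗ[B] GSym B E F := (inl B E F).toLinearMap ∘ₗ ExteriorAlgebra.ι B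

/-- The inclusion of the degree `2` generators. -/
def ι₂ : F →ₗ[B] GSym B E F := (inr B E F).toLinearMap ∘ₗ SymmetricAlgebra.ι B F

/-- The part of homological degree `n`, i.e. `⨁_{p + 2q = n} Λ^p(E) ⊗ Sym^q(F)`; it is zero for
`n < 0`. -/
def gr (n : ℤ) : Submodule B (GSym B E F) :=
  ⨆ (p : ℕ) (q : ℕ) (_ : (p : ℤ) + 2 * (q : ℤ) = n),
    LinearMap.range (ι₁ B E F) ^ p * LinearMap.range (ι₂ B E F) ^ q

end Basic

section Map

variable {B E F B' E' F' : Type*} [CommRing B] [AddCommGroup E] [Module B E] [AddCommGroup F]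
  [Module B F] [CommRing B'] [AddCommGroup E'] [Module B' E'] [AddCommGroup F'] [Module B' F']

lemma ι₁_mul_self (e : E) : ι₁ B E F e * ι₁ B E F e = 0 := by
  change inl B E F _ * inl B E F _ = _
  rw [← map_mul, ExteriorAlgebra.ι_sq_zero, map_zero]

lemma commute_inr (x : GSym B E F) (y : SymmetricAlgebra B F) : Commute x (inr B E F y) := by
  have key : ∀ z : ExteriorAlgebra B E ⊗[B] SymmetricAlgebra B F,
      z * (1 ⊗ₜ[B] y) = (1 ⊗ₜ[B] y) * z := by
    intro z
    induction z using TensorProduct.induction_on with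
    | zero => simp
    | tmul a b => simp [mul_comm]
    | add a b ha hb => rw [add_mul, mul_add, ha, hb]
  exact key x

/-- The ring homomorphism `B[E[1] ⊕ F[2]] → B'[E'[1] ⊕ F'[2]]` induced by a ring homomorphism
`B → B'` and semilinear maps `E → E'` and `F → F'`. -/
def map (φ : B →+* B') (e : E →ₛₗ[φ] E') (f : F →ₛₗ[φ] F') : GSym B E F →+* GSym B' E' F' :=
  letI : Algebra B (GSym B' E' F') := ((algebraMap B' (GSym B' E' F')).comp φ).toAlgebra'
    fun b x => Algebra.commutes (φ b) x
  letI : Algebra B (SymmetricAlgebra B' F') :=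
    ((algebraMap B' (SymmetricAlgebra B' F')).comp φ).toAlgebra
  let s : SymmetricAlgebra B F →ₐ[B] SymmetricAlgebra B' F' := SymmetricAlgebra.lift
    { toFun := fun x => SymmetricAlgebra.ι B' F' (f x)
      map_add' := by simp
      map_smul' := fun b x => by
        rw [LinearMap.map_smulₛₗ, map_smul, Algebra.smul_def, Algebra.smul_def]; rfl }
  let j : SymmetricAlgebra B' F' →ₐ[B] GSym B' E' F' :=
    { (inr B' E' F').toRingHom with
      commutes' := fun b => (inr B' E' F').commutes (φ b) }
  let l : ExteriorAlgebra B E →ₐ[B] GSym B' E' F' := ExteriorAlgebra.lift B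
    ⟨{ toFun := fun x => ι₁ B' E' F' (e x)
       map_add' := by simp
       map_smul' := fun b x => by
        rw [LinearMap.map_smulₛₗ, map_smul, Algebra.smul_def, Algebra.smul_def]; rfl },
      fun x => ι₁_mul_self (e x)⟩
  (Algebra.TensorProduct.lift l (j.comp s) fun x y => commute_inr (l x) (s y)).toRingHom

variable (φ : B →+* B') (e : E →ₛₗ[φ] E') (f : F →ₛₗ[φ] F')

lemma map_ι₀ (b : B) : map φ e f (ι₀ B E F b) = ι₀ B' E' F' (φ b) := by
  let _ : Algebra B (GSym B' E' F') := ((algebraMap B' (GSym B' E' F')).comp φ).toAlgebra'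
    fun b x => Algebra.commutes (φ b) x
  let _ : Algebra B (SymmetricAlgebra B' F') :=
    ((algebraMap B' (SymmetricAlgebra B' F')).comp φ).toAlgebra
  exact (Algebra.TensorProduct.lift (R := B) (S := B) (A := ExteriorAlgebra B E)
    (B := SymmetricAlgebra B F) (C := GSym B' E' F') _ _ _).commutes b

lemma map_ι₁ (x : E) : map φ e f (ι₁ B E F x) = ι₁ B' E' F' (e x) := by
  let _ : Algebra B (GSym B' E' F') := ((algebraMap B' (GSym B' E' F')).comp φ).toAlgebra'
    fun b x => Algebra.commutes (φ b) x
  let _ : Algebra B (SymmetricAlgebra B' F') :=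
    ((algebraMap B' (SymmetricAlgebra B' F')).comp φ).toAlgebra
  refine (Algebra.TensorProduct.lift_tmul (R := B) (S := B) (A := ExteriorAlgebra B E)
    (B := SymmetricAlgebra B F) (C := GSym B' E' F') _ _ _ (ExteriorAlgebra.ι B x) 1).trans ?_
  rw [map_one, mul_one]
  exact ExteriorAlgebra.lift_ι_apply _ _ _ _

lemma map_ι₂ (x : F) : map φ e f (ι₂ B E F x) = ι₂ B' E' F' (f x) := by
  let _ : Algebra B (GSym B' E' F') := ((algebraMap B' (GSym B' E' F')).comp φ).toAlgebra'
    fun b x => Algebra.commutes (φ b) x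
  let _ : Algebra B (SymmetricAlgebra B' F') :=
    ((algebraMap B' (SymmetricAlgebra B' F')).comp φ).toAlgebra
  refine (Algebra.TensorProduct.lift_tmul (R := B) (S := B) (A := ExteriorAlgebra B E)
    (B := SymmetricAlgebra B F) (C := GSym B' E' F') _ _ _ 1 (SymmetricAlgebra.ι B F x)).trans ?_
  rw [map_one, one_mul]
  exact congrArg (inr B' E' F') (SymmetricAlgebra.lift_ι_apply _ _)

end Map

/-!
## Graded derivations, differentials, Poisson brackets and Kähler differentials
-/

section Poisson

variable (R : Type*) {B E F : Type*} [CommRing R] [CommRing B] [Algebra R B]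
  [AddCommGroup E] [Module B E] [AddCommGroup F] [Module B F]

/-- `D` is an `R`-linear derivation of homological degree `k` of the graded algebra
`B[E[1] ⊕ F[2]]`.  (For an additive map with the Leibniz rule, `R`-linearity means that the image
of `R` is killed.) -/
structure IsGradedDerivation (k : ℤ) (D : GSym B E F →+ GSym B E F) : Prop where
  map_base : ∀ r : R, D (ι₀ B E F (algebraMap R B r)) = 0
  map_gr : ∀ n : ℤ, ∀ a ∈ gr B E F n, D a ∈ gr B E F (n + k)
  leibniz : ∀ n : ℤ, ∀ a ∈ gr B E F n, ∀ b : GSym B E F,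
    D (a * b) = D a * b + (k * n).negOnePow • (a * D b)

/-- `δ` makes `B[E[1] ⊕ F[2]]` a commutative differential graded algebra over `R` (with
differential lowering the homological degree by `1`). -/
structure IsDifferential (δ : GSym B E F →+ GSym B E F) : Prop where
  isGradedDerivation : IsGradedDerivation R (-1) δ
  sq_zero : ∀ a, δ (δ a) = 0

/-- `π` is the bracket of a strict `(-2)`-shifted Poisson structure over `R` on the commutative
differential graded algebra `(B[E[1] ⊕ F[2]], δ)`: it lowers the homological degree by `2`, is a
biderivation, makes the (evenly shifted) algebra a graded Lie algebra, and is compatible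
with `δ`. -/
structure IsStrictPoisson (δ : GSym B E F →+ GSym B E F)
    (π : GSym B E F →+ GSym B E F →+ GSym B E F) : Prop where
  right_derivation : ∀ m : ℤ, ∀ a ∈ gr B E F m, IsGradedDerivation R (m - 2) (π a)
  left_base : ∀ (r : R) (c : GSym B E F), π (ι₀ B E F (algebraMap R B r)) c = 0
  left_leibniz : ∀ m n : ℤ, ∀ a ∈ gr B E F m, ∀ b ∈ gr B E F n, ∀ c : GSym B E F,
    π (a * b) c = a * π b c + (m * n).negOnePow • (b * π a c)
  skew : ∀ m n : ℤ, ∀ a ∈ gr B E F m, ∀ b ∈ gr B E F n, π a b = -((m * n).negOnePow • π b a)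
  jacobi : ∀ m n : ℤ, ∀ a ∈ gr B E F m, ∀ b ∈ gr B E F n, ∀ c : GSym B E F,
    π a (π b c) = π (π a b) c + (m * n).negOnePow • π b (π a c)
  differential : ∀ m : ℤ, ∀ a ∈ gr B E F m, ∀ b : GSym B E F,
    δ (π a b) = π (δ a) b + m.negOnePow • π a (δ b)

variable (B E F)

/-- The relations defining graded Kähler differentials, in the free left module on symbols `d a`:
`d` is additive, vanishes on `R`, and `d (a b) = a d b + (-1)^{|a||b|} b d a`. -/
inductive KaehlerRel : (GSym B E F →₀ GSym B E F) → Prop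
  | add (a b : GSym B E F) : KaehlerRel
      (Finsupp.single (a + b) 1 - Finsupp.single a 1 - Finsupp.single b 1)
  | base (r : R) : KaehlerRel (Finsupp.single (ι₀ B E F (algebraMap R B r)) 1)
  | mul (m n : ℤ) (a b : GSym B E F) (ha : a ∈ gr B E F m) (hb : b ∈ gr B E F n) : KaehlerRel
      (Finsupp.single (a * b) 1 -
        (Finsupp.single b a + (m * n).negOnePow • Finsupp.single a b))

/-- The module `Ω¹` of Kähler differentials over `R` of the graded-commutative algebra
`B[E[1] ⊕ F[2]]`, as a left module. -/
abbrev Kaehler : Type _ :=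
  (GSym B E F →₀ GSym B E F) ⧸ Submodule.span (GSym B E F) {x | KaehlerRel R B E F x}

/-- The graded module `HHom(Ω¹, A)` for `A = B[E[1] ⊕ F[2]]`, i.e. the direct sum over `k` of the
groups of `R`-linear derivations `A → A` of degree `k`, as a subgroup of the additive
endomorphisms of `A`. -/
def gradedDerivations : AddSubgroup (GSym B E F →+ GSym B E F) :=
  AddSubgroup.closure {D | ∃ k : ℤ, IsGradedDerivation R k D}

variable {B E F} {R}

/-- The contraction `π♭ : Ω¹ → Hom(A, A)`, `a d b ↦ a π(b, -)`, which takes values in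
derivations. -/
def IsStrictPoisson.flat {δ : GSym B E F →+ GSym B E F}
    {π : GSym B E F →+ GSym B E F →+ GSym B E F} (h : IsStrictPoisson R δ π) :
    Kaehler R B E F →ₗ[GSym B E F] (GSym B E F →+ GSym B E F) :=
  Submodule.liftQ _ (Finsupp.linearCombination (GSym B E F) (fun b => π b)) <| by
    rw [Submodule.span_le]
    intro x hx
    rw [SetLike.mem_coe, LinearMap.mem_ker]
    cases hx with
    | add a b => simp
    | base r => ext c; simpa using h.left_base r c
    | mul m n a b ha hb =>
      ext c
      simp only [map_sub, map_add, Finsupp.linearCombination_single, one_smul, AddMonoidHom.sub_apply,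
        AddMonoidHom.add_apply, AddMonoidHom.zero_apply, AddMonoidHom.smul_apply, smul_eq_mul]
      rw [h.left_leibniz m n a ha b hb c]
      rcases Int.units_eq_one_or (m * n).negOnePow with hs | hs <;> simp [hs]

/-- The Poisson structure is strictly non-degenerate: `π♭ : Ω¹ → HHom(Ω¹, A)[2]` is an
isomorphism. -/
def IsStrictPoisson.StrictlyNondegenerate {δ : GSym B E F →+ GSym B E F}
    {π : GSym B E F →+ GSym B E F →+ GSym B E F} (h : IsStrictPoisson R δ π) : Prop :=
  Function.Injective h.flat ∧ Set.range h.flat = (gradedDerivations R B E F : Set _)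

end Poisson

end GSym

/-!
## Forms with coefficients in a module
-/

section Forms

variable {R B B' E E' : Type*} [CommRing R] [CommRing B] [CommRing B'] [Algebra R B] [Algebra R B']
  [AddCommGroup E] [Module B E] [AddCommGroup E'] [Module B' E']

/-- The map `Ω_{B/R} → Ω_{B'/R}` induced by an `R`-algebra homomorphism. -/
def kaehlerMap (φ : B →ₐ[R] B') : Ω[B⁄R] →ₛₗ[φ.toRingHom] Ω[B'⁄R] :=
  letI : Algebra B B' := φ.toRingHom.toAlgebra
  haveI : IsScalarTower R B B' := IsScalarTower.of_algebraMap_eq fun r => (φ.commutes r).symm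
  { toFun := KaehlerDifferential.map R R B B'
    map_add' := map_add _
    map_smul' := fun b x => by
      rw [map_smul, algebra_compatible_smul B' b]; rfl }

lemma kaehlerMap_D (φ : B →ₐ[R] B') (b : B) :
    kaehlerMap φ (KaehlerDifferential.D R B b) = KaehlerDifferential.D R B' (φ b) := by
  let _ : Algebra B B' := φ.toRingHom.toAlgebra
  have : IsScalarTower R B B' := IsScalarTower.of_algebraMap_eq fun r => (φ.commutes r).symm
  exact KaehlerDifferential.map_D R R B B' b

/-- The map `E ⊗ Ω_{B/R} → E' ⊗ Ω_{B'/R}` induced by an `R`-algebra homomorphism `B → B'` and a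
semilinear map `E → E'`. -/
def formsMap (φ : B →ₐ[R] B') (e : E →ₛₗ[φ.toRingHom] E') :
    E ⊗[B] Ω[B⁄R] →+ E' ⊗[B'] Ω[B'⁄R] :=
  TensorProduct.liftAddHom
    { toFun := fun x => ((TensorProduct.mk B' E' Ω[B'⁄R] (e x)).toAddMonoidHom).comp
        (kaehlerMap φ).toAddMonoidHom
      map_zero' := by
        ext ω
        exact (congrArg (fun z => z ⊗ₜ[B'] kaehlerMap φ ω) e.map_zero).trans
          (TensorProduct.zero_tmul _ _)
      map_add' := fun x y => by
        ext ω
        exact (congrArg (fun z => z ⊗ₜ[B'] kaehlerMap φ ω) (e.map_add x y)).trans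
          (TensorProduct.add_tmul _ _ _) }
    fun b x ω => by
      change e (b • x) ⊗ₜ[B'] kaehlerMap φ ω = e x ⊗ₜ[B'] kaehlerMap φ (b • ω)
      rw [LinearMap.map_smulₛₗ, LinearMap.map_smulₛₗ, TensorProduct.smul_tmul]

/-- Contraction `v ⌟ - : E ⊗ Ω_{B/R} → E`, `e ⊗ ω ↦ ω(v) e`, with a vector field `v`. -/
def contract (v : Derivation R B B) : E ⊗[B] Ω[B⁄R] →ₗ[B] E :=
  (TensorProduct.rid B E).toLinearMap ∘ₗ LinearMap.lTensor E v.liftKaehlerDifferential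

/-- The map `q ⊗ id : E ⊗ Ω_{B/R} → Ω_{B/R}` induced by a linear form `q` on `E`. -/
def pairForm (q : E →ₗ[B] B) : E ⊗[B] Ω[B⁄R] →ₗ[B] Ω[B⁄R] :=
  (TensorProduct.lid B Ω[B⁄R]).toLinearMap ∘ₗ LinearMap.rTensor Ω[B⁄R] q

end Forms

/-!
## Global objects on a scheme `X` over `R`

All the sheaves below are quasi-coherent on `X`, so they and the maps between them are given by
their sections on affine open subsets, compatibly with restriction.
-/

namespace DGScheme

section Sections

variable {X : Scheme.{u}}

/-- The `R`-algebra structure on functions on an open subset of a scheme over `R`. -/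
instance algebraSections (R : Type u) [CommRing R] (X : Scheme.{u}) [X.Over (Spec (.of R))]
    (U : X.Opens) : Algebra R Γ(X, U) :=
  ((Scheme.ΓSpecIso (.of R)).inv ≫ (X ↘ Spec (.of R)).appTop ≫
    X.presheaf.map (homOfLE (le_top : U ≤ ⊤)).op).hom.toAlgebra

/-- A vector bundle of finite rank: a sheaf of modules that is locally free of finite rank. -/
def IsVectorBundle (M : X.Modules) : Prop :=
  ∃ q : SheafOfModules.LocalGeneratorsData.{u} M, q.IsLocallyFreeData ∧ q.IsFiniteType

/-- Restriction of functions. -/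
def resFun (R : Type u) [CommRing R] [X.Over (Spec (.of R))] {U V : X.Opens} (h : V ≤ U) :
    Γ(X, U) →ₐ[R] Γ(X, V) where
  __ := (X.presheaf.map (homOfLE h).op).hom
  commutes' r := by
    change ((X.presheaf.map (homOfLE (le_top : U ≤ ⊤)).op ≫ X.presheaf.map (homOfLE h).op).hom
      (((Scheme.ΓSpecIso (.of R)).inv ≫ (X ↘ Spec (.of R)).appTop).hom r)) = _
    rw [← X.presheaf.map_comp]
    rfl

/-- Restriction of sections of a sheaf of modules. -/
def resSec (M : X.Modules) {U V : X.Opens} (h : V ≤ U) :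
    Γ(M, U) →ₛₗ[(X.presheaf.map (homOfLE h).op).hom] Γ(M, V) where
  __ := (M.presheaf.map (homOfLE h).op).hom
  map_smul' r x := M.map_smul (homOfLE h) r x

variable (E F : X.Modules)

/-- The sections over an affine open `U` of the sheaf `O_X[E[1] ⊕ F[2]]` of graded-commutative
algebras on `X`. -/
abbrev A (U : X.affineOpens) : Type u := GSym Γ(X, U.1) Γ(E, U.1) Γ(F, U.1)

/-- The restriction maps of `O_X[E[1] ⊕ F[2]]`. -/
def resA {U V : X.affineOpens} (h : V.1 ≤ U.1) : A E F U →+* A E F V :=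
  GSym.map _ (resSec E h) (resSec F h)

end Sections

section Structures

variable (R : Type u) [CommRing R] {X : Scheme.{u}} [X.Over (Spec (.of R))] (E F : X.Modules)

/-- A differential `δ` on the sheaf `O_X[E[1] ⊕ F[2]]` of graded-commutative algebras, making
`(X, O_X[E[1] ⊕ F[2]], δ)` a dg scheme over `R`. -/
structure Differential where
  d : ∀ U : X.affineOpens, A E F U →+ A E F U
  isDifferential : ∀ U, GSym.IsDifferential R (d U)
  res : ∀ (U V : X.affineOpens) (h : V.1 ≤ U.1) (a : A E F U),
    resA E F h (d U a) = d V (resA E F h a)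

variable {R E F}

/-- A strict `(-2)`-shifted Poisson structure on the dg scheme `(X, O_X[E[1] ⊕ F[2]], δ)`
over `R`. -/
structure StrictPoisson (δ : Differential R E F) where
  bracket : ∀ U : X.affineOpens, A E F U →+ A E F U →+ A E F U
  isStrictPoisson : ∀ U, GSym.IsStrictPoisson R (δ.d U) (bracket U)
  res : ∀ (U V : X.affineOpens) (h : V.1 ≤ U.1) (a b : A E F U),
    resA E F h (bracket U a b) = bracket V (resA E F h a) (resA E F h b)

/-- Strict non-degeneracy: `π♭ : Ω¹ → HHom(Ω¹, O)[2]` is an isomorphism of sheaves. -/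
def StrictPoisson.StrictlyNondegenerate {δ : Differential R E F} (π : StrictPoisson δ) : Prop :=
  ∀ U, (π.isStrictPoisson U).StrictlyNondegenerate

variable (R E F)

/-- Isomorphisms `α : F ≅ T_X` to the tangent sheaf; sections of `T_X` over an affine open `U` are
the `R`-derivations of `Γ(X, U)`. -/
structure TangentIso where
  toEquiv : ∀ U : X.affineOpens, Γ(F, U.1) ≃ₗ[Γ(X, U.1)] Derivation R Γ(X, U.1) Γ(X, U.1)
  res : ∀ (U V : X.affineOpens) (h : V.1 ≤ U.1) (f : Γ(F, U.1)) (a : Γ(X, U.1)),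
    resFun R h (toEquiv U f a) = toEquiv V (resSec F h f) (resFun R h a)

/-- (Not necessarily flat) left connections `∇ : E → E ⊗ Ω¹_{X/R}`. -/
structure Connection where
  toFun : ∀ U : X.affineOpens, Γ(E, U.1) →+ Γ(E, U.1) ⊗[Γ(X, U.1)] Ω[Γ(X, U.1)⁄R]
  leibniz : ∀ (U : X.affineOpens) (a : Γ(X, U.1)) (e : Γ(E, U.1)),
    toFun U (a • e) = a • toFun U e + e ⊗ₜ KaehlerDifferential.D R Γ(X, U.1) a
  res : ∀ (U V : X.affineOpens) (h : V.1 ≤ U.1) (e : Γ(E, U.1)),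
    formsMap (resFun R h) (resSec E h) (toFun U e) = toFun V (resSec E h e)

/-- Non-degenerate inner products `Q : Sym² E → O_X`; non-degenerate means that the induced map
from `E` to its dual is an isomorphism. -/
structure InnerProduct where
  form : ∀ U : X.affineOpens, LinearMap.BilinForm Γ(X, U.1) Γ(E, U.1)
  symm : ∀ (U : X.affineOpens) (e₁ e₂ : Γ(E, U.1)), form U e₁ e₂ = form U e₂ e₁
  nondegenerate : ∀ U : X.affineOpens, Function.Bijective (form U)
  res : ∀ (U V : X.affineOpens) (h : V.1 ≤ U.1) (e₁ e₂ : Γ(E, U.1)),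
    resFun R h (form U e₁ e₂) = form V (resSec E h e₁) (resSec E h e₂)

/-- The data of an isomorphism `α : F ≅ T_X`, a connection `∇` on `E`, and a non-degenerate inner
product `Q` on `E` compatible with `∇`, i.e. `d Q(e₁, e₂) = Q(∇ e₁, e₂) + Q(e₁, ∇ e₂)`. -/
structure PoissonData where
  α : TangentIso R F
  conn : Connection R E
  Q : InnerProduct R E
  compatible : ∀ (U : X.affineOpens) (e₁ e₂ : Γ(E, U.1)),
    KaehlerDifferential.D R Γ(X, U.1) (Q.form U e₁ e₂) =
      pairForm (Q.form U e₂) (conn.toFun U e₁) + pairForm (Q.form U e₁) (conn.toFun U e₂)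

variable {R E F}

/-- The restriction to an affine open of a global section. -/
def globalRes {M : X.Modules} (φ : Γ(M, ⊤)) (U : X.affineOpens) : Γ(M, U.1) :=
  resSec M (le_top : U.1 ≤ ⊤) φ

namespace PoissonData

variable (D : PoissonData R E F)

/-- `α(f) ⌟ ∇(e)`. -/
def covDeriv (U : X.affineOpens) (f : Γ(F, U.1)) (e : Γ(E, U.1)) : Γ(E, U.1) :=
  contract (D.α.toEquiv U f) (D.conn.toFun U e)

/-- The condition `d Q(φ, φ) = 0`. -/
def NormClosed (φ : Γ(E, ⊤)) : Prop :=
  ∀ U : X.affineOpens,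
    KaehlerDifferential.D R Γ(X, U.1) (D.Q.form U (globalRes φ U) (globalRes φ U)) = 0

/-- The differential `δ` is the one determined by `φ`: on `E` it is `Q(φ, -)`, and on `F` it is
`f ↦ - α(f) ⌟ ∇(φ)`. -/
structure Determines (φ : Γ(E, ⊤)) (δ : Differential R E F) : Prop where
  on_E : ∀ (U : X.affineOpens) (e : Γ(E, U.1)),
    δ.d U (GSym.ι₁ _ _ _ e) = GSym.ι₀ _ _ _ (D.Q.form U (globalRes φ U) e)
  on_F : ∀ (U : X.affineOpens) (f : Γ(F, U.1)),
    δ.d U (GSym.ι₂ _ _ _ f) = -GSym.ι₁ _ _ _ (D.covDeriv U f (globalRes φ U))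

/-- The Poisson structure `π` and the data `(α, ∇, Q)` correspond to each other:
`[f, a] = α(f) ⌟ da`, `[e₁, e₂] = Q(e₁, e₂)` and `[f, e] = α(f) ⌟ ∇(e)`
for local sections `f` of `F`, `a` of `O_X` and `e`, `e₁`, `e₂` of `E`. -/
structure Corresponds {δ : Differential R E F} (π : StrictPoisson δ) : Prop where
  bracket_F_O : ∀ (U : X.affineOpens) (f : Γ(F, U.1)) (a : Γ(X, U.1)),
    π.bracket U (GSym.ι₂ _ _ _ f) (GSym.ι₀ _ _ _ a) = GSym.ι₀ _ _ _ (D.α.toEquiv U f a)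
  bracket_E_E : ∀ (U : X.affineOpens) (e₁ e₂ : Γ(E, U.1)),
    π.bracket U (GSym.ι₁ _ _ _ e₁) (GSym.ι₁ _ _ _ e₂) = GSym.ι₀ _ _ _ (D.Q.form U e₁ e₂)
  bracket_F_E : ∀ (U : X.affineOpens) (f : Γ(F, U.1)) (e : Γ(E, U.1)),
    π.bracket U (GSym.ι₂ _ _ _ f) (GSym.ι₁ _ _ _ e) = GSym.ι₁ _ _ _ (D.covDeriv U f e)

end PoissonData

end Structures

end DGScheme

end

/-! The question is local. Over an affine open with functions `B`, write `E` and `F` for the finite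
projective modules of sections and `A` for `B[E[1] ⊕ F[2]]`. A bracket of degree `-2` is fixed by
its values on generators, and degrees leave only `[F, B] ⊆ B`, `[E, E] ⊆ B`, `[F, E] ⊆ E` and `[F,
F] ⊆ F ⊕ Λ²E`. By the Leibniz rules the first is a linear map `α` from `F` to derivations of `B`,
the second a bilinear form `Q`, the third a covariant derivative. Graded skewness makes `Q`
symmetric, and the Jacobi identity for `f, e, e'` is the compatibility of `Q` with the connection.

The bracket `[f, f']` is not a datum: it is forced. Jacobi against `B` makes its `F`-part the
commutator of vector fields, and Jacobi against `E` prescribes the contractions of its `Λ²E`-part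
through the curvature. As `Q` is non-degenerate and `2` is invertible, a bivector is determined by
its contractions (`eq_zero_of_contractions`); as the curvature is skew for `Q`, a bivector with the
required contractions exists (`contract_bivector`). The Jacobi identity on `F × F × F` is then
checked by contracting with `E`, a form of the Bianchi identity. This gives existence
(`LocalData.exists_poisson`) and, for an arbitrary map of generators, compatibility with brackets
(`IsStrictPoisson.map_bracket`). The latter yields uniqueness for the identity map and gluing for
restriction maps.

The contraction `π♭` is triangular for `B`, `E`, `F`: differentials of `F`, `E`, `B` detect
derivations on `B`, `E`, `F` through `α`, `Q` and the negative of `α`. With dual bases it is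
bijective when `α` and `Q` are (`LocalData.strictlyNondegenerate`). Conversely, hitting the
derivations that extend vector fields and linear forms on `E` and `F` forces `α` and `Q` to be
bijective (`IsStrictPoisson.exists_localData`).

A compatible differential is `Q(φ, -)` on `E` by non-degeneracy; compatibility with `[f, e]` gives
its value on `F`, so that it is `[φ, -]`. Its square is half of `[Q(φ, φ), -]`, which vanishes
exactly when `dQ(φ, φ) = 0`. -/

namespace GSym

/-! ### Generators of the algebra and their commutation rules. -/

section Generators

variable {B E F : Type*} [CommRing B] [AddCommGroup E] [Module B E] [AddCommGroup F] [Module B F]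

/-- `B[E[1] ⊕ F[2]]` is generated by its generators of degrees `0`, `1` and `2`. -/
lemma generators_induction {p : GSym B E F → Prop} (h₀ : ∀ b, p (ι₀ B E F b))
    (h₁ : ∀ e, p (ι₁ B E F e)) (h₂ : ∀ f, p (ι₂ B E F f)) (add : ∀ x y, p x → p y → p (x + y))
    (mul : ∀ x y, p x → p y → p (x * y)) (x : GSym B E F) : p x := by
  have hl : ∀ y, p (inl B E F y) := fun y => by
    induction y using ExteriorAlgebra.induction with
    | algebraMap r => rw [AlgHom.commutes]; exact h₀ r
    | ι e => exact h₁ e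
    | mul a b ha hb => rw [map_mul]; exact mul _ _ ha hb
    | add a b ha hb => rw [map_add]; exact add _ _ ha hb
  have hr : ∀ y, p (inr B E F y) := fun y => by
    induction y using SymmetricAlgebra.induction with
    | algebraMap r => rw [AlgHom.commutes]; exact h₀ r
    | ι e => exact h₂ e
    | mul a b ha hb => rw [map_mul]; exact mul _ _ ha hb
    | add a b ha hb => rw [map_add]; exact add _ _ ha hb
  have key : ∀ z : ExteriorAlgebra B E ⊗[B] SymmetricAlgebra B F, p z := fun z => by
    induction z using TensorProduct.induction_on with
    | zero => exact (map_zero (ι₀ B E F)) ▸ h₀ 0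
    | tmul a b =>
      have h : (a ⊗ₜ[B] 1 : ExteriorAlgebra B E ⊗[B] SymmetricAlgebra B F) * (1 ⊗ₜ[B] b) =
          a ⊗ₜ[B] b := by
        rw [Algebra.TensorProduct.tmul_mul_tmul, mul_one, one_mul]
      exact h ▸ mul _ _ (hl a) (hr b)
    | add a b ha hb => exact add _ _ ha hb
  exact key x

lemma ι₀_mul (b : B) (x : GSym B E F) : ι₀ B E F b * x = b • x := (Algebra.smul_def b x).symm

lemma commute_ι₀ (b : B) (x : GSym B E F) : Commute (ι₀ B E F b) x := Algebra.commutes b x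

lemma commute_ι₂ (f : F) (x : GSym B E F) : Commute (ι₂ B E F f) x := (commute_inr x _).symm

lemma ι₁_smul (b : B) (e : E) : ι₁ B E F (b • e) = ι₀ B E F b * ι₁ B E F e := by
  rw [map_smul, ι₀_mul]

lemma ι₂_smul (b : B) (f : F) : ι₂ B E F (b • f) = ι₀ B E F b * ι₂ B E F f := by
  rw [map_smul, ι₀_mul]

lemma ι₁_mul_swap (e e' : E) :
    ι₁ B E F e * ι₁ B E F e' = -(ι₁ B E F e' * ι₁ B E F e) := by
  have h := ι₁_mul_self (F := F) (B := B) (e + e')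
  rw [map_add, add_mul, mul_add, mul_add, ι₁_mul_self, ι₁_mul_self, zero_add, add_zero] at h
  exact eq_neg_of_add_eq_zero_left h

end Generators

/-! ### Universal property of the free graded-commutative algebra. -/

section Lift

variable {B E F S : Type*} [CommRing B] [AddCommGroup E] [Module B E] [AddCommGroup F] [Module B F]
  [Ring S]

/-- The universal property of `B[E[1] ⊕ F[2]]`. -/
theorem exists_ringHom (ρ : B →+* S) (g : E →+ S) (h : F →+ S)
    (hg : ∀ b e, g (b • e) = ρ b * g e) (hh : ∀ b f, h (b • f) = ρ b * h f)
    (hρg : ∀ b e, Commute (ρ b) (g e)) (hρh : ∀ b f, Commute (ρ b) (h f))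
    (hgg : ∀ e, g e * g e = 0) (hgh : ∀ e f, Commute (g e) (h f))
    (hhh : ∀ f f', Commute (h f) (h f')) :
    ∃ Φ : GSym B E F →+* S, (∀ b, Φ (ι₀ B E F b) = ρ b) ∧ (∀ e, Φ (ι₁ B E F e) = g e) ∧
      ∀ f, Φ (ι₂ B E F f) = h f := by
  -- `ρ` need not be central in `S`, so `S` is not a `B`-algebra. The centralizer of its image is
  -- one, and it contains the images of all generators.
  let C := Subring.centralizer (Set.range ρ)
  have memC : ∀ {x : S}, (∀ b, Commute (ρ b) x) → x ∈ C := fun hx => by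
    rw [Subring.mem_centralizer_iff]
    rintro _ ⟨b, rfl⟩
    exact hx b
  have hρρ : ∀ b b', Commute (ρ b) (ρ b') := fun b b' => by
    change ρ b * ρ b' = ρ b' * ρ b
    rw [← map_mul, mul_comm, map_mul]
  let ρ' : B →+* C := ρ.codRestrict C fun b => memC fun b' => hρρ b' b
  let _ : Algebra B C := ρ'.toAlgebra' fun b x => Subtype.ext <|
    (Subring.mem_centralizer_iff.mp x.2 (ρ b) ⟨b, rfl⟩)
  let g' : E →ₗ[B] C :=
    { toFun := fun e => ⟨g e, memC fun b => hρg b e⟩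
      map_add' := fun x y => Subtype.ext (map_add g x y)
      map_smul' := fun b x => Subtype.ext (hg b x) }
  let h' : F →ₗ[B] C :=
    { toFun := fun f => ⟨h f, memC fun b => hρh b f⟩
      map_add' := fun x y => Subtype.ext (map_add h x y)
      map_smul' := fun b x => Subtype.ext (hh b x) }
  let l : ExteriorAlgebra B E →ₐ[B] C := ExteriorAlgebra.lift B ⟨g', fun e => Subtype.ext (hgg e)⟩
  have comm : ∀ a ∈ Set.range h', ∀ b ∈ Set.range h', a * b = b * a := by
    rintro _ ⟨f, rfl⟩ _ ⟨f', rfl⟩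
    exact Subtype.ext (hhh f f')
  -- The target of a lift from a symmetric algebra must be commutative; the subalgebra generated by
  -- the commuting elements `h' f` is.
  let _ : CommRing (Algebra.adjoin B (Set.range h')) :=
    { (inferInstance : Ring (Algebra.adjoin B (Set.range h'))) with
      mul_comm := (Algebra.isMulCommutative_adjoin B comm).is_comm.comm }
  let s : SymmetricAlgebra B F →ₐ[B] Algebra.adjoin B (Set.range h') := SymmetricAlgebra.lift
    (h'.codRestrict (Subalgebra.toSubmodule (Algebra.adjoin B (Set.range h')))
      fun f => Algebra.subset_adjoin ⟨f, rfl⟩)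
  let s' : SymmetricAlgebra B F →ₐ[B] C := (Algebra.adjoin B (Set.range h')).val.comp s
  have hl : ∀ e, l (ExteriorAlgebra.ι B e) = g' e := fun e => ExteriorAlgebra.lift_ι_apply _ _ _ e
  have hs : ∀ f, s' (SymmetricAlgebra.ι B F f) = h' f := fun f =>
    congrArg Subtype.val (SymmetricAlgebra.lift_ι_apply _ f)
  have hcomm : ∀ x y, Commute (l x) (s' y) := fun x y => by
    induction y using SymmetricAlgebra.induction with
    | algebraMap r => rw [AlgHom.commutes]; exact (Algebra.commutes r _).symm
    | mul a b ha hb => rw [map_mul]; exact ha.mul_right hb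
    | add a b ha hb => rw [map_add]; exact ha.add_right hb
    | ι f =>
      rw [hs]
      induction x using ExteriorAlgebra.induction with
      | algebraMap r => rw [AlgHom.commutes]; exact Algebra.commutes r _
      | mul a b ha hb => rw [map_mul]; exact ha.mul_left hb
      | add a b ha hb => rw [map_add]; exact ha.add_left hb
      | ι e => rw [hl]; exact Subtype.ext (hgh e f)
  let Φ : ExteriorAlgebra B E ⊗[B] SymmetricAlgebra B F →ₐ[B] C :=
    Algebra.TensorProduct.lift l s' hcomm
  refine ⟨C.subtype.comp Φ.toRingHom, fun b => ?_, fun e => ?_, fun f => ?_⟩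
  · exact congrArg Subtype.val (Φ.commutes b)
  · have := Algebra.TensorProduct.lift_tmul l s' hcomm (ExteriorAlgebra.ι B e) 1
    rw [map_one, mul_one, hl] at this
    exact congrArg Subtype.val this
  · have := Algebra.TensorProduct.lift_tmul l s' hcomm 1 (SymmetricAlgebra.ι B F f)
    rw [map_one, one_mul, hs] at this
    exact congrArg Subtype.val this

end Lift

/-! ### The grading: multiplicativity, induction and low degrees. -/

section Grading

variable {B E F : Type*} [CommRing B] [AddCommGroup E] [Module B E] [AddCommGroup F] [Module B F]

lemma mem_gr_of {p q : ℕ} {n : ℤ} (h : (p : ℤ) + 2 * q = n) {x : GSym B E F}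
    (hx : x ∈ LinearMap.range (ι₁ B E F) ^ p * LinearMap.range (ι₂ B E F) ^ q) :
    x ∈ gr B E F n :=
  Submodule.mem_iSup_of_mem p <| Submodule.mem_iSup_of_mem q <| Submodule.mem_iSup_of_mem h hx

lemma ι₀_mem_gr (b : B) : ι₀ B E F b ∈ gr B E F 0 := by
  refine mem_gr_of (p := 0) (q := 0) (by simp) ?_
  rw [pow_zero, pow_zero, one_mul]
  exact Submodule.mem_one.mpr ⟨b, rfl⟩

lemma ι₁_mem_gr (e : E) : ι₁ B E F e ∈ gr B E F 1 := by
  refine mem_gr_of (p := 1) (q := 0) (by simp) ?_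
  rw [pow_zero, pow_one, mul_one]
  exact ⟨e, rfl⟩

lemma ι₂_mem_gr (f : F) : ι₂ B E F f ∈ gr B E F 2 := by
  refine mem_gr_of (p := 0) (q := 1) (by simp) ?_
  rw [pow_zero, pow_one, one_mul]
  exact ⟨f, rfl⟩

/-- Homogeneous elements are sums of products obtained from scalars by multiplication from the
left by generators of degrees `1` and `2`. -/
lemma gr_induction {p : ℤ → GSym B E F → Prop} (h₀ : ∀ b, p 0 (ι₀ B E F b))
    (h₁ : ∀ n e x, x ∈ gr B E F n → p n x → p (n + 1) (ι₁ B E F e * x))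
    (h₂ : ∀ n f x, x ∈ gr B E F n → p n x → p (n + 2) (ι₂ B E F f * x))
    (zero : ∀ n, p n 0)
    (add : ∀ n x y, x ∈ gr B E F n → y ∈ gr B E F n → p n x → p n y → p n (x + y))
    {n : ℤ} {x : GSym B E F} (hx : x ∈ gr B E F n) : p n x := by
  have hq : ∀ q : ℕ, ∀ x ∈ LinearMap.range (ι₂ B E F) ^ q, x ∈ gr B E F (2 * q) ∧ p (2 * q) x := by
    intro q
    induction q with
    | zero =>
      intro x hx
      rw [pow_zero] at hx
      obtain ⟨b, rfl⟩ := Submodule.mem_one.mp hx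
      exact ⟨by simpa using! ι₀_mem_gr b, by simpa using! h₀ b⟩
    | succ q ih =>
      intro x hx
      rw [pow_succ'] at hx
      refine Submodule.mul_induction_on hx ?_ ?_
      · rintro _ ⟨f, rfl⟩ y hy
        have e : (2 * (q + 1 : ℕ) : ℤ) = 2 * q + 2 := by push_cast; ring
        refine ⟨mem_gr_of (p := 0) (q := q + 1) (by simp) ?_, e ▸ h₂ _ f y (ih y hy).1 (ih y hy).2⟩
        rw [pow_zero, one_mul, pow_succ']
        exact Submodule.mul_mem_mul ⟨f, rfl⟩ hy
      · rintro x y ⟨hx, hx'⟩ ⟨hy, hy'⟩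
        exact ⟨add_mem hx hy, add _ _ _ hx hy hx' hy'⟩
  have hpq : ∀ p' q : ℕ, ∀ x ∈ LinearMap.range (ι₁ B E F) ^ p' * LinearMap.range (ι₂ B E F) ^ q,
      x ∈ gr B E F (p' + 2 * q) ∧ p (p' + 2 * q) x := by
    intro p' q
    induction p' with
    | zero =>
      intro x hx
      rw [pow_zero, one_mul] at hx
      simpa using hq q x hx
    | succ k ih =>
      intro x hx
      rw [pow_succ', mul_assoc] at hx
      refine Submodule.mul_induction_on hx ?_ ?_
      · rintro _ ⟨f, rfl⟩ y hy
        have e : ((k + 1 : ℕ) + 2 * q : ℤ) = k + 2 * q + 1 := by push_cast; ring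
        refine ⟨mem_gr_of (p := k + 1) (q := q) rfl ?_, e ▸ h₁ _ f y (ih y hy).1 (ih y hy).2⟩
        rw [pow_succ', mul_assoc]
        exact Submodule.mul_mem_mul ⟨f, rfl⟩ hy
      · rintro x y ⟨hx, hx'⟩ ⟨hy, hy'⟩
        exact ⟨add_mem hx hy, add _ _ _ hx hy hx' hy'⟩
  have key : x ∈ gr B E F n ∧ p n x := by
    unfold gr at hx
    simp_rw [iSup_sigma', iSup_psigma'] at hx
    refine Submodule.iSup_induction (motive := fun x => x ∈ gr B E F n ∧ p n x) _ hx ?_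
      ⟨zero_mem _, zero n⟩ ?_
    · rintro ⟨⟨a, b⟩, h⟩ x hx
      dsimp at h hx
      exact h ▸ hpq a b x hx
    · rintro x y ⟨hx, hx'⟩ ⟨hy, hy'⟩
      exact ⟨add_mem hx hy, add _ _ _ hx hy hx' hy'⟩
  exact key.2

lemma ι₁_mul_mem_gr (e : E) {n : ℤ} {x : GSym B E F} (hx : x ∈ gr B E F n) :
    ι₁ B E F e * x ∈ gr B E F (n + 1) := by
  unfold gr at hx
  simp_rw [iSup_sigma', iSup_psigma'] at hx
  refine Submodule.iSup_induction (motive := fun x => ι₁ B E F e * x ∈ gr B E F (n + 1)) _ hx ?_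
    (by simp) (fun x y hx hy => by rw [mul_add]; exact add_mem hx hy)
  rintro ⟨⟨a, b⟩, h⟩ x hx
  dsimp at h hx
  refine mem_gr_of (p := a + 1) (q := b) (by rw [← h]; push_cast; ring) ?_
  rw [pow_succ', mul_assoc]
  exact Submodule.mul_mem_mul ⟨e, rfl⟩ hx

lemma ι₂_mul_mem_gr (f : F) {n : ℤ} {x : GSym B E F} (hx : x ∈ gr B E F n) :
    ι₂ B E F f * x ∈ gr B E F (n + 2) := by
  unfold gr at hx
  simp_rw [iSup_sigma', iSup_psigma'] at hx
  refine Submodule.iSup_induction (motive := fun x => ι₂ B E F f * x ∈ gr B E F (n + 2)) _ hx ?_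
    (by simp) (fun x y hx hy => by rw [mul_add]; exact add_mem hx hy)
  rintro ⟨⟨a, b⟩, h⟩ x hx
  dsimp at h hx
  refine mem_gr_of (p := a) (q := b + 1) (by rw [← h]; push_cast; ring) ?_
  refine Submodule.mul_induction_on hx ?_ fun x y hx hy => by rw [mul_add]; exact add_mem hx hy
  intro x hx y hy
  rw [← mul_assoc, (commute_ι₂ f x).eq, mul_assoc, pow_succ']
  exact Submodule.mul_mem_mul hx (Submodule.mul_mem_mul ⟨f, rfl⟩ hy)

lemma mul_mem_gr {m n : ℤ} {x y : GSym B E F} (hx : x ∈ gr B E F m) (hy : y ∈ gr B E F n) :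
    x * y ∈ gr B E F (m + n) := by
  refine gr_induction (p := fun m x => x * y ∈ gr B E F (m + n)) ?_ ?_ ?_ ?_ ?_ hx
  · intro b
    rw [ι₀_mul, zero_add]
    exact Submodule.smul_mem _ _ hy
  · intro k e x _ h
    rw [mul_assoc, add_right_comm]
    exact ι₁_mul_mem_gr e h
  · intro k f x _ h
    rw [mul_assoc, add_right_comm]
    exact ι₂_mul_mem_gr f h
  · simp
  · intro k x y _ _ hx hy
    rw [add_mul]
    exact add_mem hx hy

lemma iSup_gr : ⨆ n, gr B E F n = ⊤ := by
  rw [eq_top_iff]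
  rintro x -
  have hmem : ∀ (n : ℤ) (x : GSym B E F), x ∈ gr B E F n → x ∈ ⨆ n, gr B E F n :=
    fun n x hx => Submodule.mem_iSup_of_mem n hx
  induction x using generators_induction with
  | h₀ b => exact hmem 0 _ (ι₀_mem_gr b)
  | h₁ b => exact hmem 1 _ (ι₁_mem_gr b)
  | h₂ b => exact hmem 2 _ (ι₂_mem_gr b)
  | add a b ha hb => exact add_mem ha hb
  | mul a b ha hb =>
    refine Submodule.iSup_induction _ (motive := fun a => a * b ∈ ⨆ n, gr B E F n) ha ?_ (by simp)
      fun x y hx hy => by rw [add_mul]; exact add_mem hx hy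
    intro m x hx
    refine Submodule.iSup_induction _ (motive := fun b => x * b ∈ ⨆ n, gr B E F n) hb ?_ (by simp)
      fun x y hx hy => by rw [mul_add]; exact add_mem hx hy
    intro n y hy
    exact hmem _ _ (mul_mem_gr hx hy)

/-- Every element is a sum of homogeneous elements. -/
lemma homogeneous_induction {p : GSym B E F → Prop} (h : ∀ n, ∀ x ∈ gr B E F n, p x)
    (add : ∀ x y, p x → p y → p (x + y)) (x : GSym B E F) : p x :=
  Submodule.iSup_induction _ (motive := p) (by rw [iSup_gr]; trivial : x ∈ ⨆ n, gr B E F n) h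
    (h 0 0 (zero_mem _)) add

/-- No generator has negative degree, so the supremum defining this piece is empty. This is what
makes most brackets of generators vanish. -/
lemma gr_of_neg {n : ℤ} (hn : n < 0) {x : GSym B E F} (hx : x ∈ gr B E F n) : x = 0 := by
  have : gr B E F n = ⊥ := by
    unfold gr
    simp_rw [iSup_eq_bot]
    intro p q h
    omega
  rwa [this, Submodule.mem_bot] at hx

lemma mem_gr_zero {x : GSym B E F} (hx : x ∈ gr B E F 0) : ∃ b, x = ι₀ B E F b := by
  have : gr B E F 0 ≤ 1 := by
    unfold gr
    refine iSup_le fun p => iSup_le fun q => iSup_le fun h => ?_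
    obtain ⟨rfl, rfl⟩ : p = 0 ∧ q = 0 := by omega
    simp
  obtain ⟨b, hb⟩ := Submodule.mem_one.mp (this hx)
  exact ⟨b, hb.symm⟩

lemma mem_gr_one {x : GSym B E F} (hx : x ∈ gr B E F 1) : ∃ e, x = ι₁ B E F e := by
  have : gr B E F 1 ≤ LinearMap.range (ι₁ B E F) := by
    unfold gr
    refine iSup_le fun p => iSup_le fun q => iSup_le fun h => ?_
    obtain ⟨rfl, rfl⟩ : p = 1 ∧ q = 0 := by omega
    simp
  obtain ⟨b, hb⟩ := this hx
  exact ⟨b, hb.symm⟩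

/-- The equation `p + 2q = 2` has the two solutions `(0, 1)` and `(2, 0)`. For a bracket `[f, f']`
the two summands will be the commutator of vector fields and the curvature. -/
lemma mem_gr_two {x : GSym B E F} (hx : x ∈ gr B E F 2) :
    ∃ f, ∃ w ∈ LinearMap.range (ι₁ B E F) ^ 2, x = ι₂ B E F f + w := by
  have : gr B E F 2 ≤ LinearMap.range (ι₂ B E F) ⊔ LinearMap.range (ι₁ B E F) ^ 2 := by
    unfold gr
    refine iSup_le fun p => iSup_le fun q => iSup_le fun h => ?_
    obtain ⟨rfl, rfl⟩ | ⟨rfl, rfl⟩ : (p = 2 ∧ q = 0) ∨ (p = 0 ∧ q = 1) := by omega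
    · simp
    · simp
  obtain ⟨_, ⟨f, rfl⟩, w, hw, h⟩ := Submodule.mem_sup.mp (this hx)
  exact ⟨f, w, hw, h.symm⟩

lemma sq_range_ι₁_le_gr : LinearMap.range (ι₁ B E F) ^ 2 ≤ gr B E F 2 := fun x hx =>
  mem_gr_of (p := 2) (q := 0) (by simp) (by simpa using hx)

end Grading

/-! ### Projections to degrees 0 and 1, and injectivity of the inclusions. -/

section Retractions

variable (B E F : Type*) [CommRing B] [AddCommGroup E] [Module B E] [AddCommGroup F] [Module B F]

/-- The augmentation `B[E[1] ⊕ F[2]] → B`. -/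
noncomputable def r₀ : GSym B E F →ₐ[B] B :=
  (Algebra.TensorProduct.lift ExteriorAlgebra.algebraMapInv SymmetricAlgebra.algebraMapInv
    fun _ _ => Commute.all _ _ : ExteriorAlgebra B E ⊗[B] SymmetricAlgebra B F →ₐ[B] B)

/-- The projection `B[E[1] ⊕ F[2]] → E` onto the degree `1` part. -/
noncomputable def r₁ : GSym B E F →ₗ[B] E :=
  ((TensorProduct.rid B E).toLinearMap ∘ₗ TensorProduct.map ExteriorAlgebra.ιInv
    SymmetricAlgebra.algebraMapInv.toLinearMap :
      ExteriorAlgebra B E ⊗[B] SymmetricAlgebra B F →ₗ[B] E)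

variable {B E F}

lemma r₀_ι₀ (b : B) : r₀ B E F (ι₀ B E F b) = b := (r₀ B E F).commutes b

lemma r₀_ι₁ (e : E) : r₀ B E F (ι₁ B E F e) = 0 := by
  refine (Algebra.TensorProduct.lift_tmul _ _ _ _ _).trans ?_
  simp [ExteriorAlgebra.algebraMapInv]

lemma r₀_ι₂ (f : F) : r₀ B E F (ι₂ B E F f) = 0 := by
  refine (Algebra.TensorProduct.lift_tmul _ _ _ _ _).trans ?_
  rw [map_one, one_mul, SymmetricAlgebra.algebraMapInv_ι]

lemma r₁_ι₁ (e : E) : r₁ B E F (ι₁ B E F e) = e := by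
  change (TensorProduct.rid B E) (TensorProduct.map ExteriorAlgebra.ιInv
    SymmetricAlgebra.algebraMapInv.toLinearMap (ExteriorAlgebra.ι B e ⊗ₜ 1)) = e
  rw [TensorProduct.map_tmul]
  simp [ExteriorAlgebra.ι_leftInverse e]

lemma ι₀_injective : Function.Injective (ι₀ B E F) :=
  Function.LeftInverse.injective r₀_ι₀

lemma ι₁_injective : Function.Injective (ι₁ B E F) :=
  Function.LeftInverse.injective r₁_ι₁

lemma ι₀_r₀ {x : GSym B E F} (hx : x ∈ gr B E F 0) : ι₀ B E F (r₀ B E F x) = x := by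
  obtain ⟨b, rfl⟩ := mem_gr_zero hx
  rw [r₀_ι₀]

lemma ι₁_r₁ {x : GSym B E F} (hx : x ∈ gr B E F 1) : ι₁ B E F (r₁ B E F x) = x := by
  obtain ⟨b, rfl⟩ := mem_gr_one hx
  rw [r₁_ι₁]

lemma r₀_of_mem_gr {n : ℤ} (hn : n ≠ 0) {x : GSym B E F} (hx : x ∈ gr B E F n) :
    r₀ B E F x = 0 := by
  refine gr_induction (p := fun n x => n ≠ 0 → r₀ B E F x = 0) ?_ ?_ ?_ ?_ ?_ hx hn
  · intro b h; exact absurd rfl h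
  · intro n e x _ _ _
    rw [map_mul, r₀_ι₁, zero_mul]
  · intro n e x _ _ _
    rw [map_mul, r₀_ι₂, zero_mul]
  · simp
  · intro n x y _ _ hx hy hn
    rw [map_add, hx hn, hy hn, add_zero]

end Retractions

/-! ### The sign automorphism and graded commutativity. -/

section Signs

variable {B E F : Type*} [CommRing B] [AddCommGroup E] [Module B E] [AddCommGroup F] [Module B F]

lemma map_sign_smul {M N : Type*} [AddCommGroup M] [AddCommGroup N] (f : M →+ N) (s : ℤˣ) (x : M) :
    f (s • x) = s • f x := by
  rcases Int.units_eq_one_or s with h | h <;> simp [h]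

lemma sign_smul_mem_gr (s : ℤˣ) {n : ℤ} {x : GSym B E F} (hx : x ∈ gr B E F n) :
    s • x ∈ gr B E F n := by
  rcases Int.units_eq_one_or s with h | h <;> simpa [h] using hx

variable (B E F) in
/-- The sign automorphism: multiplication by `(-1) ^ (k * n)` in degree `n`. -/
noncomputable def sgn (k : ℤ) : GSym B E F →+* GSym B E F :=
  map (RingHom.id B) (k.negOnePow • LinearMap.id) LinearMap.id

lemma sgn_ι₀ (k : ℤ) (b : B) : sgn B E F k (ι₀ B E F b) = ι₀ B E F b := map_ι₀ _ _ _ b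

lemma sgn_ι₁ (k : ℤ) (e : E) : sgn B E F k (ι₁ B E F e) = k.negOnePow • ι₁ B E F e := by
  refine (map_ι₁ _ _ _ e).trans ?_
  rw [LinearMap.smul_apply, LinearMap.id_apply]
  exact map_sign_smul (ι₁ B E F).toAddMonoidHom _ _

lemma sgn_ι₂ (k : ℤ) (f : F) : sgn B E F k (ι₂ B E F f) = ι₂ B E F f := map_ι₂ _ _ _ f

lemma sgn_of_mem_gr (k : ℤ) {n : ℤ} {x : GSym B E F} (hx : x ∈ gr B E F n) :
    sgn B E F k x = (k * n).negOnePow • x := by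
  refine gr_induction (p := fun n x => sgn B E F k x = (k * n).negOnePow • x) ?_ ?_ ?_ ?_ ?_ hx
  · intro b
    simp [sgn_ι₀]
  · intro n e x _ h
    rw [map_mul, h, sgn_ι₁, smul_mul_smul_comm, mul_add, Int.negOnePow_add, mul_one, mul_comm]
  · intro n e x _ h
    rw [map_mul, h, sgn_ι₂, mul_add, Int.negOnePow_add, mul_smul_comm,
      Int.negOnePow_even (k * 2) (by simp), mul_one]
  · simp
  · intro n x y _ _ hx hy
    rw [map_add, hx, hy, smul_add]

/-- Graded commutativity. -/
lemma mul_eq_sgn_mul {n : ℤ} {y : GSym B E F} (hy : y ∈ gr B E F n) (x : GSym B E F) :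
    y * x = sgn B E F n x * y := by
  induction x using generators_induction with
  | h₀ b => rw [sgn_ι₀, (commute_ι₀ b y).eq]
  | h₂ f => rw [sgn_ι₂, (commute_ι₂ f y).eq]
  | add a b ha hb => rw [mul_add, map_add, add_mul, ha, hb]
  | mul a b ha hb => rw [map_mul, ← mul_assoc, ha, mul_assoc, hb, mul_assoc]
  | h₁ e =>
    rw [sgn_ι₁]
    refine gr_induction (p := fun n y => y * ι₁ B E F e = n.negOnePow • ι₁ B E F e * y)
      ?_ ?_ ?_ ?_ ?_ hy
    · intro b
      rw [(commute_ι₀ b _).eq]; simp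
    · intro n e' x _ h
      rw [mul_assoc, h, Int.negOnePow_add, Int.negOnePow_one, smul_mul_assoc, mul_smul_comm,
        ← mul_assoc, ι₁_mul_swap, mul_neg_one, smul_mul_assoc]
      simp [mul_assoc]
    · intro n f x _ h
      rw [mul_assoc, h, Int.negOnePow_add, Int.negOnePow_even 2 (by simp), mul_one,
        ← mul_assoc, (commute_ι₂ f _).eq, mul_assoc]
    · simp
    · intro n x y _ _ hx hy
      rw [add_mul, hx, hy, mul_add]

lemma mul_comm_sign {m n : ℤ} {x y : GSym B E F} (hx : x ∈ gr B E F m) (hy : y ∈ gr B E F n) :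
    x * y = (m * n).negOnePow • (y * x) := by
  rw [mul_eq_sgn_mul hx, sgn_of_mem_gr m hy, smul_mul_assoc]

end Signs

/-! ### The algebra is the direct sum of its graded pieces. -/

section Decomposition

variable {B E F : Type*} [CommRing B] [AddCommGroup E] [Module B E] [AddCommGroup F] [Module B F]

-- The ring homomorphism to Laurent polynomials that multiplies a generator of degree `d` by `T ^ d`
-- sends `x` of degree `n` to `x T ^ n`; its coefficients are the projections. This proves that the
-- pieces, defined only as suprema of submodules, are independent.
open LaurentPolynomial in
lemma exists_projection : ∃ P : ℤ → GSym B E F →+ GSym B E F,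
    (∀ n, ∀ x ∈ gr B E F n, P n x = x) ∧ ∀ m n, m ≠ n → ∀ x ∈ gr B E F n, P m x = 0 := by
  have hT : ∀ (n : ℤ) (x : GSym B E F), (T n : (GSym B E F)[T;T⁻¹]) * C x = C x * T n :=
    fun n x => (commute_T n (C x)).eq
  have hcomm : ∀ (m n : ℤ) (x y : GSym B E F), Commute x y →
      Commute (C x * T m : (GSym B E F)[T;T⁻¹]) (C y * T n) := fun m n x y h => by
    refine Commute.mul_left (Commute.mul_right (h.map C) (commute_T n _).symm)
      (Commute.mul_right (commute_T m _) (commute_T m _))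
  obtain ⟨Φ, h₀, h₁, h₂⟩ := exists_ringHom (S := (GSym B E F)[T;T⁻¹])
    (C.comp (ι₀ B E F))
    ((AddMonoidHom.mulRight (T 1)).comp ((C : GSym B E F →+* _).toAddMonoidHom.comp
      (ι₁ B E F).toAddMonoidHom))
    ((AddMonoidHom.mulRight (T 2)).comp ((C : GSym B E F →+* _).toAddMonoidHom.comp
      (ι₂ B E F).toAddMonoidHom))
    (fun b e => by
      change C (ι₁ B E F (b • e)) * T 1 = C (ι₀ B E F b) * (C (ι₁ B E F e) * T 1)
      rw [ι₁_smul, map_mul, mul_assoc])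
    (fun b e => by
      change C (ι₂ B E F (b • e)) * T 2 = C (ι₀ B E F b) * (C (ι₂ B E F e) * T 2)
      rw [ι₂_smul, map_mul, mul_assoc])
    (fun b e => by simpa using! hcomm 0 1 _ _ (commute_ι₀ b (ι₁ B E F e)))
    (fun b e => by simpa using! hcomm 0 2 _ _ (commute_ι₀ b (ι₂ B E F e)))
    (fun e => by
      change C (ι₁ B E F e) * T 1 * (C (ι₁ B E F e) * T 1) = 0
      rw [mul_assoc, ← mul_assoc (T 1), hT, mul_assoc, ← mul_assoc (C _), ← map_mul, ι₁_mul_self,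
        map_zero, zero_mul])
    (fun e f => hcomm _ _ _ _ (commute_ι₂ f (ι₁ B E F e)).symm)
    (fun e f => hcomm _ _ _ _ (commute_ι₂ e (ι₂ B E F f)))
  have key : ∀ n, ∀ x ∈ gr B E F n, Φ x = C x * T n := fun n x hx => by
    refine gr_induction (p := fun n x => Φ x = C x * T n) ?_ ?_ ?_ ?_ ?_ hx
    · intro b
      rw [h₀]; simp
    · intro n e x _ h
      rw [map_mul, h, h₁]
      change C (ι₁ B E F e) * T 1 * (C x * T n) = _
      rw [mul_assoc, ← mul_assoc (T 1), hT, map_mul, add_comm, T_add]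
      simp only [mul_assoc]
    · intro n e x _ h
      rw [map_mul, h, h₂]
      change C (ι₂ B E F e) * T 2 * (C x * T n) = _
      rw [mul_assoc, ← mul_assoc (T 2), hT, map_mul, add_comm, T_add]
      simp only [mul_assoc]
    · simp
    · intro n x y _ _ hx hy
      rw [map_add, hx, hy, map_add, add_mul]
  refine ⟨fun n => (Finsupp.applyAddHom n).comp
    (AddMonoidAlgebra.coeffAddEquiv.toAddMonoidHom.comp Φ.toAddMonoidHom),
    fun n x hx => ?_, fun m n hmn x hx => ?_⟩
  · change (Φ x).coeff n = x
    rw [key n x hx, ← single_eq_C_mul_T]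
    exact Finsupp.single_eq_same
  · change (Φ x).coeff m = 0
    rw [key n x hx, ← single_eq_C_mul_T]
    exact Finsupp.single_eq_of_ne hmn

/-- Additive maps out of `B[E[1] ⊕ F[2]]` may be prescribed degree by degree. -/
lemma exists_addMonoidHom {M : Type*} [AddCommGroup M] (f : ∀ n, gr B E F n →+ M) :
    ∃ g : GSym B E F →+ M, ∀ n (x : gr B E F n), g x = f n x := by
  classical
  obtain ⟨P, hP, hP'⟩ := exists_projection (B := B) (E := E) (F := F)
  let c : DirectSum ℤ (fun n => gr B E F n) →+ GSym B E F :=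
    DirectSum.toAddMonoid fun n => (gr B E F n).subtype.toAddMonoidHom
  have hc : ∀ n (x : gr B E F n), c (DirectSum.of (fun n => gr B E F n) n x) = x := fun n x => by
    simp [c]
  have hPc : ∀ n x, P n (c x) = x n := fun n x => by
    induction x using DirectSum.induction_on with
    | zero => simp
    | of i y =>
      rw [hc]
      by_cases h : n = i
      · subst h; rw [hP _ _ y.2, DirectSum.of_eq_same]
      · rw [hP' n i h _ y.2, DirectSum.of_eq_of_ne _ _ _ h]; rfl
    | add x y hx hy => simp [hx, hy]
  have hinj : Function.Injective c := (injective_iff_map_eq_zero c).mpr fun x hx => by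
    refine DFinsupp.ext fun n => Subtype.ext ?_
    have := hPc n x
    rw [hx, map_zero] at this
    exact this.symm
  have hsurj : Function.Surjective c := fun x => by
    induction x using homogeneous_induction with
    | h n x hx => exact ⟨_, hc n ⟨x, hx⟩⟩
    | add x y hx hy =>
      obtain ⟨a, rfl⟩ := hx
      obtain ⟨b, rfl⟩ := hy
      exact ⟨a + b, map_add _ _ _⟩
  let ce := AddEquiv.ofBijective c ⟨hinj, hsurj⟩
  refine ⟨(DirectSum.toAddMonoid f).comp ce.symm.toAddMonoidHom, fun n x => ?_⟩
  have : ce.symm (x : GSym B E F) = DirectSum.of (fun n => gr B E F n) n x :=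
    ce.symm_apply_eq.mpr (hc n x).symm
  simp [this]

end Decomposition

end GSym

namespace GSym

/-! ### Graded derivations: uniqueness, construction and operations. -/

section Derivations

variable {R B E F : Type*} [CommRing R] [CommRing B] [Algebra R B]
  [AddCommGroup E] [Module B E] [AddCommGroup F] [Module B F]

/-- Two graded derivations along a ring homomorphism agree if they agree on generators. -/
lemma eq_of_leibniz {S : Type*} [Ring S] (ψ : GSym B E F →+* S) (k : ℤ) {D D' : GSym B E F →+ S}
    (hD : ∀ n, ∀ a ∈ gr B E F n, ∀ b, D (a * b) = D a * ψ b + (k * n).negOnePow • (ψ a * D b))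
    (hD' : ∀ n, ∀ a ∈ gr B E F n, ∀ b, D' (a * b) = D' a * ψ b + (k * n).negOnePow • (ψ a * D' b))
    (h₀ : ∀ b, D (ι₀ B E F b) = D' (ι₀ B E F b)) (h₁ : ∀ e, D (ι₁ B E F e) = D' (ι₁ B E F e))
    (h₂ : ∀ f, D (ι₂ B E F f) = D' (ι₂ B E F f)) : D = D' := by
  ext x
  induction x using homogeneous_induction with
  | add x y hx hy => rw [map_add, map_add, hx, hy]
  | h n x hx =>
    refine gr_induction (p := fun n x => D x = D' x) ?_ ?_ ?_ ?_ ?_ hx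
    · exact h₀
    · intro n e x _ h
      rw [hD 1 _ (ι₁_mem_gr e), hD' 1 _ (ι₁_mem_gr e), h, h₁]
    · intro n f x _ h
      rw [hD 2 _ (ι₂_mem_gr f), hD' 2 _ (ι₂_mem_gr f), h, h₂]
    · simp
    · intro n x y _ _ hx hy
      rw [map_add, map_add, hx, hy]

lemma IsGradedDerivation.ext {k : ℤ} {D D' : GSym B E F →+ GSym B E F}
    (hD : IsGradedDerivation R k D) (hD' : IsGradedDerivation R k D')
    (h₀ : ∀ b, D (ι₀ B E F b) = D' (ι₀ B E F b)) (h₁ : ∀ e, D (ι₁ B E F e) = D' (ι₁ B E F e))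
    (h₂ : ∀ f, D (ι₂ B E F f) = D' (ι₂ B E F f)) : D = D' :=
  eq_of_leibniz (RingHom.id _) k hD.leibniz hD'.leibniz h₀ h₁ h₂

/-- A map satisfying the Leibniz rule which has degree `k` on generators is a graded derivation. -/
lemma isGradedDerivation_of_sgn {k : ℤ} {D : GSym B E F →+ GSym B E F}
    (hbase : ∀ r : R, D (ι₀ B E F (algebraMap R B r)) = 0)
    (hD : ∀ a b, D (a * b) = D a * b + sgn B E F k a * D b)
    (h₀ : ∀ b, D (ι₀ B E F b) ∈ gr B E F k) (h₁ : ∀ e, D (ι₁ B E F e) ∈ gr B E F (1 + k))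
    (h₂ : ∀ f, D (ι₂ B E F f) ∈ gr B E F (2 + k)) : IsGradedDerivation R k D where
  map_base := hbase
  leibniz n a ha b := by rw [hD, sgn_of_mem_gr k ha, smul_mul_assoc]
  map_gr n a ha := by
    refine gr_induction (p := fun n a => D a ∈ gr B E F (n + k)) ?_ ?_ ?_ ?_ ?_ ha
    · intro b
      rw [zero_add]
      exact h₀ b
    · intro n e x hx h
      rw [hD, sgn_ι₁, smul_mul_assoc]
      have e₁ : n + 1 + k = 1 + k + n := by ring
      have e₂ : n + 1 + k = n + k + 1 := by ring
      exact add_mem (e₁ ▸ mul_mem_gr (h₁ e) hx) (e₂ ▸ sign_smul_mem_gr _ (ι₁_mul_mem_gr e h))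
    · intro n f x hx h
      rw [hD, sgn_ι₂]
      have e₁ : n + 2 + k = 2 + k + n := by ring
      have e₂ : n + 2 + k = n + k + 2 := by ring
      exact add_mem (e₁ ▸ mul_mem_gr (h₂ f) hx) (e₂ ▸ ι₂_mul_mem_gr f h)
    · intro n
      rw [map_zero]
      exact zero_mem _
    · intro n x y _ _ hx hy
      rw [map_add]
      exact add_mem hx hy

/-- Graded derivations of `B[E[1] ⊕ F[2]]` may be prescribed on generators. -/
theorem exists_isGradedDerivation (k : ℤ) (d₀ : B →+ GSym B E F) (d₁ : E →+ GSym B E F)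
    (d₂ : F →+ GSym B E F) (hbase : ∀ r : R, d₀ (algebraMap R B r) = 0)
    (h₀ : ∀ b, d₀ b ∈ gr B E F k) (h₁ : ∀ e, d₁ e ∈ gr B E F (1 + k))
    (h₂ : ∀ f, d₂ f ∈ gr B E F (2 + k))
    (h₀₀ : ∀ b b', d₀ (b * b') = d₀ b * ι₀ B E F b' + ι₀ B E F b * d₀ b')
    (h₀₁ : ∀ b e, d₁ (b • e) = d₀ b * ι₁ B E F e + ι₀ B E F b * d₁ e)
    (h₀₂ : ∀ b f, d₂ (b • f) = d₀ b * ι₂ B E F f + ι₀ B E F b * d₂ f) :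
    ∃ D, IsGradedDerivation R k D ∧ (∀ b, D (ι₀ B E F b) = d₀ b) ∧
      (∀ e, D (ι₁ B E F e) = d₁ e) ∧ ∀ f, D (ι₂ B E F f) = d₂ f := by
  -- A derivation is the upper right entry of a ring homomorphism `x ↦ !![sgn x, D x; 0, x]`:
  -- multiplicativity of this entry is the graded Leibniz rule `D (a b) = sgn a * D b + D a * b`. So
  -- `exists_ringHom` applies.
  let ρ : B →+* Matrix (Fin 2) (Fin 2) (GSym B E F) :=
    { toFun := fun b => !![ι₀ B E F b, d₀ b; 0, ι₀ B E F b]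
      map_one' := by
        have h := h₀₀ 1 1
        simp only [mul_one, map_one, one_mul] at h
        have h' : d₀ 1 = 0 := by simpa using h
        simp [Matrix.one_fin_two, h']
      map_mul' := fun b b' => by
        simp [h₀₀, add_comm]
      map_zero' := by
        ext i j; fin_cases i <;> fin_cases j <;> simp
      map_add' := fun b b' => by
        ext i j; fin_cases i <;> fin_cases j <;> simp }
  let g : E →+ Matrix (Fin 2) (Fin 2) (GSym B E F) :=
    { toFun := fun e => !![sgn B E F k (ι₁ B E F e), d₁ e; 0, ι₁ B E F e]
      map_zero' := by
        ext i j; fin_cases i <;> fin_cases j <;> simp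
      map_add' := fun b b' => by
        ext i j; fin_cases i <;> fin_cases j <;> simp }
  let h : F →+ Matrix (Fin 2) (Fin 2) (GSym B E F) :=
    { toFun := fun f => !![ι₂ B E F f, d₂ f; 0, ι₂ B E F f]
      map_zero' := by
        ext i j; fin_cases i <;> fin_cases j <;> simp
      map_add' := fun b b' => by
        ext i j; fin_cases i <;> fin_cases j <;> simp }
  have hρ : ∀ b, ρ b = !![ι₀ B E F b, d₀ b; 0, ι₀ B E F b] := fun b => rfl
  have hg : ∀ b, g b = !![sgn B E F k (ι₁ B E F b), d₁ b; 0, ι₁ B E F b] := fun b => rfl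
  have hh : ∀ b, h b = !![ι₂ B E F b, d₂ b; 0, ι₂ B E F b] := fun b => rfl
  obtain ⟨Φ, hΦ₀, hΦ₁, hΦ₂⟩ := exists_ringHom ρ g h
    (fun b e => by
      rw [hρ, hg, hg, Matrix.mul_fin_two, h₀₁, ι₁_smul, map_mul, sgn_ι₀, add_comm]
      simp)
    (fun b e => by
      rw [hρ, hh, hh, Matrix.mul_fin_two, h₀₂, ι₂_smul, add_comm]
      simp)
    (fun b e => by
      change ρ b * g e = g e * ρ b
      rw [hρ, hg, Matrix.mul_fin_two, Matrix.mul_fin_two, (commute_ι₀ b _).eq,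
        (commute_ι₀ b (d₁ e)).eq, (commute_ι₀ b (ι₁ B E F e)).eq,
        mul_eq_sgn_mul (h₀ b) (ι₁ B E F e)]
      simp [add_comm])
    (fun b f => by
      change ρ b * h f = h f * ρ b
      rw [hρ, hh, Matrix.mul_fin_two, Matrix.mul_fin_two, (commute_ι₀ b _).eq,
        (commute_ι₀ b (d₂ f)).eq, (commute_ι₂ f (d₀ b)).eq]
      simp [add_comm])
    -- In the upper right entry, `d₁ e` has degree `1 + k`, so moving it past `e` gives the sign
    -- opposite to the one in `sgn e`, and the two terms cancel.
    (fun e => by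
      rw [hg, Matrix.mul_fin_two, mul_eq_sgn_mul (h₁ e) (ι₁ B E F e), ← map_mul, ι₁_mul_self,
        map_zero,
        sgn_ι₁, sgn_ι₁, Int.negOnePow_add]
      ext i j; fin_cases i <;> fin_cases j <;> simp)
    (fun e f => by
      change g e * h f = h f * g e
      rw [hg, hh, Matrix.mul_fin_two, Matrix.mul_fin_two, (commute_ι₂ f (d₁ e)).eq,
        (commute_ι₂ f _).eq, (commute_ι₂ f (ι₁ B E F e)).eq, mul_eq_sgn_mul (h₂ f) (ι₁ B E F e),
        sgn_ι₁, sgn_ι₁,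
        Int.negOnePow_add, Int.negOnePow_even 2 (by simp)]
      simp [add_comm])
    (fun f f' => by
      change h f * h f' = h f' * h f
      rw [hh, hh, Matrix.mul_fin_two, Matrix.mul_fin_two, (commute_ι₂ f (d₂ f')).eq,
        (commute_ι₂ f _).eq, (commute_ι₂ f' (d₂ f)).eq]
      simp [add_comm])
  have key : ∀ x, Φ x 0 0 = sgn B E F k x ∧ Φ x 1 0 = 0 ∧ Φ x 1 1 = x := fun x => by
    induction x using generators_induction with
    | h₀ b => rw [hΦ₀, hρ, sgn_ι₀]; simp
    | h₁ b => rw [hΦ₁, hg]; simp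
    | h₂ b => rw [hΦ₂, hh, sgn_ι₂]; simp
    | add a b ha hb => simp [ha, hb]
    | mul a b ha hb => simp [Matrix.mul_apply, ha, hb]
  let D : GSym B E F →+ GSym B E F :=
    (Matrix.entryAddMonoidHom _ 0 1).comp Φ.toAddMonoidHom
  have hD : ∀ x, D x = Φ x 0 1 := fun x => rfl
  have hDmul : ∀ a b, D (a * b) = D a * b + sgn B E F k a * D b := fun a b => by
    simp [hD, Matrix.mul_apply, key, add_comm]
  have hD₀ : ∀ b, D (ι₀ B E F b) = d₀ b := fun b => by rw [hD, hΦ₀, hρ]; simp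
  have hD₁ : ∀ b, D (ι₁ B E F b) = d₁ b := fun b => by rw [hD, hΦ₁, hg]; simp
  have hD₂ : ∀ b, D (ι₂ B E F b) = d₂ b := fun b => by rw [hD, hΦ₂, hh]; simp
  exact ⟨D, isGradedDerivation_of_sgn (fun r => by rw [hD₀, hbase]) hDmul
    (fun b => by rw [hD₀]; exact h₀ b) (fun b => by rw [hD₁]; exact h₁ b)
    (fun b => by rw [hD₂]; exact h₂ b), hD₀, hD₁, hD₂⟩

namespace IsGradedDerivation

variable {k l : ℤ} {D D' : GSym B E F →+ GSym B E F}

protected lemma zero : IsGradedDerivation R k (0 : GSym B E F →+ GSym B E F) where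
  map_base := by simp
  map_gr n a ha := zero_mem _
  leibniz n a ha b := by simp

protected lemma add (hD : IsGradedDerivation R k D) (hD' : IsGradedDerivation R k D') :
    IsGradedDerivation R k (D + D') where
  map_base r := by simp [hD.map_base, hD'.map_base]
  map_gr n a ha := add_mem (hD.map_gr n a ha) (hD'.map_gr n a ha)
  leibniz n a ha b := by
    simp only [AddMonoidHom.add_apply, hD.leibniz n a ha, hD'.leibniz n a ha, add_mul, mul_add,
      smul_add]
    abel

protected lemma sign_smul (s : ℤˣ) (hD : IsGradedDerivation R k D) :
    IsGradedDerivation R k (s • D) where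
  map_base r := by simp [hD.map_base]
  map_gr n a ha := sign_smul_mem_gr _ (hD.map_gr n a ha)
  leibniz n a ha b := by
    simp only [AddMonoidHom.smul_apply, hD.leibniz n a ha, smul_add, smul_mul_assoc, mul_smul_comm]
    rw [smul_comm s]

protected lemma neg (hD : IsGradedDerivation R k D) : IsGradedDerivation R k (-D) := by
  have := hD.sign_smul (-1)
  rwa [Units.neg_smul, one_smul] at this

protected lemma sub (hD : IsGradedDerivation R k D) (hD' : IsGradedDerivation R k D') :
    IsGradedDerivation R k (D - D') := by
  rw [sub_eq_add_neg]
  exact hD.add hD'.neg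

protected lemma sum {ι : Type*} (s : Finset ι) {D : ι → GSym B E F →+ GSym B E F}
    (hD : ∀ i ∈ s, IsGradedDerivation R k (D i)) : IsGradedDerivation R k (∑ i ∈ s, D i) := by
  classical
  induction s using Finset.induction_on with
  | empty => exact .zero
  | insert i s hi ih =>
    rw [Finset.sum_insert hi]
    exact (hD i (Finset.mem_insert_self i s)).add
      (ih fun j hj => hD j (Finset.mem_insert_of_mem hj))

protected lemma left_mul {m : ℤ} {a : GSym B E F} (ha : a ∈ gr B E F m)
    (hD : IsGradedDerivation R k D) : IsGradedDerivation R (m + k) (a • D) where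
  map_base r := by
    rw [AddMonoidHom.smul_apply, hD.map_base, smul_zero]
  map_gr n x hx := by
    have : n + (m + k) = m + (n + k) := by ring
    rw [this]
    exact mul_mem_gr ha (hD.map_gr n x hx)
  leibniz n x hx y := by
    simp only [AddMonoidHom.smul_apply, smul_eq_mul]
    rw [hD.leibniz n x hx, mul_add, mul_smul_comm, ← mul_assoc, ← mul_assoc,
      mul_comm_sign ha hx, smul_mul_assoc, smul_smul, add_mul, Int.negOnePow_add, mul_comm,
      mul_assoc x, mul_comm (m * n).negOnePow]

/-- The graded commutator of graded derivations is a graded derivation. -/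
protected lemma commutator (hD : IsGradedDerivation R k D) (hD' : IsGradedDerivation R l D') :
    IsGradedDerivation R (k + l) (D.comp D' - (k * l).negOnePow • D'.comp D) where
  map_base r := by simp [hD.map_base, hD'.map_base]
  map_gr n x hx := by
    have e₁ : n + (k + l) = n + l + k := by ring
    have e₂ : n + (k + l) = n + k + l := by ring
    exact sub_mem (e₁ ▸ hD.map_gr _ _ (hD'.map_gr _ _ hx))
      (sign_smul_mem_gr _ (e₂ ▸ hD'.map_gr _ _ (hD.map_gr _ _ hx)))
  leibniz n x hx y := by
    simp only [AddMonoidHom.sub_apply, AddMonoidHom.comp_apply, AddMonoidHom.smul_apply]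
    rw [hD'.leibniz n x hx, hD.leibniz n x hx, map_add, map_add, map_sign_smul, map_sign_smul,
      hD.leibniz n x hx, hD'.leibniz n x hx, hD.leibniz _ _ (hD'.map_gr n x hx),
      hD'.leibniz _ _ (hD.map_gr n x hx), mul_add, mul_add, add_mul, mul_comm l k,
      Int.negOnePow_add, Int.negOnePow_add, Int.negOnePow_add]
    rcases Int.units_eq_one_or (k * n).negOnePow with h | h <;>
    rcases Int.units_eq_one_or (l * n).negOnePow with h' | h' <;>
    rcases Int.units_eq_one_or (k * l).negOnePow with h'' | h'' <;>
    simp only [h, h', h'', one_smul, Units.neg_smul, mul_one, mul_neg, neg_neg, smul_add, smul_neg,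
      sub_mul, mul_sub, neg_mul] <;> abel

end IsGradedDerivation

end Derivations

end GSym

namespace GSym

/-! ### Poisson brackets from brackets of generators. -/

section Brackets

variable {R B E F : Type*} [CommRing R] [CommRing B] [Algebra R B]
  [AddCommGroup E] [Module B E] [AddCommGroup F] [Module B F]

/-- `y` is one of the generators of degree `d` of `B[E[1] ⊕ F[2]]`. -/
inductive IsGenerator : ℤ → GSym B E F → Prop
  | zero (b : B) : IsGenerator 0 (ι₀ B E F b)
  | one (e : E) : IsGenerator 1 (ι₁ B E F e)
  | two (f : F) : IsGenerator 2 (ι₂ B E F f)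

lemma IsGenerator.mem_gr {d : ℤ} {y : GSym B E F} (h : IsGenerator d y) : y ∈ gr B E F d := by
  cases h with
  | zero b => exact ι₀_mem_gr b
  | one b => exact ι₁_mem_gr b
  | two b => exact ι₂_mem_gr b

lemma IsGradedDerivation.ext_generator {k : ℤ} {D D' : GSym B E F →+ GSym B E F}
    (hD : IsGradedDerivation R k D) (hD' : IsGradedDerivation R k D')
    (h : ∀ d y, IsGenerator d y → D y = D' y) : D = D' :=
  hD.ext hD' (fun b => h _ _ (.zero b)) (fun b => h _ _ (.one b)) fun b => h _ _ (.two b)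

/-- Derivations `D₀ b = [b, -]`, `D₁ e = [e, -]`, `D₂ f = [f, -]` attached to the generators, which
come from a (unique) Poisson bracket. -/
structure GeneratorBrackets (R : Type*) [CommRing R] [Algebra R B]
    (D₀ : B →+ GSym B E F →+ GSym B E F) (D₁ : E →+ GSym B E F →+ GSym B E F)
    (D₂ : F →+ GSym B E F →+ GSym B E F) : Prop where
  deriv₀ : ∀ b, IsGradedDerivation R (-2) (D₀ b)
  deriv₁ : ∀ e, IsGradedDerivation R (-1) (D₁ e)
  deriv₂ : ∀ f, IsGradedDerivation R 0 (D₂ f)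
  base : ∀ r x, D₀ (algebraMap R B r) x = 0
  mul₀ : ∀ b b' x, D₀ (b * b') x = ι₀ B E F b * D₀ b' x + ι₀ B E F b' * D₀ b x
  smul₁ : ∀ b e x, D₁ (b • e) x = ι₀ B E F b * D₁ e x + ι₁ B E F e * D₀ b x
  smul₂ : ∀ b f x, D₂ (b • f) x = ι₀ B E F b * D₂ f x + ι₂ B E F f * D₀ b x
  skew₀₂ : ∀ b f, D₀ b (ι₂ B E F f) = -D₂ f (ι₀ B E F b)
  skew₁₁ : ∀ e e', D₁ e (ι₁ B E F e') = D₁ e' (ι₁ B E F e)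
  skew₁₂ : ∀ e f, D₁ e (ι₂ B E F f) = -D₂ f (ι₁ B E F e)
  skew₂₂ : ∀ f f', D₂ f (ι₂ B E F f') = -D₂ f' (ι₂ B E F f)
  -- As `[f, f']` is not a generator, `[[f, f'], b]` is expressed by skewness as `-[b, [f, f']]`;
  -- likewise below. No axiom is needed for triples of total degree below 4, whose double brackets
  -- have negative degree.
  jacobi₂₂₀ : ∀ f f' b, D₂ f (D₂ f' (ι₀ B E F b)) =
    -D₀ b (D₂ f (ι₂ B E F f')) + D₂ f' (D₂ f (ι₀ B E F b))
  jacobi₂₂₁ : ∀ f f' e, D₂ f (D₂ f' (ι₁ B E F e)) =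
    -D₁ e (D₂ f (ι₂ B E F f')) + D₂ f' (D₂ f (ι₁ B E F e))
  jacobi₂₂₂ : ∀ f f' f'', D₂ f (D₂ f' (ι₂ B E F f'')) =
    -D₂ f'' (D₂ f (ι₂ B E F f')) + D₂ f' (D₂ f (ι₂ B E F f''))
  jacobi₂₁₁ : ∀ f e e', D₂ f (D₁ e (ι₁ B E F e')) =
    D₁ e' (D₂ f (ι₁ B E F e)) + D₁ e (D₂ f (ι₁ B E F e'))

lemma negOnePow_sub_two_mul (m n : ℤ) : ((m - 2) * n).negOnePow = (m * n).negOnePow := by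
  rw [sub_mul, Int.negOnePow_sub, Int.negOnePow_even (2 * n) (by simp), mul_one]

lemma negOnePow_mul_sub_two (m n : ℤ) : (n * (m - 2)).negOnePow = (n * m).negOnePow := by
  rw [mul_comm, negOnePow_sub_two_mul, mul_comm]

variable {D₀ : B →+ GSym B E F →+ GSym B E F} {D₁ : E →+ GSym B E F →+ GSym B E F}
  {D₂ : F →+ GSym B E F →+ GSym B E F}

/-- Skewness dictates the values of `[a, -]` on generators. They extend to a derivation because
`D₀`, `D₁`, `D₂` obey the Leibniz rule in their first argument. -/
lemma GeneratorBrackets.exists_right_derivation (h : GeneratorBrackets R D₀ D₁ D₂) (m : ℤ)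
    {a : GSym B E F} (ha : a ∈ gr B E F m) :
    ∃ D, IsGradedDerivation R (m - 2) D ∧ (∀ b, D (ι₀ B E F b) = -D₀ b a) ∧
      (∀ e, D (ι₁ B E F e) = -(m.negOnePow • D₁ e a)) ∧ ∀ f, D (ι₂ B E F f) = -D₂ f a := by
  refine exists_isGradedDerivation (m - 2) (-D₀.flip a) (-(m.negOnePow • D₁.flip a)) (-D₂.flip a)
    ?_ ?_ ?_ ?_ ?_ ?_ ?_
  · intro r
    simpa using h.base r a
  · intro b
    exact neg_mem ((h.deriv₀ b).map_gr m a ha)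
  · intro e
    have e₁ : 1 + (m - 2) = m + -1 := by ring
    rw [e₁]
    exact neg_mem (sign_smul_mem_gr _ ((h.deriv₁ e).map_gr m a ha))
  · intro f
    have e₁ : 2 + (m - 2) = m + 0 := by ring
    rw [e₁]
    exact neg_mem ((h.deriv₂ f).map_gr m a ha)
  · intro b b'
    simp only [AddMonoidHom.neg_apply, AddMonoidHom.flip_apply]
    rw [h.mul₀, (commute_ι₀ b' _).eq]
    noncomm_ring
  · intro b e
    simp only [AddMonoidHom.neg_apply, AddMonoidHom.flip_apply, AddMonoidHom.smul_apply]
    rw [h.smul₁, smul_add, neg_mul,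
      mul_comm_sign ((h.deriv₀ b).map_gr m a ha) (ι₁_mem_gr e), mul_one, Int.negOnePow_add,
      Int.negOnePow_even (-2) (by simp), mul_one, mul_neg, mul_smul_comm]
    abel
  · intro b f
    simp only [AddMonoidHom.neg_apply, AddMonoidHom.flip_apply]
    rw [h.smul₂, (commute_ι₂ f _).eq]
    noncomm_ring

/-- The derivations `[a, -]` are unique, hence additive in `a` in each degree, and the degrees are
assembled by `exists_addMonoidHom`. -/
lemma GeneratorBrackets.exists_bracket (h : GeneratorBrackets R D₀ D₁ D₂) :
    ∃ π : GSym B E F →+ GSym B E F →+ GSym B E F, ∀ m, ∀ a ∈ gr B E F m,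
      IsGradedDerivation R (m - 2) (π a) ∧ (∀ b, π a (ι₀ B E F b) = -D₀ b a) ∧
      (∀ e, π a (ι₁ B E F e) = -(m.negOnePow • D₁ e a)) ∧ ∀ f, π a (ι₂ B E F f) = -D₂ f a := by
  choose D hD hD₀ hD₁ hD₂ using fun (m : ℤ) (a : gr B E F m) => h.exists_right_derivation m a.2
  obtain ⟨π, hπ⟩ := exists_addMonoidHom (B := B) (E := E) (F := F)
    (M := GSym B E F →+ GSym B E F) fun m =>
    { toFun := fun a => D m a
      map_zero' := (hD m 0).ext .zero (fun b => by simp [hD₀]) (fun b => by simp [hD₁])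
        (fun b => by simp [hD₂])
      map_add' := fun a b => (hD m (a + b)).ext ((hD m a).add (hD m b))
        (fun c => by simp [hD₀, add_comm]) (fun c => by simp [hD₁, add_comm])
        (fun c => by simp [hD₂, add_comm]) }
  have hπ' : ∀ m a (ha : a ∈ gr B E F m), π a = D m ⟨a, ha⟩ := fun m a ha => hπ m ⟨a, ha⟩
  refine ⟨π, fun m a ha => ?_⟩
  rw [hπ' m a ha]
  exact ⟨hD m ⟨a, ha⟩, hD₀ m ⟨a, ha⟩, hD₁ m ⟨a, ha⟩, hD₂ m ⟨a, ha⟩⟩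

section FromDerivations

variable {π : GSym B E F →+ GSym B E F →+ GSym B E F}

lemma bracket_mem_gr (hder : ∀ m, ∀ a ∈ gr B E F m, IsGradedDerivation R (m - 2) (π a)) {m n : ℤ}
    {a b : GSym B E F} (ha : a ∈ gr B E F m) (hb : b ∈ gr B E F n) :
    π a b ∈ gr B E F (m + n - 2) := by
  have e : m + n - 2 = n + (m - 2) := by ring
  rw [e]
  exact (hder m a ha).map_gr n b hb

/-- Both sides are derivations in `c` of the same degree, so `c` may be a generator; there skewness
turns the claim into the Leibniz rule for `[c, -]`. -/
lemma left_leibniz_of_generators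
    (hder : ∀ m, ∀ a ∈ gr B E F m, IsGradedDerivation R (m - 2) (π a))
    (hskew : ∀ m d, ∀ a ∈ gr B E F m, ∀ y, IsGenerator d y →
      π a y = -((m * d).negOnePow • π y a))
    {m n : ℤ} {a b : GSym B E F} (ha : a ∈ gr B E F m) (hb : b ∈ gr B E F n) (c : GSym B E F) :
    π (a * b) c = a * π b c + (m * n).negOnePow • (b * π a c) := by
  have e₁ : m + n - 2 = m + (n - 2) := by ring
  have e₂ : m + n - 2 = n + (m - 2) := by ring
  have key : π (a * b) = a • π b + (m * n).negOnePow • (b • π a) := by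
    refine (hder _ _ (mul_mem_gr ha hb)).ext_generator
      ((e₁ ▸ (hder n b hb).left_mul ha).add ((e₂ ▸ (hder m a ha).left_mul hb).sign_smul _)) ?_
    intro d y hy
    simp only [AddMonoidHom.add_apply, AddMonoidHom.smul_apply, smul_eq_mul]
    rw [hskew _ _ _ (mul_mem_gr ha hb) y hy, hskew _ _ _ ha y hy, hskew _ _ _ hb y hy,
      (hder d y hy.mem_gr).leibniz m a ha, negOnePow_sub_two_mul,
      mul_comm_sign (bracket_mem_gr hder hy.mem_gr ha) hb, negOnePow_sub_two_mul, add_mul, add_mul,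
      Int.negOnePow_add, Int.negOnePow_add, mul_comm d m, mul_comm d n]
    rcases Int.units_eq_one_or (m * n).negOnePow with h | h <;>
    rcases Int.units_eq_one_or (m * d).negOnePow with h' | h' <;>
    rcases Int.units_eq_one_or (n * d).negOnePow with h'' | h'' <;>
    simp only [h, h', h'', one_smul, Units.neg_smul, mul_one, mul_neg, neg_neg, smul_add, smul_neg,
      neg_add] <;> abel
  rw [key]
  rfl

/-- Skewness against generators propagates to products in the second argument, by the Leibniz rules
in both arguments. -/
lemma skew_of_generators
    (hder : ∀ m, ∀ a ∈ gr B E F m, IsGradedDerivation R (m - 2) (π a))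
    (hskew : ∀ m d, ∀ a ∈ gr B E F m, ∀ y, IsGenerator d y →
      π a y = -((m * d).negOnePow • π y a))
    {m n : ℤ} {a b : GSym B E F} (ha : a ∈ gr B E F m) (hb : b ∈ gr B E F n) :
    π a b = -((m * n).negOnePow • π b a) := by
  have step : ∀ d n y x, IsGenerator d y → x ∈ gr B E F n →
      π a x = -((m * n).negOnePow • π x a) →
      π a (y * x) = -((m * (n + d)).negOnePow • π (y * x) a) := by
    intro d n y x hy hx h
    rw [(hder m a ha).leibniz d y hy.mem_gr, left_leibniz_of_generators hder hskew hy.mem_gr hx,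
      h, hskew m d a ha y hy, negOnePow_sub_two_mul, mul_add, Int.negOnePow_add, neg_mul,
      smul_mul_assoc, mul_comm_sign (bracket_mem_gr hder hy.mem_gr ha) hx, negOnePow_sub_two_mul,
      add_mul, Int.negOnePow_add]
    rcases Int.units_eq_one_or (m * n).negOnePow with h | h <;>
    rcases Int.units_eq_one_or (m * d).negOnePow with h' | h' <;>
    rcases Int.units_eq_one_or (d * n).negOnePow with h'' | h'' <;>
    simp only [h, h', h'', one_smul, Units.neg_smul, mul_one, mul_neg, neg_neg, smul_add, smul_neg,
      neg_add] <;> abel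
  refine gr_induction (p := fun n b => π a b = -((m * n).negOnePow • π b a)) ?_ ?_ ?_ ?_ ?_ hb
  · intro b
    exact hskew m 0 a ha _ (.zero b)
  · intro n e x hx h
    exact step 1 n _ x (.one e) hx h
  · intro n f x hx h
    exact step 2 n _ x (.two f) hx h
  · simp
  · intro n x y _ _ hx hy
    rw [map_add, hx, hy, map_add, AddMonoidHom.add_apply, smul_add, neg_add]

/-- Together with `jacobi_swap_right`, this makes the Jacobi identities for all orderings of three
elements equivalent, so that only one ordering of each triple has to be checked. -/
lemma jacobi_swap_left
    (hskew : ∀ m n, ∀ a ∈ gr B E F m, ∀ b ∈ gr B E F n, π a b = -((m * n).negOnePow • π b a))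
    {m n : ℤ} {a b c : GSym B E F} (ha : a ∈ gr B E F m) (hb : b ∈ gr B E F n)
    (h : π a (π b c) = π (π a b) c + (m * n).negOnePow • π b (π a c)) :
    π b (π a c) = π (π b a) c + (n * m).negOnePow • π a (π b c) := by
  rw [h, hskew n m b hb a ha, map_neg, AddMonoidHom.neg_apply, map_sign_smul,
    AddMonoidHom.smul_apply, mul_comm n m]
  rcases Int.units_eq_one_or (m * n).negOnePow with h | h <;> simp [h]

lemma jacobi_swap_right
    (hder : ∀ m, ∀ a ∈ gr B E F m, IsGradedDerivation R (m - 2) (π a))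
    (hskew : ∀ m n, ∀ a ∈ gr B E F m, ∀ b ∈ gr B E F n, π a b = -((m * n).negOnePow • π b a))
    {m n k : ℤ} {a b c : GSym B E F} (ha : a ∈ gr B E F m) (hb : b ∈ gr B E F n)
    (hc : c ∈ gr B E F k)
    (h : π a (π b c) = π (π a b) c + (m * n).negOnePow • π b (π a c)) :
    π a (π c b) = π (π a c) b + (m * k).negOnePow • π c (π a b) := by
  rw [hskew k n c hc b hb, map_neg, map_sign_smul, h,
    hskew _ _ _ (bracket_mem_gr hder ha hb) c hc, negOnePow_sub_two_mul,
    hskew _ _ _ hb _ (bracket_mem_gr hder ha hc), negOnePow_mul_sub_two, mul_add, add_mul,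
    Int.negOnePow_add, Int.negOnePow_add, mul_comm n m, mul_comm k n]
  rcases Int.units_eq_one_or (m * n).negOnePow with h | h <;>
  rcases Int.units_eq_one_or (m * k).negOnePow with h' | h' <;>
  rcases Int.units_eq_one_or (n * k).negOnePow with h'' | h'' <;>
  simp only [h, h', h'', one_smul, Units.neg_smul, mul_one, mul_neg, neg_neg, smul_add, smul_neg,
      neg_add] <;> abel

/-- The graded commutator of `[a, -]` and `[b, -]` and the map `[[a, b], -]` are derivations of the
same degree, so they agree as soon as they do on generators. -/
lemma jacobi_of_generators_right
    (hder : ∀ m, ∀ a ∈ gr B E F m, IsGradedDerivation R (m - 2) (π a))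
    {m n : ℤ} {a b : GSym B E F} (ha : a ∈ gr B E F m) (hb : b ∈ gr B E F n)
    (h : ∀ d y, IsGenerator d y →
      π a (π b y) = π (π a b) y + (m * n).negOnePow • π b (π a y)) (c : GSym B E F) :
    π a (π b c) = π (π a b) c + (m * n).negOnePow • π b (π a c) := by
  have e : m + n - 2 - 2 = (m - 2) + (n - 2) := by ring
  have key : (π a).comp (π b) - ((m - 2) * (n - 2)).negOnePow • (π b).comp (π a) = π (π a b) := by
    refine ((hder m a ha).commutator (hder n b hb)).ext_generator
      (e ▸ hder _ _ (bracket_mem_gr hder ha hb)) fun d y hy => ?_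
    simp only [AddMonoidHom.sub_apply, AddMonoidHom.comp_apply, AddMonoidHom.smul_apply]
    rw [h d y hy, negOnePow_sub_two_mul, negOnePow_mul_sub_two, add_sub_cancel_right]
  rw [negOnePow_sub_two_mul, negOnePow_mul_sub_two] at key
  rw [← key]
  simp

/-- The last argument can be freed from generators to arbitrary elements; the swaps bring each of
the three arguments into the last place in turn. -/
lemma jacobi_of_generators
    (hder : ∀ m, ∀ a ∈ gr B E F m, IsGradedDerivation R (m - 2) (π a))
    (hskew : ∀ m n, ∀ a ∈ gr B E F m, ∀ b ∈ gr B E F n, π a b = -((m * n).negOnePow • π b a))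
    (h : ∀ d₁ y₁ d₂ y₂ d₃ y₃, IsGenerator d₁ y₁ → IsGenerator d₂ y₂ → IsGenerator d₃ y₃ →
      π y₁ (π y₂ y₃) = π (π y₁ y₂) y₃ + (d₁ * d₂).negOnePow • π y₂ (π y₁ y₃))
    {m n : ℤ} {a b : GSym B E F} (ha : a ∈ gr B E F m) (hb : b ∈ gr B E F n) (c : GSym B E F) :
    π a (π b c) = π (π a b) c + (m * n).negOnePow • π b (π a c) := by
  have h₁ : ∀ {d n y b}, IsGenerator d y → b ∈ gr B E F n → ∀ c,
      π y (π b c) = π (π y b) c + (d * n).negOnePow • π b (π y c) := fun hy hb c =>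
    jacobi_of_generators_right hder hy.mem_gr hb (fun d' y' hy' =>
      jacobi_swap_right hder hskew hy.mem_gr hy'.mem_gr hb
        (jacobi_of_generators_right hder hy.mem_gr hy'.mem_gr
          (fun d'' y'' hy'' => h _ _ _ _ _ _ hy hy' hy'') _)) c
  exact jacobi_of_generators_right hder ha hb (fun d y hy =>
    jacobi_swap_right hder hskew ha hy.mem_gr hb
      (jacobi_swap_left hskew hy.mem_gr ha (h₁ hy ha b))) c

end FromDerivations

/-- The Poisson bracket with given brackets of generators. -/
theorem GeneratorBrackets.exists_poisson (h : GeneratorBrackets R D₀ D₁ D₂) :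
    ∃ π : GSym B E F →+ GSym B E F →+ GSym B E F, IsStrictPoisson R 0 π ∧
      (∀ b, π (ι₀ B E F b) = D₀ b) ∧ (∀ e, π (ι₁ B E F e) = D₁ e) ∧
      ∀ f, π (ι₂ B E F f) = D₂ f := by
  obtain ⟨π, hπ⟩ := h.exists_bracket
  have hder : ∀ m, ∀ a ∈ gr B E F m, IsGradedDerivation R (m - 2) (π a) :=
    fun m a ha => (hπ m a ha).1
  have hneg : ∀ {n : ℤ} {x : GSym B E F}, x ∈ gr B E F n → n < 0 → x = 0 := fun hx hn =>
    gr_of_neg hn hx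
  have hπ₀ : ∀ b, π (ι₀ B E F b) = D₀ b := fun b => by
    obtain ⟨h0, h1, h2, h3⟩ := hπ 0 _ (ι₀_mem_gr b)
    refine h0.ext (h.deriv₀ b) (fun b' => ?_) (fun e => ?_) fun f => ?_
    · rw [hneg (h0.map_gr _ _ (ι₀_mem_gr b')) (by norm_num),
        hneg ((h.deriv₀ b).map_gr _ _ (ι₀_mem_gr b')) (by norm_num)]
    · rw [hneg (h0.map_gr _ _ (ι₁_mem_gr e)) (by norm_num),
        hneg ((h.deriv₀ b).map_gr _ _ (ι₁_mem_gr e)) (by norm_num)]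
    · rw [h3, h.skew₀₂]
  have hπ₁ : ∀ e, π (ι₁ B E F e) = D₁ e := fun e => by
    obtain ⟨h0, h1, h2, h3⟩ := hπ 1 _ (ι₁_mem_gr e)
    refine h0.ext (h.deriv₁ e) (fun b' => ?_) (fun e' => ?_) fun f => ?_
    · rw [hneg (h0.map_gr _ _ (ι₀_mem_gr b')) (by norm_num),
        hneg ((h.deriv₁ e).map_gr _ _ (ι₀_mem_gr b')) (by norm_num)]
    · rw [h2, h.skew₁₁]
      simp
    · rw [h3, h.skew₁₂]
  have hπ₂ : ∀ f, π (ι₂ B E F f) = D₂ f := fun f => by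
    obtain ⟨h0, h1, h2, h3⟩ := hπ 2 _ (ι₂_mem_gr f)
    refine h0.ext (h.deriv₂ f) (fun b' => ?_) (fun e' => ?_) fun f => ?_
    · rw [h1, h.skew₀₂, neg_neg]
    · rw [h2, h.skew₁₂, Int.negOnePow_even 2 (by simp), one_smul, neg_neg]
    · rw [h3, h.skew₂₂, neg_neg]
  have hskew' : ∀ m d, ∀ a ∈ gr B E F m, ∀ y, IsGenerator d y →
      π a y = -((m * d).negOnePow • π y a) := by
    intro m d a ha y hy
    obtain ⟨h0, h1, h2, h3⟩ := hπ m a ha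
    cases hy with
    | zero b => rw [h1, hπ₀]; simp
    | one e => rw [h2, hπ₁, mul_one]
    | two f => rw [h3, hπ₂, Int.negOnePow_even (m * 2) (by simp), one_smul]
  have hskew : ∀ m n, ∀ a ∈ gr B E F m, ∀ b ∈ gr B E F n,
      π a b = -((m * n).negOnePow • π b a) :=
    fun m n a ha b hb => skew_of_generators hder hskew' ha hb
  have hb : ∀ {m n : ℤ} {a b : GSym B E F}, a ∈ gr B E F m → b ∈ gr B E F n →
    π a b ∈ gr B E F (m + n - 2) := bracket_mem_gr hder
  -- A double bracket lowers the total degree by 4, so below 4 all three terms vanish.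
  have hsmall : ∀ {d₁ y₁ d₂ y₂ d₃ y₃}, IsGenerator d₁ y₁ → IsGenerator d₂ y₂ →
      IsGenerator d₃ y₃ → d₁ + d₂ + d₃ < 4 →
      π y₁ (π y₂ y₃) = π (π y₁ y₂) y₃ + (d₁ * d₂).negOnePow • π y₂ (π y₁ y₃) := by
    intro d₁ y₁ d₂ y₂ d₃ y₃ h₁ h₂ h₃ hlt
    rw [hneg (hb h₁.mem_gr (hb h₂.mem_gr h₃.mem_gr)) (by linarith),
      hneg (hb (hb h₁.mem_gr h₂.mem_gr) h₃.mem_gr) (by linarith),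
      hneg (hb h₂.mem_gr (hb h₁.mem_gr h₃.mem_gr)) (by linarith), smul_zero, add_zero]
  have j₂₂₀ : ∀ f f' b, π (ι₂ B E F f) (π (ι₂ B E F f') (ι₀ B E F b)) =
      π (π (ι₂ B E F f) (ι₂ B E F f')) (ι₀ B E F b) +
        (2 * 2 : ℤ).negOnePow • π (ι₂ B E F f') (π (ι₂ B E F f) (ι₀ B E F b)) := fun f f' b => by
    rw [(hπ _ _ (hb (ι₂_mem_gr f) (ι₂_mem_gr f'))).2.1, hπ₂, hπ₂, h.jacobi₂₂₀,
      Int.negOnePow_even (2 * 2) (by decide), one_smul]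
  have j₂₂₁ : ∀ f f' b, π (ι₂ B E F f) (π (ι₂ B E F f') (ι₁ B E F b)) =
      π (π (ι₂ B E F f) (ι₂ B E F f')) (ι₁ B E F b) +
        (2 * 2 : ℤ).negOnePow • π (ι₂ B E F f') (π (ι₂ B E F f) (ι₁ B E F b)) := fun f f' b => by
    rw [(hπ _ _ (hb (ι₂_mem_gr f) (ι₂_mem_gr f'))).2.2.1, hπ₂, hπ₂, h.jacobi₂₂₁,
      Int.negOnePow_even (2 * 2) (by decide), Int.negOnePow_even (2 + 2 - 2) (by simp),
      one_smul, one_smul]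
  have j₂₂₂ : ∀ f f' b, π (ι₂ B E F f) (π (ι₂ B E F f') (ι₂ B E F b)) =
      π (π (ι₂ B E F f) (ι₂ B E F f')) (ι₂ B E F b) +
        (2 * 2 : ℤ).negOnePow • π (ι₂ B E F f') (π (ι₂ B E F f) (ι₂ B E F b)) := fun f f' b => by
    rw [(hπ _ _ (hb (ι₂_mem_gr f) (ι₂_mem_gr f'))).2.2.2, hπ₂, hπ₂, h.jacobi₂₂₂,
      Int.negOnePow_even (2 * 2) (by decide), one_smul]
  have j₂₁₁ : ∀ f e e', π (ι₂ B E F f) (π (ι₁ B E F e) (ι₁ B E F e')) =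
      π (π (ι₂ B E F f) (ι₁ B E F e)) (ι₁ B E F e') +
        (2 * 1 : ℤ).negOnePow • π (ι₁ B E F e) (π (ι₂ B E F f) (ι₁ B E F e')) := fun f e e' => by
    rw [(hπ _ _ (hb (ι₂_mem_gr f) (ι₁_mem_gr e))).2.2.1, hπ₂, hπ₁, h.jacobi₂₁₁,
      Int.negOnePow_even (2 * 1) (by simp), Int.negOnePow_odd (2 + 1 - 2) (by decide),
      one_smul, Units.neg_smul, one_smul, neg_neg]
  have hjac : ∀ d₁ y₁ d₂ y₂ d₃ y₃, IsGenerator d₁ y₁ → IsGenerator d₂ y₂ → IsGenerator d₃ y₃ →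
      π y₁ (π y₂ y₃) = π (π y₁ y₂) y₃ + (d₁ * d₂).negOnePow • π y₂ (π y₁ y₃) := by
    intro d₁ y₁ d₂ y₂ d₃ y₃ h₁ h₂ h₃
    by_cases hlt : d₁ + d₂ + d₃ < 4
    · exact hsmall h₁ h₂ h₃ hlt
    -- The remaining triples are the orderings of the degrees `(2, 2, 0)`, `(2, 1, 1)`, `(2, 2, 1)`
    -- and `(2, 2, 2)`.
    rcases h₁ with b₁ | e₁ | f₁ <;> rcases h₂ with b₂ | e₂ | f₂ <;>
      rcases h₃ with b₃ | e₃ | f₃ <;> try (norm_num at hlt; done)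
    · exact jacobi_swap_left hskew (ι₂_mem_gr f₂) (ι₀_mem_gr b₁)
        (jacobi_swap_right hder hskew (ι₂_mem_gr f₂) (ι₂_mem_gr f₃) (ι₀_mem_gr b₁) (j₂₂₀ _ _ _))
    · exact jacobi_swap_right hder hskew (ι₁_mem_gr e₁) (ι₂_mem_gr f₃) (ι₁_mem_gr e₂)
        (jacobi_swap_left hskew (ι₂_mem_gr f₃) (ι₁_mem_gr e₁) (j₂₁₁ _ _ _))
    · exact jacobi_swap_left hskew (ι₂_mem_gr f₂) (ι₁_mem_gr e₁) (j₂₁₁ _ _ _)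
    · exact jacobi_swap_left hskew (ι₂_mem_gr f₂) (ι₁_mem_gr e₁)
        (jacobi_swap_right hder hskew (ι₂_mem_gr f₂) (ι₂_mem_gr f₃) (ι₁_mem_gr e₁) (j₂₂₁ _ _ _))
    · exact jacobi_swap_right hder hskew (ι₂_mem_gr f₁) (ι₂_mem_gr f₃) (ι₀_mem_gr b₂) (j₂₂₀ _ _ _)
    · exact j₂₁₁ _ _ _
    · exact jacobi_swap_right hder hskew (ι₂_mem_gr f₁) (ι₂_mem_gr f₃) (ι₁_mem_gr e₂) (j₂₂₁ _ _ _)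
    · exact j₂₂₀ _ _ _
    · exact j₂₂₁ _ _ _
    · exact j₂₂₂ _ _ _
  refine ⟨π, ?_, hπ₀, hπ₁, hπ₂⟩
  exact
    { right_derivation := hder
      left_base := fun r c => by rw [hπ₀, h.base]
      left_leibniz := fun m n a ha b hb c => left_leibniz_of_generators hder hskew' ha hb c
      skew := hskew
      jacobi := fun m n a ha b hb c => jacobi_of_generators hder hskew hjac ha hb c
      -- The differential is zero here; the actual one, `[φ, -]`, is substituted later by
      -- `IsStrictPoisson.of_bracket`.
      differential := fun m a ha b => by simp }

end Brackets

end GSym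

/-! ### Dual bases, local data and contraction of bivectors. -/

lemma exists_dual_basis (B M : Type*) [CommRing B] [AddCommGroup M] [Module B M]
    [Module.Finite B M] [Module.Projective B M] :
    ∃ (n : ℕ) (m : Fin n → M) (ξ : Fin n → M →ₗ[B] B), ∀ x, ∑ i, ξ i x • m i = x := by
  obtain ⟨n, f, g, -, -, h⟩ := Module.Finite.exists_comp_eq_id_of_projective B M
  refine ⟨n, fun i => f (Pi.single i 1), fun i => LinearMap.proj i ∘ₗ g, fun x => ?_⟩
  have hx : f (g x) = x := LinearMap.congr_fun h x
  conv_rhs => rw [← hx, ← Finset.univ_sum_single (g x), map_sum]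
  refine Finset.sum_congr rfl fun i _ => ?_
  rw [LinearMap.comp_apply, LinearMap.proj_apply, ← map_smul, ← Pi.single_smul, smul_eq_mul,
    mul_one]

namespace GSym

/-- The sections over an affine open of an isomorphism `α` to the tangent sheaf, of the covariant
derivative of a connection, and of a compatible non-degenerate inner product. -/
structure LocalData (R B E F : Type*) [CommRing R] [CommRing B] [Algebra R B]
    [AddCommGroup E] [Module B E] [AddCommGroup F] [Module B F] where
  α : F ≃ₗ[B] Derivation R B B
  cov : F →+ E →+ E
  cov_smul_left : ∀ (b : B) f e, cov (b • f) e = b • cov f e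
  cov_smul : ∀ f (b : B) e, cov f (b • e) = b • cov f e + α f b • e
  Q : LinearMap.BilinForm B E
  symm : ∀ e e', Q e e' = Q e' e
  bijective : Function.Bijective Q
  compatible : ∀ f e e', α f (Q e e') = Q (cov f e) e' + Q e (cov f e')

section

variable {R B E F : Type*} [CommRing R] [CommRing B] [Algebra R B]
  [AddCommGroup E] [Module B E] [AddCommGroup F] [Module B F]

/-- The coordinate forms of a dual basis are pulled back through the bijection `Q`, so that
coordinates become pairings with elements of `E`. -/
lemma exists_dual_basis_form [Module.Finite B E] [Module.Projective B E]
    {Q : LinearMap.BilinForm B E} (hQ : Function.Bijective Q) :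
    ∃ (n : ℕ) (e e' : Fin n → E), ∀ x, ∑ i, Q (e' i) x • e i = x := by
  obtain ⟨n, m, ξ, h⟩ := exists_dual_basis B E
  choose g hg using hQ.2
  exact ⟨n, m, fun i => g (ξ i), fun x => by simp only [hg, h]⟩

/-- A bivector is determined by its contractions. -/
lemma eq_zero_of_contractions [Module.Finite B E] [Module.Projective B E] {t : B} (ht : t + t = 1)
    {Q : LinearMap.BilinForm B E} (hQ : Function.Bijective Q)
    {D₁ : E → GSym B E F →+ GSym B E F} (hD : ∀ e, IsGradedDerivation R (-1) (D₁ e))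
    (hD₁ : ∀ e e', D₁ e (ι₁ B E F e') = ι₀ B E F (Q e e')) {w : GSym B E F}
    (hw : w ∈ LinearMap.range (ι₁ B E F) ^ 2) (h : ∀ e, D₁ e w = 0) : w = 0 := by
  obtain ⟨n, e, e', he⟩ := exists_dual_basis_form hQ
  -- Contracting with a dual basis and multiplying back recovers each factor of a bivector once.
  -- This is an Euler identity, and the resulting factor 2 is why `2` must be invertible.
  have key : ∑ j, D₁ (e' j) w * ι₁ B E F (e j) = -(w + w) := by
    rw [pow_two] at hw
    refine Submodule.mul_induction_on hw ?_ fun x y hx hy => by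
      simp only [map_add, add_mul, Finset.sum_add_distrib, hx, hy]
      abel
    rintro _ ⟨a, rfl⟩ _ ⟨b, rfl⟩
    have : ∀ j, D₁ (e' j) (ι₁ B E F a * ι₁ B E F b) * ι₁ B E F (e j) =
        ι₁ B E F b * ι₁ B E F (Q (e' j) a • e j) - ι₁ B E F a * ι₁ B E F (Q (e' j) b • e j) := by
      intro j
      rw [(hD (e' j)).leibniz 1 _ (ι₁_mem_gr a), hD₁, hD₁, ι₁_smul, ι₁_smul, mul_one,
        Int.negOnePow_neg, Int.negOnePow_one, Units.neg_smul, one_smul, add_mul, ← mul_assoc,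
        ← mul_assoc, (commute_ι₀ _ (ι₁ B E F b)).eq, neg_mul, sub_eq_add_neg]
    simp only [this, Finset.sum_sub_distrib, ← Finset.mul_sum, ← map_sum, he]
    rw [ι₁_mul_swap b a]
    abel
  simp only [h, zero_mul, Finset.sum_const_zero] at key
  have h2 : w + w = 0 := neg_eq_zero.mp key.symm
  calc w = t • (w + w) := by rw [smul_add, ← add_smul, ht, one_smul]
    _ = 0 := by rw [h2, smul_zero]

/-- Graded derivations preserve the bivectors if they preserve the degree `1` part. -/
lemma derivation_sq_range {D : GSym B E F →+ GSym B E F} (hD : IsGradedDerivation R 0 D)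
    {w : GSym B E F} (hw : w ∈ LinearMap.range (ι₁ B E F) ^ 2) :
    D w ∈ LinearMap.range (ι₁ B E F) ^ 2 := by
  rw [pow_two] at hw ⊢
  refine Submodule.mul_induction_on hw ?_ fun x y hx hy => by
    rw [map_add]
    exact add_mem hx hy
  rintro _ ⟨a, rfl⟩ _ ⟨b, rfl⟩
  rw [hD.leibniz 1 _ (ι₁_mem_gr a), zero_mul, Int.negOnePow_zero, one_smul]
  have ha := hD.map_gr _ _ (ι₁_mem_gr a)
  have hb := hD.map_gr _ _ (ι₁_mem_gr b)
  rw [add_zero] at ha hb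
  exact add_mem (Submodule.mul_mem_mul ⟨_, ι₁_r₁ ha⟩ ⟨b, rfl⟩)
    (Submodule.mul_mem_mul ⟨a, rfl⟩ ⟨_, ι₁_r₁ hb⟩)

end

/-! ### Curvature, its bivector, and existence of the local bracket. -/

namespace LocalData

variable {R B E F : Type*} [CommRing R] [CommRing B] [Algebra R B]
  [AddCommGroup E] [Module B E] [AddCommGroup F] [Module B F] (L : LocalData R B E F)

/-- The bracket of `F` transported from the commutator of derivations. -/
def lie (f f' : F) : F := L.α.symm ⁅L.α f, L.α f'⁆

lemma α_lie (f f' : F) (b : B) : L.α (L.lie f f') b = L.α f (L.α f' b) - L.α f' (L.α f b) := by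
  rw [lie, LinearEquiv.apply_symm_apply, Derivation.commutator_apply]

/-- Identities in `F` may be tested on vector fields; in this way `lie` inherits skewness, the
Leibniz rule and the Jacobi identity from commutators. -/
lemma eq_of_α {f f' : F} (h : ∀ b, L.α f b = L.α f' b) : f = f' :=
  L.α.injective (Derivation.ext h)

lemma lie_add (f f' f'' : F) : L.lie f (f' + f'') = L.lie f f' + L.lie f f'' :=
  L.eq_of_α fun b => by
    simp only [map_add, Derivation.add_apply, α_lie]
    abel

lemma lie_skew (f f' : F) : L.lie f f' = -L.lie f' f := L.eq_of_α fun b => by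
  simp only [map_neg, Derivation.neg_apply, α_lie, neg_sub]

lemma lie_smul (f f' : F) (b : B) : L.lie f (b • f') = b • L.lie f f' + L.α f b • f' :=
  L.eq_of_α fun c => by
    simp only [map_add, map_smul, Derivation.add_apply, Derivation.smul_apply, α_lie,
      Derivation.leibniz, smul_eq_mul]
    ring

lemma lie_jacobi (f f' f'' : F) :
    L.lie f (L.lie f' f'') + L.lie f'' (L.lie f f') = L.lie f' (L.lie f f'') :=
  L.eq_of_α fun c => by
    simp only [map_add, map_sub, Derivation.add_apply, α_lie]
    abel

/-- The curvature of the connection. -/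
def curv (f f' : F) (e : E) : E :=
  L.cov f (L.cov f' e) - L.cov f' (L.cov f e) - L.cov (L.lie f f') e

lemma curv_add (f f' f'' : F) (e : E) :
    L.curv f (f' + f'') e = L.curv f f' e + L.curv f f'' e := by
  simp only [curv, lie_add, map_add, AddMonoidHom.add_apply]
  abel

lemma curv_skew (f f' : F) (e : E) : L.curv f f' e = -L.curv f' f e := by
  simp only [curv, L.lie_skew f f', map_neg, AddMonoidHom.neg_apply]
  abel

lemma curv_smul_right (f f' : F) (b : B) (e : E) : L.curv f (b • f') e = b • L.curv f f' e := by
  simp only [curv, lie_smul, map_add, AddMonoidHom.add_apply, cov_smul_left, cov_smul, smul_sub]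
  abel

/-- Evaluate the commutator of the two vector fields on `Q e e'` and expand by compatibility: the
mixed terms cancel. This skewness is what lets the curvature be represented by an element of `Λ²E`.
-/
lemma curv_compatible (f f' : F) (e e' : E) :
    L.Q (L.curv f f' e) e' = -L.Q e (L.curv f f' e') := by
  have h := L.α_lie f f' (L.Q e e')
  rw [L.compatible, L.compatible f' e e', L.compatible f e e', map_add, map_add, L.compatible,
    L.compatible, L.compatible, L.compatible] at h
  simp only [curv, map_sub, LinearMap.sub_apply]
  linear_combination -h

/-- The curvature is linear. -/
lemma curv_sum (f f' : F) {n : ℕ} (c : Fin n → B) (e : Fin n → E) :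
    L.curv f f' (∑ i, c i • e i) = ∑ i, c i • L.curv f f' (e i) := by
  simp only [curv, map_sum, cov_smul, map_add, α_lie, Finset.sum_add_distrib, sub_smul,
    Finset.sum_sub_distrib, smul_sub]
  abel

/-- The bivector representing the curvature, in terms of dual bases of `E`. -/
noncomputable def bivector (t : B) {n : ℕ} (e e' : Fin n → E) (f f' : F) : GSym B E F :=
  ∑ j, t • (ι₁ B E F (L.curv f f' (e' j)) * ι₁ B E F (e j))

variable {t : B} {n : ℕ} {e e' : Fin n → E}

lemma bivector_mem (f f' : F) :
    L.bivector t e e' f f' ∈ LinearMap.range (ι₁ B E F) ^ 2 := by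
  rw [pow_two]
  exact Submodule.sum_mem _ fun j _ => Submodule.smul_mem _ _
    (Submodule.mul_mem_mul ⟨_, rfl⟩ ⟨_, rfl⟩)

lemma bivector_add (f f' f'' : F) : L.bivector t e e' f (f' + f'') =
    L.bivector t e e' f f' + L.bivector t e e' f f'' := by
  simp only [bivector, curv_add, map_add, add_mul, smul_add, Finset.sum_add_distrib]

lemma bivector_skew (f f' : F) : L.bivector t e e' f f' = -L.bivector t e e' f' f := by
  simp only [bivector, L.curv_skew f f', map_neg, neg_mul, smul_neg, Finset.sum_neg_distrib]

lemma bivector_smul_right (f f' : F) (b : B) :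
    L.bivector t e e' f (b • f') = ι₀ B E F b * L.bivector t e e' f f' := by
  simp only [bivector, curv_smul_right, map_smul, smul_mul_assoc, ι₀_mul, Finset.smul_sum]
  exact Finset.sum_congr rfl fun j _ => smul_comm _ _ _

/-- Contracting either factor of `∑ R(e' j) e j` with `x` gives `-R(x)`: for the first factor by
skewness of `R` under `Q`, for the second by expanding `x` in the dual basis. The constant `t = 1/2`
compensates for counting it twice. -/
lemma contract_bivector (ht : t + t = 1) (he : ∀ x, ∑ i, L.Q (e' i) x • e i = x)
    {x : E} {D : GSym B E F →+ GSym B E F} (hD : IsGradedDerivation R (-1) D)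
    (hDx : ∀ y, D (ι₁ B E F y) = ι₀ B E F (L.Q x y)) (f f' : F) :
    D (L.bivector t e e' f f') = -ι₁ B E F (L.curv f f' x) := by
  -- By non-degeneracy of `Q`, the roles of `e` and `e'` in the dual basis identity can be
  -- exchanged.
  have he' : ∑ j, L.Q x (e j) • e' j = x := by
    refine L.bijective.1 (LinearMap.ext fun y => ?_)
    conv_rhs => rw [← he y]
    simp only [map_sum, LinearMap.sum_apply, map_smul, LinearMap.smul_apply, smul_eq_mul]
    exact Finset.sum_congr rfl fun j _ => mul_comm _ _
  have hD0 : ∀ b : B, D (ι₀ B E F b) = 0 := fun b =>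
    gr_of_neg (by norm_num) (hD.map_gr _ _ (ι₀_mem_gr b))
  have hDs : ∀ (b : B) y, D (b • y) = b • D y := fun b y => by
    rw [← ι₀_mul, hD.leibniz 0 _ (ι₀_mem_gr b), hD0]
    simp [ι₀_mul]
  have step : ∀ j, D (t • (ι₁ B E F (L.curv f f' (e' j)) * ι₁ B E F (e j))) =
      -(t • ι₁ B E F (L.Q (e' j) (L.curv f f' x) • e j)) -
        t • ι₁ B E F (L.Q x (e j) • L.curv f f' (e' j)) := by
    intro j
    rw [hDs, hD.leibniz 1 _ (ι₁_mem_gr _), hDx, hDx, L.symm x (L.curv f f' (e' j)),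
      L.curv_compatible, ← (commute_ι₀ _ (ι₁ B E F (L.curv f f' (e' j)))).eq, ι₀_mul, ι₀_mul,
      ← map_smul, ← map_smul]
    simp only [mul_one, Int.negOnePow_neg, Int.negOnePow_one, Units.neg_smul, one_smul, neg_smul,
      map_neg, smul_add, smul_neg]
    abel
  rw [bivector, map_sum]
  simp only [step, Finset.sum_sub_distrib, Finset.sum_neg_distrib, ← Finset.smul_sum, ← map_sum,
    ← curv_sum, he, he']
  rw [← neg_add', ← add_smul, ht, one_smul]

/-- This is `[b, -]`, and the next two lemmas give `[x, -]` and `[f, -]`. Their values on generators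
are those dictated by degree, skewness and the data. -/
lemma exists_bracket₀ (b : B) : ∃ D : GSym B E F →+ GSym B E F, IsGradedDerivation R (-2) D ∧
    ∀ f, D (ι₂ B E F f) = -ι₀ B E F (L.α f b) := by
  obtain ⟨D, hD, -, -, h⟩ := exists_isGradedDerivation (R := R) (B := B) (E := E) (F := F) (-2) 0 0
    (AddMonoidHom.mk' (fun f => -ι₀ B E F (L.α f b)) fun x y => by
      rw [map_add, Derivation.add_apply, map_add, neg_add])
    (fun _ => rfl) (fun _ => zero_mem _) (fun _ => zero_mem _) (fun f => neg_mem (ι₀_mem_gr _))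
    (fun b b' => by simp only [AddMonoidHom.zero_apply, zero_mul, mul_zero, add_zero])
    (fun b b' => by simp only [AddMonoidHom.zero_apply, zero_mul, mul_zero, add_zero])
    (fun b' f => by
      change -ι₀ B E F (L.α (b' • f) b) = 0 * ι₂ B E F f + ι₀ B E F b' * -ι₀ B E F (L.α f b)
      rw [map_smul, Derivation.smul_apply, smul_eq_mul, map_mul, zero_mul, zero_add, mul_neg])
  exact ⟨D, hD, h⟩

lemma exists_bracket₁ (x : E) : ∃ D : GSym B E F →+ GSym B E F, IsGradedDerivation R (-1) D ∧
    (∀ y, D (ι₁ B E F y) = ι₀ B E F (L.Q x y)) ∧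
    ∀ f, D (ι₂ B E F f) = -ι₁ B E F (L.cov f x) := by
  obtain ⟨D, hD, -, h, h'⟩ := exists_isGradedDerivation (R := R) (B := B) (E := E) (F := F) (-1) 0
    ((ι₀ B E F).toAddMonoidHom.comp (L.Q x).toAddMonoidHom)
    { toFun := fun f => -ι₁ B E F (L.cov f x)
      map_zero' := by simp
      map_add' := fun x y => by simp [add_comm] }
    (by simp) (fun _ => zero_mem _) (fun _ => ι₀_mem_gr _) (fun f => neg_mem (ι₁_mem_gr _))
    (by simp) (fun b y => by simp) (fun b f => by simp [cov_smul_left, ι₀_mul])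
  exact ⟨D, hD, h, h'⟩

/-- Only `[f, f']` needs a choice: the commutator of vector fields plus the curvature bivector. It
is a derivation in `f'` because `lie` obeys the Leibniz rule and the bivector is linear. -/
lemma exists_bracket₂ (t : B) {n : ℕ} (e e' : Fin n → E) (f : F) :
    ∃ D : GSym B E F →+ GSym B E F, IsGradedDerivation R 0 D ∧
    (∀ b, D (ι₀ B E F b) = ι₀ B E F (L.α f b)) ∧ (∀ y, D (ι₁ B E F y) = ι₁ B E F (L.cov f y)) ∧
    ∀ f', D (ι₂ B E F f') = ι₂ B E F (L.lie f f') + L.bivector t e e' f f' :=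
  exists_isGradedDerivation (R := R) (B := B) (E := E) (F := F) 0
    ((ι₀ B E F).toAddMonoidHom.comp ((L.α f : Derivation R B B) : B →ₗ[R] B).toAddMonoidHom)
    ((ι₁ B E F).toAddMonoidHom.comp (L.cov f))
    (AddMonoidHom.mk' (fun f' => ι₂ B E F (L.lie f f') + L.bivector t e e' f f')
      fun x y => by rw [lie_add, bivector_add, map_add]; abel)
    (fun r => by
      change ι₀ B E F (L.α f (algebraMap R B r)) = 0
      rw [Derivation.map_algebraMap, map_zero])
    (fun _ => ι₀_mem_gr _) (fun _ => ι₁_mem_gr _)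
    (fun f' => add_mem (ι₂_mem_gr _) (sq_range_ι₁_le_gr (L.bivector_mem f f')))
    (fun b b' => by
      change ι₀ B E F (L.α f (b * b')) = ι₀ B E F (L.α f b) * ι₀ B E F b' +
        ι₀ B E F b * ι₀ B E F (L.α f b')
      rw [Derivation.leibniz, ← map_mul, ← map_mul, ← map_add, smul_eq_mul, smul_eq_mul,
        mul_comm b', add_comm])
    (fun b y => by
      change ι₁ B E F (L.cov f (b • y)) = ι₀ B E F (L.α f b) * ι₁ B E F y +
        ι₀ B E F b * ι₁ B E F (L.cov f y)
      rw [cov_smul, map_add, ι₁_smul, ι₁_smul, add_comm])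
    (fun b f' => by
      change ι₂ B E F (L.lie f (b • f')) + L.bivector t e e' f (b • f') =
        ι₀ B E F (L.α f b) * ι₂ B E F f' +
          ι₀ B E F b * (ι₂ B E F (L.lie f f') + L.bivector t e e' f f')
      rw [lie_smul, bivector_smul_right, map_add, ι₂_smul, ι₂_smul, mul_add]
      abel)

/-- By degree, such a derivation kills `B` and `E`. -/
lemma derivation_neg_two {D D' : GSym B E F →+ GSym B E F} (hD : IsGradedDerivation R (-2) D)
    (hD' : IsGradedDerivation R (-2) D') (h : ∀ f, D (ι₂ B E F f) = D' (ι₂ B E F f)) : D = D' := by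
  refine hD.ext hD' (fun b => ?_) (fun e => ?_) h
  · rw [gr_of_neg (by norm_num) (hD.map_gr _ _ (ι₀_mem_gr b)),
      gr_of_neg (by norm_num) (hD'.map_gr _ _ (ι₀_mem_gr b))]
  · rw [gr_of_neg (by norm_num) (hD.map_gr _ _ (ι₁_mem_gr e)),
      gr_of_neg (by norm_num) (hD'.map_gr _ _ (ι₁_mem_gr e))]

lemma derivation_neg_one {D D' : GSym B E F →+ GSym B E F} (hD : IsGradedDerivation R (-1) D)
    (hD' : IsGradedDerivation R (-1) D') (h₁ : ∀ e, D (ι₁ B E F e) = D' (ι₁ B E F e))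
    (h : ∀ f, D (ι₂ B E F f) = D' (ι₂ B E F f)) : D = D' := by
  refine hD.ext hD' (fun b => ?_) h₁ h
  rw [gr_of_neg (by norm_num) (hD.map_gr _ _ (ι₀_mem_gr b)),
    gr_of_neg (by norm_num) (hD'.map_gr _ _ (ι₀_mem_gr b))]

/-- The brackets of the generators are determined by the local data. -/
theorem exists_generatorBrackets [Module.Finite B E] [Module.Projective B E] (ht : t + t = 1) :
    ∃ (D₀ : B →+ GSym B E F →+ GSym B E F) (D₁ : E →+ GSym B E F →+ GSym B E F)
      (D₂ : F →+ GSym B E F →+ GSym B E F), GeneratorBrackets R D₀ D₁ D₂ ∧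
      (∀ f b, D₂ f (ι₀ B E F b) = ι₀ B E F (L.α f b)) ∧
      (∀ e e', D₁ e (ι₁ B E F e') = ι₀ B E F (L.Q e e')) ∧
      ∀ f e, D₂ f (ι₁ B E F e) = ι₁ B E F (L.cov f e) := by
  obtain ⟨n, e, e', he⟩ := exists_dual_basis_form L.bijective
  choose D₀ hD₀ hD₀₂ using L.exists_bracket₀
  choose D₁ hD₁ hD₁₁ hD₁₂ using L.exists_bracket₁
  choose D₂ hD₂ hD₂₀ hD₂₁ hD₂₂ using L.exists_bracket₂ t e e'
  have hD₁₀ : ∀ x b, D₁ x (ι₀ B E F b) = 0 := fun x b =>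
    gr_of_neg (by norm_num) ((hD₁ x).map_gr _ _ (ι₀_mem_gr b))
  have hD₀₀ : ∀ b b', D₀ b (ι₀ B E F b') = 0 := fun x b =>
    gr_of_neg (by norm_num) ((hD₀ x).map_gr _ _ (ι₀_mem_gr b))
  have hD₀₁ : ∀ b x, D₀ b (ι₁ B E F x) = 0 := fun b x =>
    gr_of_neg (by norm_num) ((hD₀ b).map_gr _ _ (ι₁_mem_gr x))
  have hD₀w : ∀ b, ∀ w ∈ LinearMap.range (ι₁ B E F) ^ 2, D₀ b w = 0 := fun b w hw => by
    rw [pow_two] at hw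
    refine Submodule.mul_induction_on hw ?_ fun x y hx hy => by rw [map_add, hx, hy, add_zero]
    rintro _ ⟨x, rfl⟩ _ ⟨y, rfl⟩
    rw [(hD₀ b).leibniz 1 _ (ι₁_mem_gr x), hD₀₁, hD₀₁, zero_mul, mul_zero, smul_zero, add_zero]
  have lmul₀ : ∀ (b : B) {k D}, IsGradedDerivation R k D →
      IsGradedDerivation R k (ι₀ B E F b • D) := fun b k D hD => by
    simpa using hD.left_mul (ι₀_mem_gr b)
  -- the commutator of `[f, -]` and `[x, -]`
  have comm : ∀ f x y, D₁ x (D₂ f y) = D₂ f (D₁ x y) - D₁ (L.cov f x) y := by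
    intro f x y
    have key : (D₁ x).comp (D₂ f) - ((-1 : ℤ) * 0).negOnePow • (D₂ f).comp (D₁ x) =
        -D₁ (L.cov f x) := by
      refine derivation_neg_one ((hD₁ x).commutator (hD₂ f)) (hD₁ _).neg (fun y => ?_) fun f' => ?_
      · simp only [mul_zero, Int.negOnePow_zero, one_smul, AddMonoidHom.sub_apply,
          AddMonoidHom.comp_apply, AddMonoidHom.neg_apply]
        rw [hD₂₁, hD₁₁, hD₁₁, hD₁₁, hD₂₀, L.compatible, map_add]
        abel
      -- On `F` the commutator of the covariant derivatives differs from the derivative along `lie f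
      -- f'` by the curvature, and the contraction of the bivector supplies exactly this defect.
      · simp only [mul_zero, Int.negOnePow_zero, one_smul, AddMonoidHom.sub_apply,
          AddMonoidHom.comp_apply, AddMonoidHom.neg_apply]
        rw [hD₂₂, hD₁₂, map_add, hD₁₂, hD₁₂, map_neg, hD₂₁,
          L.contract_bivector ht he (hD₁ x) (hD₁₁ x), curv, map_sub, map_sub]
        abel
    have := DFunLike.congr_fun key y
    simp only [mul_zero, Int.negOnePow_zero, one_smul, AddMonoidHom.sub_apply,
          AddMonoidHom.comp_apply, AddMonoidHom.neg_apply] at this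
    rw [eq_sub_iff_add_eq, ← sub_eq_zero]
    rw [← sub_eq_zero] at this
    rw [← this]
    abel
  have commFF : ∀ x f f', D₁ x (D₂ f (ι₂ B E F f')) =
      -ι₁ B E F (L.cov f (L.cov f' x)) + ι₁ B E F (L.cov f' (L.cov f x)) := fun x f f' => by
    rw [comm, hD₁₂, hD₁₂, map_neg, hD₂₁, sub_neg_eq_add]
  have commFFF : ∀ x f f' f'', D₁ x (D₂ f (D₂ f' (ι₂ B E F f''))) =
      -ι₁ B E F (L.cov f (L.cov f' (L.cov f'' x))) + ι₁ B E F (L.cov f (L.cov f'' (L.cov f' x)))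
      + ι₁ B E F (L.cov f' (L.cov f'' (L.cov f x)))
      - ι₁ B E F (L.cov f'' (L.cov f' (L.cov f x))) := fun x f f' f'' => by
    rw [comm, commFF, commFF, map_add, map_neg, hD₂₁, hD₂₁]
    abel
  -- The `F`-part of this defect vanishes by the Jacobi identity for vector fields, so it is a
  -- bivector. Its contraction with `x` is, by `commFFF`, a sum of triple covariant derivatives that
  -- cancel: the Bianchi identity.
  have FFF : ∀ f f' f'', D₂ f (D₂ f' (ι₂ B E F f'')) + D₂ f'' (D₂ f (ι₂ B E F f')) -
      D₂ f' (D₂ f (ι₂ B E F f'')) = 0 := fun f f' f'' => by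
    refine eq_zero_of_contractions ht L.bijective hD₁ hD₁₁ ?_ fun x => ?_
    · have h : ∀ f f' f'', D₂ f (D₂ f' (ι₂ B E F f'')) - ι₂ B E F (L.lie f (L.lie f' f'')) ∈
          LinearMap.range (ι₁ B E F) ^ 2 := fun f f' f'' => by
        rw [hD₂₂, map_add, hD₂₂, add_assoc, add_sub_cancel_left]
        exact add_mem (L.bivector_mem _ _) (derivation_sq_range (hD₂ f) (L.bivector_mem _ _))
      have := sub_mem (add_mem (h f f' f'') (h f'' f f')) (h f' f f'')
      rw [← L.lie_jacobi f f' f'', map_add] at this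
      convert this using 1
      abel
    · rw [map_sub, map_add, commFFF, commFFF, commFFF]
      abel
  -- Additivity of the chosen derivations, and below their Leibniz rules in the generator, follow
  -- from uniqueness: both sides are derivations that agree on generators.
  refine ⟨AddMonoidHom.mk' D₀ fun b b' => ?_, AddMonoidHom.mk' D₁ fun x y => ?_,
    AddMonoidHom.mk' D₂ fun f f' => ?_, ?_, hD₂₀, hD₁₁, hD₂₁⟩
  · refine derivation_neg_two (hD₀ _) ((hD₀ b).add (hD₀ b')) fun f => ?_
    rw [AddMonoidHom.add_apply, hD₀₂, hD₀₂, hD₀₂, map_add, map_add, neg_add]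
  · refine derivation_neg_one (hD₁ _) ((hD₁ x).add (hD₁ y)) (fun z => ?_) fun f => ?_
    · rw [AddMonoidHom.add_apply, hD₁₁, hD₁₁, hD₁₁, map_add, LinearMap.add_apply, map_add]
    · rw [AddMonoidHom.add_apply, hD₁₂, hD₁₂, hD₁₂, map_add, map_add, neg_add]
  · refine (hD₂ _).ext ((hD₂ f).add (hD₂ f')) (fun b => ?_) (fun x => ?_) fun f'' => ?_
    · rw [AddMonoidHom.add_apply, hD₂₀, hD₂₀, hD₂₀, map_add, Derivation.add_apply, map_add]
    · rw [AddMonoidHom.add_apply, hD₂₁, hD₂₁, hD₂₁, map_add, AddMonoidHom.add_apply, map_add]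
    · rw [AddMonoidHom.add_apply, hD₂₂, hD₂₂, hD₂₂, lie_skew, lie_add, bivector_skew,
        bivector_add, L.lie_skew f'' f, L.lie_skew f'' f', L.bivector_skew f'' f,
        L.bivector_skew f'' f']
      simp only [map_add, neg_add, neg_neg]
      abel
  exact
    { deriv₀ := hD₀
      deriv₁ := hD₁
      deriv₂ := hD₂
      base := fun r x => by
        have : D₀ (algebraMap R B r) = 0 := derivation_neg_two (hD₀ _) .zero fun f => by
          rw [hD₀₂]; simp
        exact DFunLike.congr_fun this x
      mul₀ := fun b b' x => by
        have : D₀ (b * b') = ι₀ B E F b • D₀ b' + ι₀ B E F b' • D₀ b :=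
          derivation_neg_two (hD₀ _) ((lmul₀ b (hD₀ b')).add (lmul₀ b' (hD₀ b))) fun f => by
            simp only [AddMonoidHom.add_apply, AddMonoidHom.smul_apply, smul_eq_mul, hD₀₂,
              Derivation.leibniz, map_add, map_mul]
            noncomm_ring
        exact DFunLike.congr_fun this x
      smul₁ := fun b y x => by
        have : D₁ (b • y) = ι₀ B E F b • D₁ y + ι₁ B E F y • D₀ b :=
          derivation_neg_one (hD₁ _) ((lmul₀ b (hD₁ y)).add ((hD₀ b).left_mul (ι₁_mem_gr y)))
            (fun z => by
              simp only [AddMonoidHom.add_apply, AddMonoidHom.smul_apply, smul_eq_mul, hD₁₁, hD₀₁,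
                mul_zero, add_zero, map_smul, LinearMap.smul_apply, map_mul])
            fun f => by
              simp only [AddMonoidHom.add_apply, AddMonoidHom.smul_apply, smul_eq_mul, hD₁₂, hD₀₂,
                cov_smul, map_add, ι₁_smul]
              rw [mul_neg, mul_neg, ← (commute_ι₀ _ (ι₁ B E F y)).eq, neg_add]
        exact DFunLike.congr_fun this x
      smul₂ := fun b f x => by
        have : D₂ (b • f) = ι₀ B E F b • D₂ f + ι₂ B E F f • D₀ b :=
          (hD₂ _).ext ((lmul₀ b (hD₂ f)).add ((hD₀ b).left_mul (ι₂_mem_gr f)))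
            (fun z => by
              simp only [AddMonoidHom.add_apply, AddMonoidHom.smul_apply, smul_eq_mul, hD₂₀, hD₀₀,
                mul_zero, add_zero, map_smul, Derivation.smul_apply, map_mul])
            (fun z => by
              simp only [AddMonoidHom.add_apply, AddMonoidHom.smul_apply, smul_eq_mul, hD₂₁, hD₀₁,
                mul_zero, add_zero, cov_smul_left, ι₁_smul])
            fun f' => by
              simp only [AddMonoidHom.add_apply, AddMonoidHom.smul_apply, smul_eq_mul, hD₂₂, hD₀₂]
              rw [lie_skew, lie_smul, bivector_skew, bivector_smul_right, L.lie_skew f f',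
                L.bivector_skew f f', map_neg, map_neg, map_add, ι₂_smul, ι₂_smul, mul_neg,
                ← (commute_ι₀ _ (ι₂ B E F f)).eq]
              noncomm_ring
        exact DFunLike.congr_fun this x
      skew₀₂ := fun b f => by
        rw [AddMonoidHom.mk'_apply, AddMonoidHom.mk'_apply, hD₀₂, hD₂₀]
      skew₁₁ := fun x y => by
        rw [AddMonoidHom.mk'_apply, hD₁₁, hD₁₁, L.symm]
      skew₁₂ := fun x f => by
        rw [AddMonoidHom.mk'_apply, AddMonoidHom.mk'_apply, hD₁₂, hD₂₁]
      skew₂₂ := fun f f' => by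
        rw [AddMonoidHom.mk'_apply, hD₂₂, hD₂₂, lie_skew, bivector_skew,
          map_neg, neg_add]
      jacobi₂₂₀ := fun f f' b => by
        simp only [AddMonoidHom.mk'_apply]
        rw [hD₂₂, hD₂₀, hD₂₀, hD₂₀, hD₂₀, map_add, hD₀₂, hD₀w b _ (L.bivector_mem _ _), α_lie,
          map_sub]
        abel
      jacobi₂₂₁ := fun f f' x => by
        simp only [AddMonoidHom.mk'_apply]
        rw [commFF, hD₂₁, hD₂₁, hD₂₁, hD₂₁]
        abel
      jacobi₂₂₂ := fun f f' f'' => by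
        have := FFF f f' f''
        simp only [AddMonoidHom.mk'_apply]
        rw [← sub_eq_zero, ← this]
        abel
      jacobi₂₁₁ := fun f x y => by
        simp only [AddMonoidHom.mk'_apply]
        rw [hD₁₁, hD₂₀, hD₂₁, hD₂₁, hD₁₁, hD₁₁, L.compatible, map_add, L.symm y] }

theorem exists_poisson [Module.Finite B E] [Module.Projective B E] (ht : t + t = 1) :
    ∃ π : GSym B E F →+ GSym B E F →+ GSym B E F, IsStrictPoisson R 0 π ∧
      (∀ f b, π (ι₂ B E F f) (ι₀ B E F b) = ι₀ B E F (L.α f b)) ∧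
      (∀ e e', π (ι₁ B E F e) (ι₁ B E F e') = ι₀ B E F (L.Q e e')) ∧
      ∀ f e, π (ι₂ B E F f) (ι₁ B E F e) = ι₁ B E F (L.cov f e) := by
  obtain ⟨D₀, D₁, D₂, h, h₁, h₂, h₃⟩ := L.exists_generatorBrackets ht
  obtain ⟨π, hπ, -, hπ₁, hπ₂⟩ := h.exists_poisson
  exact ⟨π, hπ, fun f b => by rw [hπ₂, h₁], fun f b => by rw [hπ₁, h₂],
    fun f b => by rw [hπ₂, h₃]⟩

end LocalData

end GSym

/-! ### Maps of generators compatible with brackets, and uniqueness. -/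

namespace GSym

section Naturality

variable {R B E F B' E' F' : Type*} [CommRing R] [CommRing B] [Algebra R B]
  [AddCommGroup E] [Module B E] [AddCommGroup F] [Module B F]
  [CommRing B'] [Algebra R B'] [AddCommGroup E'] [Module B' E'] [AddCommGroup F'] [Module B' F']
  {δ' : GSym B' E' F' →+ GSym B' E' F'} {π' : GSym B' E' F' →+ GSym B' E' F' →+ GSym B' E' F'}
  {δ : GSym B E F →+ GSym B E F} {π : GSym B E F →+ GSym B E F →+ GSym B E F}

/-- A ring homomorphism induced by maps of generators. -/
structure IsMap (ψ : GSym B E F →+* GSym B' E' F') (φ : B → B') (g : E → E') (h : F → F') :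
    Prop where
  map_ι₀ : ∀ b, ψ (ι₀ B E F b) = ι₀ B' E' F' (φ b)
  map_ι₁ : ∀ e, ψ (ι₁ B E F e) = ι₁ B' E' F' (g e)
  map_ι₂ : ∀ f, ψ (ι₂ B E F f) = ι₂ B' E' F' (h f)

lemma IsMap.id : IsMap (RingHom.id (GSym B E F)) id id id :=
  ⟨fun _ => rfl, fun _ => rfl, fun _ => rfl⟩

lemma isMap_map (φ : B →+* B') (g : E →ₛₗ[φ] E') (h : F →ₛₗ[φ] F') : IsMap (map φ g h) φ g h :=
  ⟨map_ι₀ φ g h, map_ι₁ φ g h, map_ι₂ φ g h⟩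

variable {ψ : GSym B E F →+* GSym B' E' F'} {φ : B → B'} {g : E → E'} {h : F → F'}

lemma IsMap.mem_gr (hψ : IsMap ψ φ g h) {n : ℤ} {x : GSym B E F} (hx : x ∈ gr B E F n) :
    ψ x ∈ gr B' E' F' n := by
  refine gr_induction (p := fun n x => ψ x ∈ gr B' E' F' n) ?_ ?_ ?_ ?_ ?_ hx
  · intro b
    rw [hψ.map_ι₀]
    exact ι₀_mem_gr _
  · intro n e x _ hx
    rw [map_mul, hψ.map_ι₁]
    exact ι₁_mul_mem_gr _ hx
  · intro n f x _ hx
    rw [map_mul, hψ.map_ι₂]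
    exact ι₂_mul_mem_gr _ hx
  · intro n
    rw [map_zero]
    exact zero_mem _
  · intro n x y _ _ hx hy
    rw [map_add]
    exact add_mem hx hy

/-- `ψ ∘ D` and `D' ∘ ψ` are derivations along `ψ` of the same degree, so `eq_of_leibniz` compares
them. -/
lemma IsMap.comp_eq_of_generators (hψ : IsMap ψ φ g h) {k : ℤ} {D : GSym B E F →+ GSym B E F}
    {D' : GSym B' E' F' →+ GSym B' E' F'} (hD : IsGradedDerivation R k D)
    (hD' : IsGradedDerivation R k D') (h₀ : ∀ b, ψ (D (ι₀ B E F b)) = D' (ι₀ B' E' F' (φ b)))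
    (h₁ : ∀ e, ψ (D (ι₁ B E F e)) = D' (ι₁ B' E' F' (g e)))
    (h₂ : ∀ f, ψ (D (ι₂ B E F f)) = D' (ι₂ B' E' F' (h f))) (x : GSym B E F) :
    ψ (D x) = D' (ψ x) := by
  have := eq_of_leibniz ψ k (D := ψ.toAddMonoidHom.comp D) (D' := D'.comp ψ.toAddMonoidHom)
    (fun n a ha b => ?_) (fun n a ha b => ?_) (fun b => ?_) (fun b => ?_) (fun b => ?_)
  · exact DFunLike.congr_fun this x
  · change ψ (D (a * b)) = ψ (D a) * ψ b + _ • (ψ a * ψ (D b))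
    rw [hD.leibniz n a ha, map_add, map_mul]
    exact congrArg (ψ (D a) * ψ b + ·) ((map_sign_smul ψ.toAddMonoidHom _ _).trans
      (congrArg _ (map_mul ψ a (D b))))
  · change D' (ψ (a * b)) = D' (ψ a) * ψ b + _ • (ψ a * D' (ψ b))
    rw [map_mul, hD'.leibniz n _ (hψ.mem_gr ha)]
  · change ψ (D _) = D' (ψ _)
    rw [h₀, hψ.map_ι₀]
  · change ψ (D _) = D' (ψ _)
    rw [h₁, hψ.map_ι₁]
  · change ψ (D _) = D' (ψ _)
    rw [h₂, hψ.map_ι₂]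

lemma IsStrictPoisson.map_skew (hπ : IsStrictPoisson R δ π) (hπ' : IsStrictPoisson R δ' π')
    (hψ : IsMap ψ φ g h) {m n : ℤ} {a b : GSym B E F} (ha : a ∈ gr B E F m) (hb : b ∈ gr B E F n)
    (hab : ψ (π a b) = π' (ψ a) (ψ b)) : ψ (π b a) = π' (ψ b) (ψ a) := by
  rw [hπ.skew n m b hb a ha, hπ'.skew n m _ (hψ.mem_gr hb) _ (hψ.mem_gr ha), map_neg, ← hab]
  congr 1
  exact map_sign_smul ψ.toAddMonoidHom _ _

/-- A map of the generators respecting the brackets of the generators respects all brackets. -/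
lemma IsStrictPoisson.map_of_generators (hπ : IsStrictPoisson R δ π)
    (hπ' : IsStrictPoisson R δ' π') (hψ : IsMap ψ φ g h)
    (H : ∀ d y d' y', IsGenerator d y → IsGenerator d' y' → ψ (π y y') = π' (ψ y) (ψ y'))
    (a b : GSym B E F) : ψ (π a b) = π' (ψ a) (ψ b) := by
  have step : ∀ m a, a ∈ gr B E F m →
      (∀ d y, IsGenerator d y → ψ (π a y) = π' (ψ a) (ψ y)) → ∀ b, ψ (π a b) = π' (ψ a) (ψ b) := by
    intro m a ha H b
    refine hψ.comp_eq_of_generators (hπ.right_derivation m a ha)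
      (hπ'.right_derivation m _ (hψ.mem_gr ha)) (fun b => ?_) (fun e => ?_) (fun f => ?_) b
    · rw [H _ _ (.zero b), hψ.map_ι₀]
    · rw [H _ _ (.one e), hψ.map_ι₁]
    · rw [H _ _ (.two f), hψ.map_ι₂]
  induction a using homogeneous_induction with
  | add x y hx hy => simp only [map_add, AddMonoidHom.add_apply, hx, hy]
  | h m a ha =>
    refine step m a ha (fun d y hy => ?_) b
    exact hπ.map_skew hπ' hψ hy.mem_gr ha
      (step d y hy.mem_gr (fun d' y' hy' => H d y d' y' hy hy') a)

lemma IsStrictPoisson.bracket_ι₀_sq_range (hπ : IsStrictPoisson R δ π) (b : B) {w : GSym B E F}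
    (hw : w ∈ LinearMap.range (ι₁ B E F) ^ 2) : π (ι₀ B E F b) w = 0 := by
  rw [pow_two] at hw
  refine Submodule.mul_induction_on hw ?_ fun x y hx hy => by rw [map_add, hx, hy, add_zero]
  rintro _ ⟨x, rfl⟩ _ ⟨y, rfl⟩
  have : ∀ e, π (ι₀ B E F b) (ι₁ B E F e) = 0 := fun e =>
    gr_of_neg (by norm_num) (bracket_mem_gr hπ.right_derivation (ι₀_mem_gr b) (ι₁_mem_gr e))
  rw [(hπ.right_derivation 0 _ (ι₀_mem_gr b)).leibniz 1 _ (ι₁_mem_gr x), this, this, zero_mul,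
    mul_zero, smul_zero, add_zero]

/-- An element of degree `2` is determined by its brackets with sufficiently many elements of
degree at most `1`. -/
lemma IsStrictPoisson.eq_zero_of_mem_gr_two [Module.Finite B E] [Module.Projective B E] {t : B}
    (ht : t + t = 1) (hπ : IsStrictPoisson R δ π) {Q : LinearMap.BilinForm B E}
    (hQ : Function.Bijective Q)
    (hπQ : ∀ e e', π (ι₁ B E F e) (ι₁ B E F e') = ι₀ B E F (Q e e')) {S : Set B} {T : Set E}
    (hS : ∀ f, (∀ b ∈ S, π (ι₂ B E F f) (ι₀ B E F b) = 0) → f = 0)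
    (hT : Submodule.span B T = ⊤) {x : GSym B E F} (hx : x ∈ gr B E F 2)
    (h₀ : ∀ b ∈ S, π (ι₀ B E F b) x = 0) (h₁ : ∀ e ∈ T, π (ι₁ B E F e) x = 0) : x = 0 := by
  obtain ⟨f, w, hw, rfl⟩ := mem_gr_two hx
  -- Since `[b, -]` kills bivectors, it sees only the `F`-part of `x`; what remains is a bivector,
  -- killed by contraction.
  have hf : f = 0 := hS f fun b hb => by
    have := h₀ b hb
    rw [map_add, hπ.bracket_ι₀_sq_range b hw, add_zero] at this
    rw [hπ.skew 2 0 _ (ι₂_mem_gr f) _ (ι₀_mem_gr b), this, smul_zero, neg_zero]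
  subst hf
  rw [map_zero, zero_add] at h₁ ⊢
  refine eq_zero_of_contractions ht hQ (D₁ := fun e => π (ι₁ B E F e))
    (fun e => hπ.right_derivation 1 _ (ι₁_mem_gr e)) hπQ hw fun e => ?_
  refine Submodule.span_induction (p := fun e _ => π (ι₁ B E F e) w = 0) h₁ ?_ ?_ ?_
    (by rw [hT]; trivial : e ∈ Submodule.span B T)
  · rw [map_zero, map_zero, AddMonoidHom.zero_apply]
  · intro x y _ _ hx hy
    rw [map_add, map_add, AddMonoidHom.add_apply, hx, hy, add_zero]
  · intro b e _ he
    rw [ι₁_smul, hπ.left_leibniz 0 1 _ (ι₀_mem_gr b) _ (ι₁_mem_gr e), he,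
      hπ.bracket_ι₀_sq_range b hw, mul_zero, mul_zero, smul_zero, add_zero]

/-- A consequence of the Jacobi identities. -/
lemma IsStrictPoisson.map_jacobi (hπ : IsStrictPoisson R δ π) (hπ' : IsStrictPoisson R δ' π')
    (hψ : IsMap ψ φ g h) {m : ℤ} {y : GSym B E F} (hy : y ∈ gr B E F m)
    (row : ∀ x, ψ (π y x) = π' (ψ y) (ψ x))
    (row' : ∀ f x, ψ (π (π y (ι₂ B E F f)) x) = π' (ψ (π y (ι₂ B E F f))) (ψ x)) (f f' : F) :
    π' (ψ y) (ψ (π (ι₂ B E F f) (ι₂ B E F f')) - π' (ψ (ι₂ B E F f)) (ψ (ι₂ B E F f'))) = 0 := by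
  have e : ψ ((m * 2).negOnePow • π (ι₂ B E F f) (π y (ι₂ B E F f'))) =
      (m * 2).negOnePow • π' (ψ (ι₂ B E F f)) (ψ (π y (ι₂ B E F f'))) := by
    rw [← hπ.map_skew hπ' hψ (bracket_mem_gr hπ.right_derivation hy (ι₂_mem_gr f'))
      (ι₂_mem_gr f) (row' f' _)]
    exact map_sign_smul ψ.toAddMonoidHom _ _
  -- Both `[y, [f, f']]` upstairs and its counterpart downstairs expand into brackets having `y` or
  -- some `[y, f]` as an entry, where compatibility is already known.
  rw [map_sub, ← row, hπ.jacobi m 2 y hy _ (ι₂_mem_gr f),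
    hπ'.jacobi m 2 _ (hψ.mem_gr hy) _ (hψ.mem_gr (ι₂_mem_gr f)), map_add, row', e, row, row,
    sub_self]

set_option maxHeartbeats 400000 in
/-- A map of generators respecting the brackets in `F × B`, `E × E` and `F × E` respects all
brackets. -/
theorem IsStrictPoisson.map_bracket [Module.Finite B' E'] [Module.Projective B' E'] {t : B'}
    (ht : t + t = 1) (hπ : IsStrictPoisson R δ π) (hπ' : IsStrictPoisson R δ' π')
    (hψ : IsMap ψ φ g h) {Q' : LinearMap.BilinForm B' E'} (hQ : Function.Bijective Q')
    (hπQ : ∀ e e', π' (ι₁ B' E' F' e) (ι₁ B' E' F' e') = ι₀ B' E' F' (Q' e e'))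
    (hS : ∀ f, (∀ b, π' (ι₂ B' E' F' f) (ι₀ B' E' F' (φ b)) = 0) → f = 0)
    (hT : Submodule.span B' (Set.range g) = ⊤)
    (h₂₀ : ∀ f b, ψ (π (ι₂ B E F f) (ι₀ B E F b)) =
      π' (ι₂ B' E' F' (h f)) (ι₀ B' E' F' (φ b)))
    (h₁₁ : ∀ e e', ψ (π (ι₁ B E F e) (ι₁ B E F e')) =
      π' (ι₁ B' E' F' (g e)) (ι₁ B' E' F' (g e')))
    (h₂₁ : ∀ f e, ψ (π (ι₂ B E F f) (ι₁ B E F e)) =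
      π' (ι₂ B' E' F' (h f)) (ι₁ B' E' F' (g e)))
    (a b : GSym B E F) : ψ (π a b) = π' (ψ a) (ψ b) := by
  have neg : ∀ m n a b, a ∈ gr B E F m → b ∈ gr B E F n → m + n - 2 < 0 →
      ψ (π a b) = π' (ψ a) (ψ b) := fun m n a b ha hb hmn => by
    rw [gr_of_neg hmn (bracket_mem_gr hπ.right_derivation ha hb), gr_of_neg hmn
      (bracket_mem_gr hπ'.right_derivation (hψ.mem_gr ha) (hψ.mem_gr hb)), map_zero]
  have h₂₀' : ∀ f b, ψ (π (ι₂ B E F f) (ι₀ B E F b)) = π' (ψ (ι₂ B E F f)) (ψ (ι₀ B E F b)) :=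
    fun f b => by rw [h₂₀, hψ.map_ι₂, hψ.map_ι₀]
  have h₁₁' : ∀ f b, ψ (π (ι₁ B E F f) (ι₁ B E F b)) = π' (ψ (ι₁ B E F f)) (ψ (ι₁ B E F b)) :=
    fun f b => by rw [h₁₁, hψ.map_ι₁, hψ.map_ι₁]
  have h₂₁' : ∀ f b, ψ (π (ι₂ B E F f) (ι₁ B E F b)) = π' (ψ (ι₂ B E F f)) (ψ (ι₁ B E F b)) :=
    fun f b => by rw [h₂₁, hψ.map_ι₂, hψ.map_ι₁]
  have h₀₂ := fun b f => hπ.map_skew hπ' hψ (ι₂_mem_gr f) (ι₀_mem_gr b) (h₂₀' f b)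
  have h₁₂ := fun b f => hπ.map_skew hπ' hψ (ι₂_mem_gr f) (ι₁_mem_gr b) (h₂₁' f b)
  have row₀ : ∀ b x, ψ (π (ι₀ B E F b) x) = π' (ψ (ι₀ B E F b)) (ψ x) := fun b x => by
    refine hψ.comp_eq_of_generators (hπ.right_derivation 0 _ (ι₀_mem_gr b))
      (hπ'.right_derivation 0 _ (hψ.mem_gr (ι₀_mem_gr b))) (fun b' => ?_) (fun e => ?_)
      (fun f => ?_) x
    · rw [← hψ.map_ι₀]
      exact neg _ _ _ _ (ι₀_mem_gr _) (ι₀_mem_gr _) (by norm_num)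
    · rw [← hψ.map_ι₁]
      exact neg _ _ _ _ (ι₀_mem_gr _) (ι₁_mem_gr _) (by norm_num)
    · rw [← hψ.map_ι₂]
      exact h₀₂ b f
  have row₁ : ∀ b x, ψ (π (ι₁ B E F b) x) = π' (ψ (ι₁ B E F b)) (ψ x) := fun b x => by
    refine hψ.comp_eq_of_generators (hπ.right_derivation 1 _ (ι₁_mem_gr b))
      (hπ'.right_derivation 1 _ (hψ.mem_gr (ι₁_mem_gr b))) (fun b' => ?_) (fun e => ?_)
      (fun f => ?_) x
    · rw [← hψ.map_ι₀]
      exact neg _ _ _ _ (ι₁_mem_gr _) (ι₀_mem_gr _) (by norm_num)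
    · rw [← hψ.map_ι₁]
      exact h₁₁' b e
    · rw [← hψ.map_ι₂]
      exact h₁₂ b f
  -- The only brackets without a hypothesis. The defect has degree 2 and is annihilated by the
  -- images of `B` and `E` through Jacobi, because `[b, f]` and `[e, f]` lie again in `B` and `E`,
  -- where the rows are settled.
  have h₂₂ : ∀ f f', ψ (π (ι₂ B E F f) (ι₂ B E F f')) =
      π' (ψ (ι₂ B E F f)) (ψ (ι₂ B E F f')) := fun f f' => by
    have hm : π (ι₂ B E F f) (ι₂ B E F f') ∈ gr B E F 2 :=
      bracket_mem_gr (m := 2) (n := 2) hπ.right_derivation (ι₂_mem_gr f) (ι₂_mem_gr f')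
    have hm' : π' (ψ (ι₂ B E F f)) (ψ (ι₂ B E F f')) ∈ gr B' E' F' 2 :=
      bracket_mem_gr (m := 2) (n := 2) hπ'.right_derivation (hψ.mem_gr (ι₂_mem_gr f))
        (hψ.mem_gr (ι₂_mem_gr f'))
    rw [← sub_eq_zero]
    refine hπ'.eq_zero_of_mem_gr_two ht hQ hπQ (S := Set.range φ) (T := Set.range g)
      (fun f hf => hS f fun b => hf _ ⟨b, rfl⟩) hT (sub_mem (hψ.mem_gr hm) hm') ?_ ?_
    · rintro _ ⟨b, rfl⟩
      rw [← hψ.map_ι₀]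
      refine hπ.map_jacobi hπ' hψ (ι₀_mem_gr b) (row₀ b) (fun f x => ?_) f f'
      obtain ⟨c, hc⟩ := mem_gr_zero
        (bracket_mem_gr (m := 0) (n := 2) hπ.right_derivation (ι₀_mem_gr b) (ι₂_mem_gr f))
      rw [hc, row₀]
    · rintro _ ⟨b, rfl⟩
      rw [← hψ.map_ι₁]
      refine hπ.map_jacobi hπ' hψ (ι₁_mem_gr b) (row₁ b) (fun f x => ?_) f f'
      obtain ⟨c, hc⟩ := mem_gr_one
        (bracket_mem_gr (m := 1) (n := 2) hπ.right_derivation (ι₁_mem_gr b) (ι₂_mem_gr f))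
      rw [hc, row₁]
  refine hπ.map_of_generators hπ' hψ (fun d y d' y' hy hy' => ?_) a b
  cases hy with
  | zero b => exact row₀ b y'
  | one e => exact row₁ e y'
  | two f =>
    cases hy' with
    | zero b => exact h₂₀' f b
    | one e => exact h₂₁' f e
    | two k => exact h₂₂ f k

/-- Poisson brackets with the same local data agree. -/
theorem IsStrictPoisson.ext_of_localData [Module.Finite B E] [Module.Projective B E] {t : B}
    (ht : t + t = 1) {δ' : GSym B E F →+ GSym B E F} {π' : GSym B E F →+ GSym B E F →+ GSym B E F}
    (hπ : IsStrictPoisson R δ π) (hπ' : IsStrictPoisson R δ' π') (L : LocalData R B E F)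
    (h₂₀ : ∀ f b, π (ι₂ B E F f) (ι₀ B E F b) = ι₀ B E F (L.α f b))
    (h₁₁ : ∀ e e', π (ι₁ B E F e) (ι₁ B E F e') = ι₀ B E F (L.Q e e'))
    (h₂₁ : ∀ f e, π (ι₂ B E F f) (ι₁ B E F e) = ι₁ B E F (L.cov f e))
    (h₂₀' : ∀ f b, π' (ι₂ B E F f) (ι₀ B E F b) = ι₀ B E F (L.α f b))
    (h₁₁' : ∀ e e', π' (ι₁ B E F e) (ι₁ B E F e') = ι₀ B E F (L.Q e e'))
    (h₂₁' : ∀ f e, π' (ι₂ B E F f) (ι₁ B E F e) = ι₁ B E F (L.cov f e)) : π = π' := by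
  ext a b
  -- Uniqueness is compatibility with the identity map.
  refine hπ.map_bracket ht hπ' .id L.bijective h₁₁' (fun f hf => ?_) ?_ ?_ ?_ ?_ a b
  · refine L.eq_of_α fun b => ι₀_injective (E := E) (F := F) ?_
    rw [← h₂₀', map_zero, Derivation.zero_apply, map_zero]
    exact hf b
  · rw [Set.range_id, Submodule.span_univ]
  · exact fun f b => (h₂₀ f b).trans (h₂₀' f b).symm
  · exact fun f b => (h₁₁ f b).trans (h₁₁' f b).symm
  · exact fun f b => (h₂₁ f b).trans (h₂₁' f b).symm

/-- The bracket with a section of `E` of constant norm is a differential. -/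
lemma IsStrictPoisson.isDifferential_bracket (hπ : IsStrictPoisson R δ π) {t : B}
    (ht : t + t = 1) (L : LocalData R B E F)
    (h₂₀ : ∀ f b, π (ι₂ B E F f) (ι₀ B E F b) = ι₀ B E F (L.α f b))
    (h₁₁ : ∀ e e', π (ι₁ B E F e) (ι₁ B E F e') = ι₀ B E F (L.Q e e'))
    {s : E} (hs : ∀ f, L.α f (L.Q s s) = 0) : IsDifferential R (π (ι₁ B E F s)) where
  isGradedDerivation := hπ.right_derivation 1 _ (ι₁_mem_gr s)
  sq_zero a := by
    -- A derivation of degree `-2` is determined on `F`, where this one is minus the derivative of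
    -- the norm of `s`.
    have h₀ : π (ι₀ B E F (L.Q s s)) = 0 :=
      LocalData.derivation_neg_two (hπ.right_derivation 0 _ (ι₀_mem_gr _)) .zero fun f => by
        rw [hπ.skew 0 2 _ (ι₀_mem_gr _) _ (ι₂_mem_gr f), h₂₀, hs, map_zero, smul_zero, neg_zero]
        rfl
    -- For the odd element `s`, Jacobi reads `2 [s, [s, a]] = [[s, s], a] = [Q(s, s), a]`.
    have := hπ.jacobi 1 1 _ (ι₁_mem_gr s) _ (ι₁_mem_gr s) a
    rw [h₁₁, h₀, AddMonoidHom.zero_apply, zero_add, mul_one, Int.negOnePow_one, Units.neg_smul,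
      one_smul, eq_neg_iff_add_eq_zero] at this
    calc π (ι₁ B E F s) (π (ι₁ B E F s) a)
        = t • (π (ι₁ B E F s) (π (ι₁ B E F s) a) + π (ι₁ B E F s) (π (ι₁ B E F s) a)) := by
          rw [smul_add, ← add_smul, ht, one_smul]
      _ = 0 := by rw [this, smul_zero]

/-- A Poisson bracket is compatible with the differential `[s, -]`. -/
lemma IsStrictPoisson.of_bracket (hπ : IsStrictPoisson R δ π) (s : E) :
    IsStrictPoisson R (π (ι₁ B E F s)) π where
  right_derivation := hπ.right_derivation
  left_base := hπ.left_base
  left_leibniz := hπ.left_leibniz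
  skew := hπ.skew
  jacobi := hπ.jacobi
  differential m a ha b := by
    rw [hπ.jacobi 1 m _ (ι₁_mem_gr s) a ha, one_mul]

end Naturality

end GSym

/-! ### Kähler differentials of the base ring. -/

section KaehlerDifferential

variable {R B : Type*} [CommRing R] [CommRing B] [Algebra R B]

/-- The universal property of Kähler differentials for derivations into modules over `B` without a
given `R`-module structure. -/
lemma exists_linearMap_kaehlerDifferential {M : Type*} [AddCommGroup M] [Module B M] (d : B →+ M)
    (hd : ∀ b b', d (b * b') = b • d b' + b' • d b) (hd' : ∀ r : R, d (algebraMap R B r) = 0) :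
    ∃ l : Ω[B⁄R] →ₗ[B] M, ∀ b, l (KaehlerDifferential.D R B b) = d b := by
  let _ : Module R M := Module.compHom M (algebraMap R B)
  have smul_def : ∀ (r : R) (m : M), r • m = algebraMap R B r • m := fun _ _ => rfl
  have : IsScalarTower R B M := ⟨fun r b m => by
    rw [smul_def, Algebra.smul_def, mul_smul]⟩
  let D : Derivation R B M := Derivation.mk'
    { toFun := d
      map_add' := map_add d
      map_smul' := fun r b => by
        rw [Algebra.smul_def, hd, hd', smul_zero, add_zero, RingHom.id_apply, smul_def] } hd
  exact ⟨D.liftKaehlerDifferential, fun b => D.liftKaehlerDifferential_comp_D b⟩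

/-- Dual bases of the Kähler differentials consisting of exact forms and derivations. -/
lemma exists_dual_basis_kaehlerDifferential [Module.Finite B Ω[B⁄R]]
    [Module.Projective B Ω[B⁄R]] :
    ∃ (n : ℕ) (b : Fin n → B) (v : Fin n → Derivation R B B), ∀ ω : Ω[B⁄R],
      ∑ i, (v i).liftKaehlerDifferential ω • KaehlerDifferential.D R B (b i) = ω := by
  classical
  -- Exact forms generate, so finitely many of them already do.
  have hfg : (⊤ : Submodule B Ω[B⁄R]).FG := Module.Finite.fg_top
  rw [← KaehlerDifferential.span_range_derivation R B] at hfg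
  obtain ⟨s, hs, hs'⟩ := (Submodule.fg_span_iff_fg_span_finset_subset _).mp hfg
  rw [KaehlerDifferential.span_range_derivation] at hs'
  choose c hc using fun x : s => hs x.2
  let b : Fin s.card → B := fun i => c (s.equivFin.symm i)
  have hb : ∀ i, KaehlerDifferential.D R B (b i) = s.equivFin.symm i := fun i => hc _
  have hsurj : LinearMap.range (Fintype.linearCombination B
      (fun i => KaehlerDifferential.D R B (b i))) = ⊤ := by
    rw [Fintype.range_linearCombination, hs']
    congr 1
    ext x
    constructor
    · rintro ⟨i, rfl⟩
      dsimp only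
      rw [hb]
      exact (s.equivFin.symm i).2
    · intro hx
      exact ⟨s.equivFin ⟨x, hx⟩, by dsimp only; rw [hb, Equiv.symm_apply_apply]⟩
  -- A splitting of the surjection given by these exact forms has linear forms as coordinates, which
  -- are vector fields by the universal property.
  obtain ⟨l, hl⟩ := Module.projective_lifting_property _ LinearMap.id
    (LinearMap.range_eq_top.mp hsurj)
  refine ⟨_, b, fun i => (LinearMap.proj i ∘ₗ l).compDer (KaehlerDifferential.D R B),
    fun ω => ?_⟩
  have : ∀ i, ((LinearMap.proj i ∘ₗ l).compDer (KaehlerDifferential.D R B) :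
      Derivation R B B).liftKaehlerDifferential = LinearMap.proj i ∘ₗ l := fun i =>
    Derivation.liftKaehlerDifferential_unique _ _ (by
      rw [Derivation.liftKaehlerDifferential_comp])
  simp only [this]
  have := LinearMap.congr_fun hl ω
  rwa [LinearMap.comp_apply, Fintype.linearCombination_apply] at this

end KaehlerDifferential

/-! ### Graded Kähler differentials and bijectivity of the contraction. -/

namespace GSym

section Nondegenerate

variable {R B E F : Type*} [CommRing R] [CommRing B] [Algebra R B]
  [AddCommGroup E] [Module B E] [AddCommGroup F] [Module B F]
  {δ : GSym B E F →+ GSym B E F} {π : GSym B E F →+ GSym B E F →+ GSym B E F}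

variable (R) in
/-- The universal derivation. -/
noncomputable def kd (y : GSym B E F) : Kaehler R B E F :=
  Submodule.Quotient.mk (Finsupp.single y 1)

lemma kd_add (x y : GSym B E F) : kd R (x + y) = kd R x + kd R y := by
  rw [kd, kd, kd, ← Submodule.Quotient.mk_add, Submodule.Quotient.eq, ← sub_sub]
  exact Submodule.subset_span (.add x y)

lemma kd_base (r : R) : kd R (ι₀ B E F (algebraMap R B r)) = 0 := by
  rw [kd, Submodule.Quotient.mk_eq_zero]
  exact Submodule.subset_span (.base r)

lemma smul_kd (a y : GSym B E F) :
    a • kd R y = Submodule.Quotient.mk (Finsupp.single y a) := by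
  rw [kd, ← Submodule.Quotient.mk_smul, Finsupp.smul_single, smul_eq_mul, mul_one]

lemma kd_mul {m n : ℤ} {a b : GSym B E F} (ha : a ∈ gr B E F m) (hb : b ∈ gr B E F n) :
    kd R (a * b) = a • kd R b + (m * n).negOnePow • b • kd R a := by
  have : (m * n).negOnePow • b • kd R a =
      Submodule.Quotient.mk ((m * n).negOnePow • Finsupp.single a b) := by
    rw [smul_kd]
    rcases Int.units_eq_one_or (m * n).negOnePow with h | h <;> rw [h]
    · rw [one_smul, one_smul]
    · rw [Units.neg_smul, one_smul, Units.neg_smul, one_smul, Submodule.Quotient.mk_neg]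
  rw [this, smul_kd, kd, ← Submodule.Quotient.mk_add, Submodule.Quotient.eq]
  exact Submodule.subset_span (.mul m n a b ha hb)

lemma kd_ι₀_mul (b : B) {n : ℤ} {x : GSym B E F} (hx : x ∈ gr B E F n) :
    kd R (ι₀ B E F b * x) = ι₀ B E F b • kd R x + x • kd R (ι₀ B E F b) := by
  rw [kd_mul (ι₀_mem_gr b) hx, zero_mul, Int.negOnePow_zero, one_smul]

lemma kd_sum {ι : Type*} (s : Finset ι) (x : ι → GSym B E F) :
    kd R (∑ i ∈ s, x i) = ∑ i ∈ s, kd R (x i) :=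
  map_sum (AddMonoidHom.mk' (kd R) kd_add) x s

lemma span_kd : Submodule.span (GSym B E F) (Set.range (kd R (B := B) (E := E) (F := F))) = ⊤ := by
  rw [eq_top_iff]
  rintro x -
  obtain ⟨x, rfl⟩ := Submodule.Quotient.mk_surjective _ x
  induction x using Finsupp.induction_linear with
  | zero => exact zero_mem _
  | add x y hx hy => exact add_mem hx hy
  | single y a =>
    rw [← smul_kd]
    exact Submodule.smul_mem _ _ (Submodule.subset_span ⟨y, rfl⟩)

lemma IsStrictPoisson.flat_kd (hπ : IsStrictPoisson R δ π) (y : GSym B E F) :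
    hπ.flat (kd R y) = π y := by
  rw [flat, kd]
  erw [Submodule.liftQ_apply]
  rw [Finsupp.linearCombination_single, one_smul]

lemma IsStrictPoisson.flat_mem (hπ : IsStrictPoisson R δ π) (x : Kaehler R B E F) :
    hπ.flat x ∈ gradedDerivations R B E F := by
  have hx : x ∈ Submodule.span (GSym B E F) (Set.range (kd R (B := B) (E := E) (F := F))) := by
    rw [span_kd]; trivial
  have key : ∀ a b : GSym B E F, a • π b ∈ gradedDerivations R B E F := fun a b => by
    induction a using homogeneous_induction with
    | add x y hx hy => rw [add_smul]; exact add_mem hx hy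
    | h m a ha =>
      induction b using homogeneous_induction with
      | add x y hx hy => rw [map_add, smul_add]; exact add_mem hx hy
      | h n b hb =>
        exact AddSubgroup.subset_closure ⟨_, (hπ.right_derivation n b hb).left_mul ha⟩
  obtain ⟨c, rfl⟩ := (Finsupp.mem_span_range_iff_exists_finsupp).mp hx
  rw [Finsupp.sum, map_sum]
  refine sum_mem fun i _ => ?_
  rw [map_smul, hπ.flat_kd]
  exact key _ _

/-- The values of a derivation on `B` are determined by a dual basis of the differentials. -/
lemma IsGradedDerivation.map_ι₀_eq_sum {k : ℤ} {D : GSym B E F →+ GSym B E F}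
    (hD : IsGradedDerivation R k D) {n : ℕ} {b : Fin n → B} {v : Fin n → Derivation R B B}
    (hv : ∀ ω : Ω[B⁄R],
      ∑ i, (v i).liftKaehlerDifferential ω • KaehlerDifferential.D R B (b i) = ω) (c : B) :
    D (ι₀ B E F c) = ∑ i, ι₀ B E F (v i c) * D (ι₀ B E F (b i)) := by
  obtain ⟨l, hl⟩ := exists_linearMap_kaehlerDifferential (R := R)
    (D.comp (ι₀ B E F).toAddMonoidHom) (fun b b' => by
      change D (ι₀ B E F (b * b')) = b • D (ι₀ B E F b') + b' • D (ι₀ B E F b)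
      rw [map_mul, hD.leibniz 0 _ (ι₀_mem_gr b), mul_zero, Int.negOnePow_zero, one_smul, ← ι₀_mul,
        ← ι₀_mul, (commute_ι₀ b' _).eq, add_comm]) hD.map_base
  have hl' : ∀ b, l (KaehlerDifferential.D R B b) = D (ι₀ B E F b) := hl
  rw [← hl', ← hv (KaehlerDifferential.D R B c), map_sum]
  refine Finset.sum_congr rfl fun i _ => ?_
  rw [map_smul, hl', Derivation.liftKaehlerDifferential_comp_D, ι₀_mul]

/-- On `B` the universal derivation of `A` factors through `Ω[B⁄R]`, to which the dual basis
applies. -/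
lemma kd_ι₀_eq_sum {n : ℕ} {b : Fin n → B} {v : Fin n → Derivation R B B}
    (hv : ∀ ω : Ω[B⁄R],
      ∑ i, (v i).liftKaehlerDifferential ω • KaehlerDifferential.D R B (b i) = ω) (c : B) :
    kd R (ι₀ B E F c) = ∑ i, ι₀ B E F (v i c) • kd R (ι₀ B E F (b i)) := by
  have smul_def : ∀ (b : B) (m : Kaehler R B E F), b • m = ι₀ B E F b • m :=
    fun b m => (algebraMap_smul (GSym B E F) b m).symm
  obtain ⟨l, hl⟩ := exists_linearMap_kaehlerDifferential (R := R)
    (AddMonoidHom.mk' (fun c => kd R (ι₀ B E F c)) fun x y => by rw [map_add, kd_add])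
    (fun b b' => by
      simp only [AddMonoidHom.mk'_apply, map_mul, smul_def]
      exact kd_ι₀_mul b (ι₀_mem_gr b')) kd_base
  have hl' : ∀ b, l (KaehlerDifferential.D R B b) = kd R (ι₀ B E F b) := hl
  rw [← hl', ← hv (KaehlerDifferential.D R B c), map_sum]
  refine Finset.sum_congr rfl fun i _ => ?_
  rw [map_smul, hl', Derivation.liftKaehlerDifferential_comp_D, smul_def]

variable (R B E F) in
/-- The submodule generated by the differentials of elements of `B`. -/
noncomputable def baseForms : Submodule (GSym B E F) (Kaehler R B E F) :=
  Submodule.span _ (Set.range fun c => kd R (ι₀ B E F c))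

lemma kd_ι₀_mem_baseForms (c : B) : kd R (ι₀ B E F c) ∈ baseForms R B E F :=
  Submodule.subset_span ⟨c, rfl⟩

lemma baseForms_eq_span {n : ℕ} {b : Fin n → B} {v : Fin n → Derivation R B B}
    (hv : ∀ ω : Ω[B⁄R],
      ∑ i, (v i).liftKaehlerDifferential ω • KaehlerDifferential.D R B (b i) = ω) :
    baseForms R B E F = Submodule.span _ (Set.range fun i => kd R (ι₀ B E F (b i))) := by
  refine le_antisymm (Submodule.span_le.mpr ?_) (Submodule.span_le.mpr ?_)
  · rintro _ ⟨c, rfl⟩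
    dsimp only
    rw [kd_ι₀_eq_sum hv]
    exact sum_mem fun i _ => Submodule.smul_mem _ _ (Submodule.subset_span ⟨i, rfl⟩)
  · rintro _ ⟨i, rfl⟩
    exact kd_ι₀_mem_baseForms _

/-- Brackets with `B` lower the degree by 2, so base forms are invisible on `B` and `E`. This is the
triangularity behind injectivity of the contraction. -/
lemma IsStrictPoisson.flat_of_mem_baseForms (hπ : IsStrictPoisson R δ π) {y : Kaehler R B E F}
    (hy : y ∈ baseForms R B E F) {k : ℤ} {z : GSym B E F} (hz : z ∈ gr B E F k) (hk : k < 2) :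
    hπ.flat y z = 0 := by
  obtain ⟨c, rfl⟩ := (Finsupp.mem_span_range_iff_exists_finsupp).mp hy
  rw [Finsupp.sum, map_sum, AddMonoidHom.finsetSum_apply]
  refine Finset.sum_eq_zero fun i _ => ?_
  rw [map_smul, hπ.flat_kd, AddMonoidHom.smul_apply, gr_of_neg (by omega)
      (bracket_mem_gr hπ.right_derivation (ι₀_mem_gr i) hz), smul_zero]

/-- Modulo base forms, the universal derivation is `B`-linear on `E`; the next lemma is its analogue
for `F`. -/
lemma kd_ι₁_sub_mem {n : ℕ} (c : Fin n → B) (e : Fin n → E) :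
    kd R (ι₁ B E F (∑ i, c i • e i)) - ∑ i, ι₀ B E F (c i) • kd R (ι₁ B E F (e i)) ∈
      baseForms R B E F := by
  rw [map_sum, kd_sum, ← Finset.sum_sub_distrib]
  refine sum_mem fun i _ => ?_
  rw [ι₁_smul, kd_ι₀_mul _ (ι₁_mem_gr _), add_sub_cancel_left]
  exact Submodule.smul_mem _ _ (kd_ι₀_mem_baseForms _)

lemma kd_ι₂_sub_mem {n : ℕ} (c : Fin n → B) (f : Fin n → F) :
    kd R (ι₂ B E F (∑ i, c i • f i)) - ∑ i, ι₀ B E F (c i) • kd R (ι₂ B E F (f i)) ∈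
      baseForms R B E F := by
  rw [map_sum, kd_sum, ← Finset.sum_sub_distrib]
  refine sum_mem fun i _ => ?_
  rw [ι₂_smul, kd_ι₀_mul _ (ι₂_mem_gr _), add_sub_cancel_left]
  exact Submodule.smul_mem _ _ (kd_ι₀_mem_baseForms _)

lemma sum_smul_sum_eq_zero {A M : Type*} [Ring A] [AddCommGroup M] [Module A M] {n : ℕ}
    {c : Fin n → A} {a : Fin n → Fin n → A} (h : ∀ k, ∑ i, c i * a i k = 0) (z : Fin n → M) :
    ∑ i, c i • ∑ k, a i k • z k = 0 := by
  simp only [Finset.smul_sum, smul_smul]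
  rw [Finset.sum_comm]
  refine Finset.sum_eq_zero fun k _ => ?_
  rw [← Finset.sum_smul, h, zero_smul]

/-- Since the `e i` come from a dual basis and not a basis, the coefficients `c` need not vanish
when the form does. Rewriting each `e i` in the family replaces `c` by `c * a`, and these products
are what the contraction detects. -/
lemma sum_mem_baseForms_ι₁ {n : ℕ} {e : Fin n → E} (c : Fin n → GSym B E F)
    (a : Fin n → Fin n → B) (ha : ∀ i, ∑ k, a i k • e k = e i)
    (h : ∀ k, ∑ i, c i * ι₀ B E F (a i k) = 0) :
    ∑ i, c i • kd R (ι₁ B E F (e i)) ∈ baseForms R B E F := by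
  rw [← sub_zero (∑ i, c i • kd R (ι₁ B E F (e i))),
    ← sum_smul_sum_eq_zero h fun k => kd R (ι₁ B E F (e k)), ← Finset.sum_sub_distrib]
  refine sum_mem fun i _ => ?_
  rw [← smul_sub]
  have := kd_ι₁_sub_mem (R := R) (F := F) (a i) e
  rw [ha] at this
  exact Submodule.smul_mem _ _ this

lemma sum_mem_baseForms_ι₂ {n : ℕ} {f : Fin n → F} (c : Fin n → GSym B E F)
    (a : Fin n → Fin n → B) (ha : ∀ i, ∑ k, a i k • f k = f i)
    (h : ∀ k, ∑ i, c i * ι₀ B E F (a i k) = 0) :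
    ∑ i, c i • kd R (ι₂ B E F (f i)) ∈ baseForms R B E F := by
  rw [← sub_zero (∑ i, c i • kd R (ι₂ B E F (f i))),
    ← sum_smul_sum_eq_zero h fun k => kd R (ι₂ B E F (f k)), ← Finset.sum_sub_distrib]
  refine sum_mem fun i _ => ?_
  rw [← smul_sub]
  have := kd_ι₂_sub_mem (R := R) (E := E) (a i) f
  rw [ha] at this
  exact Submodule.smul_mem _ _ this

/-- The differentials of generators generate the Kähler differentials. -/
lemma exists_sub_mem_baseForms {m n : ℕ} {e : Fin m → E} {f : Fin n → F}
    (he : ∀ y, ∃ c : Fin m → B, ∑ i, c i • e i = y)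
    (hf : ∀ y, ∃ c : Fin n → B, ∑ i, c i • f i = y) (x : Kaehler R B E F) :
    ∃ (c : Fin n → GSym B E F) (c' : Fin m → GSym B E F),
      x - ∑ i, c i • kd R (ι₂ B E F (f i)) - ∑ i, c' i • kd R (ι₁ B E F (e i)) ∈
        baseForms R B E F := by
  let N : Submodule (GSym B E F) (Kaehler R B E F) :=
    Submodule.span _ (Set.range fun i => kd R (ι₂ B E F (f i))) ⊔
      Submodule.span _ (Set.range fun i => kd R (ι₁ B E F (e i))) ⊔ baseForms R B E F
  have hN₀ : ∀ c, kd R (ι₀ B E F c) ∈ N := fun c =>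
    Submodule.mem_sup_right (kd_ι₀_mem_baseForms c)
  have hN₁ : ∀ y, kd R (ι₁ B E F y) ∈ N := fun y => by
    obtain ⟨c, rfl⟩ := he y
    rw [← sub_add_cancel (kd R (ι₁ B E F _)) (∑ i, ι₀ B E F (c i) • kd R (ι₁ B E F (e i)))]
    exact add_mem (Submodule.mem_sup_right (kd_ι₁_sub_mem c e))
      (Submodule.mem_sup_left (Submodule.mem_sup_right
        (sum_mem fun i _ => Submodule.smul_mem _ _ (Submodule.subset_span ⟨i, rfl⟩))))
  have hN₂ : ∀ y, kd R (ι₂ B E F y) ∈ N := fun y => by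
    obtain ⟨c, rfl⟩ := hf y
    rw [← sub_add_cancel (kd R (ι₂ B E F _)) (∑ i, ι₀ B E F (c i) • kd R (ι₂ B E F (f i)))]
    exact add_mem (Submodule.mem_sup_right (kd_ι₂_sub_mem c f))
      (Submodule.mem_sup_left (Submodule.mem_sup_left
        (sum_mem fun i _ => Submodule.smul_mem _ _ (Submodule.subset_span ⟨i, rfl⟩))))
  have sgn_mem : ∀ (s : ℤˣ), ∀ z ∈ N, s • z ∈ N := fun s z hz => by
    rcases Int.units_eq_one_or s with rfl | rfl
    · rwa [one_smul]
    · rw [Units.neg_smul, one_smul]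
      exact neg_mem hz
  have htop : ∀ y : GSym B E F, kd R y ∈ N := fun y => by
    induction y using homogeneous_induction with
    | add x y hx hy => rw [kd_add]; exact add_mem hx hy
    | h k y hy =>
      refine gr_induction (p := fun k y => kd R y ∈ N) hN₀ ?_ ?_ ?_ ?_ hy
      · intro n x y hy h
        rw [kd_mul (ι₁_mem_gr x) hy]
        exact add_mem (Submodule.smul_mem _ _ h)
          (sgn_mem _ _ (Submodule.smul_mem _ _ (hN₁ x)))
      · intro n x y hy h
        rw [kd_mul (ι₂_mem_gr x) hy]
        exact add_mem (Submodule.smul_mem _ _ h)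
          (sgn_mem _ _ (Submodule.smul_mem _ _ (hN₂ x)))
      · intro _
        have := hN₀ 0
        rwa [map_zero] at this
      · intro n x y _ _ hx hy
        rw [kd_add]
        exact add_mem hx hy
  have hx : x ∈ N := by
    have : x ∈ Submodule.span (GSym B E F) (Set.range (kd R (B := B) (E := E) (F := F))) := by
      rw [span_kd]; trivial
    refine (Submodule.span_le.mpr ?_) this
    rintro _ ⟨y, rfl⟩
    exact htop y
  obtain ⟨y, hy, z, hz, rfl⟩ := Submodule.mem_sup.mp hx
  obtain ⟨y₂, hy₂, y₁, hy₁, rfl⟩ := Submodule.mem_sup.mp hy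
  obtain ⟨c, rfl⟩ := (Submodule.mem_span_range_iff_exists_fun _).mp hy₂
  obtain ⟨c', rfl⟩ := (Submodule.mem_span_range_iff_exists_fun _).mp hy₁
  refine ⟨c, c', ?_⟩
  rw [sub_sub, add_sub_cancel_left]
  exact hz

namespace LocalData

variable (L : LocalData R B E F) {n : ℕ} {b : Fin n → B} {v : Fin n → Derivation R B B}

/-- The dual basis of `Ω[B⁄R]` transported by `α`: the derivatives of the `b i` are the coordinates
on `F`. -/
lemma sum_smul_symm (hv : ∀ ω : Ω[B⁄R],
      ∑ i, (v i).liftKaehlerDifferential ω • KaehlerDifferential.D R B (b i) = ω) (f : F) :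
    ∑ i, L.α f (b i) • L.α.symm (v i) = f := by
  refine L.eq_of_α fun c => ?_
  have := congrArg (L.α f).liftKaehlerDifferential (hv (KaehlerDifferential.D R B c))
  simp only [map_sum, map_smul, Derivation.liftKaehlerDifferential_comp_D] at this
  rw [← this, map_sum, ← Derivation.coeFnAddMonoidHom_apply, map_sum, Finset.sum_apply]
  refine Finset.sum_congr rfl fun i _ => ?_
  rw [Derivation.coeFnAddMonoidHom_apply, map_smul, Derivation.smul_apply,
    LinearEquiv.apply_symm_apply, smul_eq_mul, smul_eq_mul, mul_comm]

/-- Every graded derivation is in the image of the contraction. -/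
theorem exists_flat_eq [Module.Finite B E] [Module.Projective B E]
    [Module.Finite B Ω[B⁄R]] [Module.Projective B Ω[B⁄R]] (hπ : IsStrictPoisson R δ π)
    (h₂₀ : ∀ f b, π (ι₂ B E F f) (ι₀ B E F b) = ι₀ B E F (L.α f b))
    (h₁₁ : ∀ e e', π (ι₁ B E F e) (ι₁ B E F e') = ι₀ B E F (L.Q e e'))
    {k : ℤ} {D : GSym B E F →+ GSym B E F} (hD : IsGradedDerivation R k D) :
    ∃ x, hπ.flat x = D := by
  obtain ⟨n, b, v, hv⟩ := exists_dual_basis_kaehlerDifferential (R := R) (B := B)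
  obtain ⟨m, e, e', he⟩ := exists_dual_basis_form L.bijective
  -- correct the derivation on `B`, then on `E`, then on `F`
  have step₀ : ∃ x D', D = hπ.flat x + D' ∧ IsGradedDerivation R k D' ∧
      ∀ c, D' (ι₀ B E F c) = 0 := by
    -- Because `[α⁻¹ (v i), c] = v i c`, the contraction of this form restricts to `D` on `B` by
    -- `map_ι₀_eq_sum`.
    refine ⟨∑ i, D (ι₀ B E F (b i)) • kd R (ι₂ B E F (L.α.symm (v i))), _,
      (add_sub_cancel _ _).symm, hD.sub ?_, fun c => ?_⟩
    · rw [map_sum]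
      refine .sum _ fun i _ => ?_
      rw [map_smul, hπ.flat_kd]
      have := (hπ.right_derivation 2 _ (ι₂_mem_gr (L.α.symm (v i)))).left_mul
        (hD.map_gr _ _ (ι₀_mem_gr (b i)))
      convert this using 1
      ring
    · rw [AddMonoidHom.sub_apply, hD.map_ι₀_eq_sum hv, map_sum, AddMonoidHom.finsetSum_apply,
        ← Finset.sum_sub_distrib]
      refine Finset.sum_eq_zero fun i _ => ?_
      rw [map_smul, hπ.flat_kd, AddMonoidHom.smul_apply, h₂₀, LinearEquiv.apply_symm_apply,
        smul_eq_mul, (commute_ι₀ _ _).eq, sub_self]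
  obtain ⟨x₀, D₀, rfl, hD₀, hD₀₀⟩ := step₀
  have hlin : ∀ {D : GSym B E F →+ GSym B E F}, IsGradedDerivation R k D →
      (∀ c, D (ι₀ B E F c) = 0) → ∀ c x, D (ι₀ B E F c * x) = ι₀ B E F c * D x := by
    intro D hD h c x
    rw [hD.leibniz 0 _ (ι₀_mem_gr c), h, zero_mul, zero_add, mul_zero, Int.negOnePow_zero,
      one_smul]
  have step₁ : ∃ x D', D₀ = hπ.flat x + D' ∧ IsGradedDerivation R k D' ∧
      (∀ c, D' (ι₀ B E F c) = 0) ∧ ∀ y, D' (ι₁ B E F y) = 0 := by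
    -- Brackets with `E` kill `B`, so this correction leaves the previous one intact; in the last
    -- step, brackets with `B` kill both `B` and `E`.
    refine ⟨∑ i, D₀ (ι₁ B E F (e i)) • kd R (ι₁ B E F (e' i)), _,
      (add_sub_cancel _ _).symm, hD₀.sub ?_, fun c => ?_, fun y => ?_⟩
    · rw [map_sum]
      refine .sum _ fun i _ => ?_
      rw [map_smul, hπ.flat_kd]
      have := (hπ.right_derivation 1 _ (ι₁_mem_gr (e' i))).left_mul
        (hD₀.map_gr _ _ (ι₁_mem_gr (e i)))
      convert this using 1
      ring
    · rw [AddMonoidHom.sub_apply, hD₀₀, map_sum, AddMonoidHom.finsetSum_apply, zero_sub,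
        neg_eq_zero]
      refine Finset.sum_eq_zero fun i _ => ?_
      rw [map_smul, hπ.flat_kd, AddMonoidHom.smul_apply, gr_of_neg (by norm_num)
        (bracket_mem_gr hπ.right_derivation (ι₁_mem_gr (e' i)) (ι₀_mem_gr c)), smul_zero]
    · rw [AddMonoidHom.sub_apply, map_sum, AddMonoidHom.finsetSum_apply, sub_eq_zero]
      conv_lhs => rw [← he y, map_sum, map_sum]
      refine Finset.sum_congr rfl fun i _ => ?_
      rw [map_smul hπ.flat, hπ.flat_kd, AddMonoidHom.smul_apply, h₁₁, map_smul, ← ι₀_mul,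
        hlin hD₀ hD₀₀,
        smul_eq_mul, (commute_ι₀ _ _).eq]
  obtain ⟨x₁, D₁, rfl, hD₁, hD₁₀, hD₁₁⟩ := step₁
  -- The minus sign comes from `[b, f] = -α(f)(b)`.
  have step₂ : D₁ = hπ.flat (-∑ i, D₁ (ι₂ B E F (L.α.symm (v i))) • kd R (ι₀ B E F (b i))) := by
    rw [map_neg, map_sum]
    refine hD₁.ext (IsGradedDerivation.neg (.sum _ fun i _ => ?_)) (fun c => ?_) (fun y => ?_)
      fun f => ?_
    · rw [map_smul, hπ.flat_kd]
      have := (hπ.right_derivation 0 _ (ι₀_mem_gr (b i))).left_mul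
        (hD₁.map_gr _ _ (ι₂_mem_gr (L.α.symm (v i))))
      convert this using 1
      ring
    · rw [hD₁₀, AddMonoidHom.neg_apply, AddMonoidHom.finsetSum_apply, eq_comm, neg_eq_zero]
      refine Finset.sum_eq_zero fun i _ => ?_
      rw [map_smul, hπ.flat_kd, AddMonoidHom.smul_apply, gr_of_neg (by norm_num)
        (bracket_mem_gr hπ.right_derivation (ι₀_mem_gr (b i)) (ι₀_mem_gr c)), smul_zero]
    · rw [hD₁₁, AddMonoidHom.neg_apply, AddMonoidHom.finsetSum_apply, eq_comm, neg_eq_zero]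
      refine Finset.sum_eq_zero fun i _ => ?_
      rw [map_smul, hπ.flat_kd, AddMonoidHom.smul_apply, gr_of_neg (by norm_num)
        (bracket_mem_gr hπ.right_derivation (ι₀_mem_gr (b i)) (ι₁_mem_gr y)), smul_zero]
    · rw [AddMonoidHom.neg_apply, AddMonoidHom.finsetSum_apply, ← Finset.sum_neg_distrib]
      conv_lhs => rw [← L.sum_smul_symm hv f, map_sum, map_sum]
      refine Finset.sum_congr rfl fun i _ => ?_
      rw [map_smul hπ.flat, hπ.flat_kd, AddMonoidHom.smul_apply,
        hπ.skew 0 2 _ (ι₀_mem_gr (b i)) _ (ι₂_mem_gr f), h₂₀, map_smul, ← ι₀_mul, hlin hD₁ hD₁₀,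
        smul_eq_mul, (commute_ι₀ _ _).eq, zero_mul, Int.negOnePow_zero, one_smul, mul_neg, neg_neg]
  exact ⟨x₀ + (x₁ + _), by rw [map_add, map_add, ← step₂]⟩

/-- The contraction is injective. -/
theorem flat_injective [Module.Finite B E] [Module.Projective B E]
    [Module.Finite B Ω[B⁄R]] [Module.Projective B Ω[B⁄R]] (hπ : IsStrictPoisson R δ π)
    (h₂₀ : ∀ f b, π (ι₂ B E F f) (ι₀ B E F b) = ι₀ B E F (L.α f b))
    (h₁₁ : ∀ e e', π (ι₁ B E F e) (ι₁ B E F e') = ι₀ B E F (L.Q e e')) :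
    Function.Injective hπ.flat := by
  obtain ⟨n, b, v, hv⟩ := exists_dual_basis_kaehlerDifferential (R := R) (B := B)
  obtain ⟨m, e, e', he⟩ := exists_dual_basis_form L.bijective
  rw [injective_iff_map_eq_zero]
  intro x hx
  obtain ⟨c, c', hcc'⟩ := exists_sub_mem_baseForms (fun x => ⟨_, he x⟩)
    (fun f => ⟨_, L.sum_smul_symm hv f⟩) x
  -- Evaluation on `b k` sees only the differentials of `F`. Afterwards evaluation on `e' k` sees
  -- only those of `E`, and evaluation on `α⁻¹ (v k)` handles the remaining base form.
  have hc : ∑ i, c i • kd R (ι₂ B E F (L.α.symm (v i))) ∈ baseForms R B E F := by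
    refine sum_mem_baseForms_ι₂ c (fun i k => v i (b k)) (fun i => ?_) fun k => ?_
    · have := L.sum_smul_symm hv (L.α.symm (v i))
      rwa [LinearEquiv.apply_symm_apply] at this
    · have h := hπ.flat_of_mem_baseForms hcc' (ι₀_mem_gr (b k)) (by norm_num)
      have h' : hπ.flat (∑ i, c' i • kd R (ι₁ B E F (e i))) (ι₀ B E F (b k)) = 0 := by
        rw [map_sum, AddMonoidHom.finsetSum_apply]
        refine Finset.sum_eq_zero fun i _ => ?_
        rw [map_smul, hπ.flat_kd, AddMonoidHom.smul_apply, gr_of_neg (by norm_num)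
          (bracket_mem_gr hπ.right_derivation (ι₁_mem_gr (e i)) (ι₀_mem_gr (b k))), smul_zero]
      rw [map_sub, map_sub, hx, zero_sub, AddMonoidHom.sub_apply, AddMonoidHom.neg_apply, h',
        sub_zero, neg_eq_zero, map_sum, AddMonoidHom.finsetSum_apply] at h
      rw [← h]
      refine Finset.sum_congr rfl fun i _ => ?_
      rw [map_smul, hπ.flat_kd, AddMonoidHom.smul_apply, h₂₀, LinearEquiv.apply_symm_apply,
        smul_eq_mul]
  replace hcc' := add_mem hcc' hc
  rw [sub_add_eq_add_sub, sub_add_cancel] at hcc'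
  have hc' : ∑ i, c' i • kd R (ι₁ B E F (e i)) ∈ baseForms R B E F := by
    refine sum_mem_baseForms_ι₁ c' (fun i k => L.Q (e' k) (e i)) (fun i => he (e i)) fun k => ?_
    have h := hπ.flat_of_mem_baseForms hcc' (ι₁_mem_gr (e' k)) (by norm_num)
    rw [map_sub, hx, zero_sub, AddMonoidHom.neg_apply, map_sum,
        AddMonoidHom.finsetSum_apply, neg_eq_zero] at h
    rw [← h]
    refine Finset.sum_congr rfl fun i _ => ?_
    rw [map_smul, hπ.flat_kd, AddMonoidHom.smul_apply, h₁₁, smul_eq_mul, L.symm]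
  have hx₀ := add_mem hcc' hc'
  rw [sub_add_cancel, baseForms_eq_span hv] at hx₀
  obtain ⟨c, rfl⟩ := (Submodule.mem_span_range_iff_exists_fun _).mp hx₀
  have key : ∀ k, ∑ i, c i * ι₀ B E F (v k (b i)) = 0 := fun k => by
    have := DFunLike.congr_fun hx (ι₂ B E F (L.α.symm (v k)))
    rw [map_sum, AddMonoidHom.finsetSum_apply, AddMonoidHom.zero_apply] at this
    rw [← neg_eq_zero, ← this, ← Finset.sum_neg_distrib]
    refine Finset.sum_congr rfl fun i _ => ?_
    rw [map_smul, hπ.flat_kd, AddMonoidHom.smul_apply,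
      hπ.skew 0 2 _ (ι₀_mem_gr (b i)) _ (ι₂_mem_gr _), h₂₀, LinearEquiv.apply_symm_apply,
      zero_mul, Int.negOnePow_zero, one_smul, smul_eq_mul, mul_neg]
  have : ∀ i, c i • kd R (ι₀ B E F (b i)) =
      ∑ k, (c i * ι₀ B E F (v k (b i))) • kd R (ι₀ B E F (b k)) := fun i => by
    conv_lhs => rw [kd_ι₀_eq_sum hv (b i), Finset.smul_sum]
    simp only [smul_smul]
  rw [Finset.sum_congr rfl fun i _ => this i, Finset.sum_comm]
  refine Finset.sum_eq_zero fun k _ => ?_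
  rw [← Finset.sum_smul, key, zero_smul]

theorem strictlyNondegenerate [Module.Finite B E] [Module.Projective B E]
    [Module.Finite B Ω[B⁄R]] [Module.Projective B Ω[B⁄R]] (hπ : IsStrictPoisson R δ π)
    (h₂₀ : ∀ f b, π (ι₂ B E F f) (ι₀ B E F b) = ι₀ B E F (L.α f b))
    (h₁₁ : ∀ e e', π (ι₁ B E F e) (ι₁ B E F e') = ι₀ B E F (L.Q e e')) :
    hπ.StrictlyNondegenerate := by
  refine ⟨L.flat_injective hπ h₂₀ h₁₁, Set.Subset.antisymm ?_ ?_⟩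
  · rintro _ ⟨x, rfl⟩
    exact hπ.flat_mem x
  · have : gradedDerivations R B E F ≤ (LinearMap.range hπ.flat).toAddSubgroup := by
      refine (AddSubgroup.closure_le _).mpr ?_
      rintro D ⟨k, hD⟩
      exact L.exists_flat_eq hπ h₂₀ h₁₁ hD
    exact this

end LocalData

end Nondegenerate

end GSym

/-! ### Local data and sections recovered from a non-degenerate bracket. -/

namespace GSym

section LocalDataOfBracket

variable {R B E F : Type*} [CommRing R] [CommRing B] [Algebra R B]
  [AddCommGroup E] [Module B E] [AddCommGroup F] [Module B F]
  {δ : GSym B E F →+ GSym B E F} {π : GSym B E F →+ GSym B E F →+ GSym B E F}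

/-- A graded derivation of degree `0` restricts to a derivation of `B`. -/
lemma IsGradedDerivation.exists_derivation {D : GSym B E F →+ GSym B E F}
    (hD : IsGradedDerivation R 0 D) :
    ∃ v : Derivation R B B, ∀ b, D (ι₀ B E F b) = ι₀ B E F (v b) := by
  have h : ∀ b, D (ι₀ B E F b) = ι₀ B E F (r₀ B E F (D (ι₀ B E F b))) := fun b =>
    (ι₀_r₀ (hD.map_gr 0 _ (ι₀_mem_gr b))).symm
  obtain ⟨l, hl⟩ := exists_linearMap_kaehlerDifferential (R := R) (M := B)
    (((r₀ B E F : GSym B E F →+* B).toAddMonoidHom.comp D).comp (ι₀ B E F).toAddMonoidHom)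
    (fun b b' => by
      change r₀ B E F (D (ι₀ B E F (b * b'))) =
        b • r₀ B E F (D (ι₀ B E F b')) + b' • r₀ B E F (D (ι₀ B E F b))
      rw [map_mul, hD.leibniz 0 _ (ι₀_mem_gr b), mul_zero, Int.negOnePow_zero, one_smul, map_add,
        map_mul, map_mul, r₀_ι₀, r₀_ι₀, smul_eq_mul, smul_eq_mul, add_comm, mul_comm b'])
    (fun r => by
      change r₀ B E F (D (ι₀ B E F (algebraMap R B r))) = 0
      rw [hD.map_base, map_zero])
  exact ⟨l.compDer (KaehlerDifferential.D R B), fun b => by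
    rw [h]
    exact congrArg _ (hl b).symm⟩

/-- The Leibniz rule for the connection defined by a dual basis. -/
lemma sum_derivation_smul {n : ℕ} {e : Fin n → E} {ξ : Fin n → E →ₗ[B] B}
    (he : ∀ x, ∑ i, ξ i x • e i = x) (v : Derivation R B B) (b : B) (x : E) :
    ∑ i, v (ξ i (b • x)) • e i = v b • x + b • ∑ i, v (ξ i x) • e i := by
  have h : v b • x = ∑ i, v b • ξ i x • e i := by rw [← Finset.smul_sum, he]
  rw [h, Finset.smul_sum, ← Finset.sum_add_distrib]
  refine Finset.sum_congr rfl fun i _ => ?_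
  rw [map_smul, smul_eq_mul, Derivation.leibniz, add_smul, smul_smul, smul_smul, smul_eq_mul,
    smul_eq_mul, add_comm, mul_comm (v b)]

/-- Derivations of `B` extend to graded derivations of degree `0`. -/
lemma exists_extension_derivation [Module.Finite B E] [Module.Projective B E] [Module.Finite B F]
    [Module.Projective B F] (v : Derivation R B B) :
    ∃ D : GSym B E F →+ GSym B E F, IsGradedDerivation R 0 D ∧
      ∀ b, D (ι₀ B E F b) = ι₀ B E F (v b) := by
  obtain ⟨m, e, ξ, he⟩ := exists_dual_basis B E
  obtain ⟨n, f, η, hf⟩ := exists_dual_basis B F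
  obtain ⟨D, hD, h, -, -⟩ := exists_isGradedDerivation (R := R) (B := B) (E := E) (F := F) 0
    ((ι₀ B E F).toAddMonoidHom.comp (v : B →ₗ[R] B).toAddMonoidHom)
    (AddMonoidHom.mk' (fun x => ι₁ B E F (∑ j, v (ξ j x) • e j)) fun x y => by
      simp only [map_add, add_smul, Finset.sum_add_distrib])
    (AddMonoidHom.mk' (fun x => ι₂ B E F (∑ j, v (η j x) • f j)) fun x y => by
      simp only [map_add, add_smul, Finset.sum_add_distrib])
    (fun r => by
      change ι₀ B E F (v (algebraMap R B r)) = 0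
      rw [Derivation.map_algebraMap, map_zero])
    (fun _ => ι₀_mem_gr _) (fun _ => ι₁_mem_gr _) (fun _ => ι₂_mem_gr _)
    (fun b b' => by
      change ι₀ B E F (v (b * b')) = ι₀ B E F (v b) * ι₀ B E F b' + ι₀ B E F b * ι₀ B E F (v b')
      rw [Derivation.leibniz, ← map_mul, ← map_mul, ← map_add, smul_eq_mul, smul_eq_mul,
        mul_comm b', add_comm])
    (fun b x => by
      change ι₁ B E F (∑ j, v (ξ j (b • x)) • e j) = ι₀ B E F (v b) * ι₁ B E F x +
        ι₀ B E F b * ι₁ B E F (∑ j, v (ξ j x) • e j)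
      rw [sum_derivation_smul he, map_add, ι₁_smul, ι₁_smul])
    (fun b x => by
      change ι₂ B E F (∑ j, v (η j (b • x)) • f j) = ι₀ B E F (v b) * ι₂ B E F x +
        ι₀ B E F b * ι₂ B E F (∑ j, v (η j x) • f j)
      rw [sum_derivation_smul hf, map_add, ι₂_smul, ι₂_smul])
  exact ⟨D, hD, h⟩

/-- Linear forms on `E` extend to graded derivations of degree `-1`. -/
lemma exists_extension_dual_one (ξ : E →ₗ[B] B) :
    ∃ D : GSym B E F →+ GSym B E F, IsGradedDerivation R (-1) D ∧
      ∀ e, D (ι₁ B E F e) = ι₀ B E F (ξ e) := by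
  obtain ⟨D, hD, -, h, -⟩ := exists_isGradedDerivation (R := R) (B := B) (E := E) (F := F) (-1) 0
    ((ι₀ B E F).toAddMonoidHom.comp ξ.toAddMonoidHom) 0 (fun _ => rfl)
    (fun _ => zero_mem _) (fun e => (ι₀_mem_gr (ξ e) : _ ∈ gr B E F 0)) (fun _ => zero_mem _)
    (fun b b' => by simp only [AddMonoidHom.zero_apply, zero_mul, mul_zero, add_zero])
    (fun b x => by
      change ι₀ B E F (ξ (b • x)) = 0 * _ + ι₀ B E F b * ι₀ B E F (ξ x)
      rw [map_smul, smul_eq_mul, map_mul, zero_mul, zero_add])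
    (fun b b' => by simp only [AddMonoidHom.zero_apply, zero_mul, mul_zero, add_zero])
  exact ⟨D, hD, h⟩

/-- Linear forms on `F` extend to graded derivations of degree `-2`. -/
lemma exists_extension_dual_two (ξ : F →ₗ[B] B) :
    ∃ D : GSym B E F →+ GSym B E F, IsGradedDerivation R (-2) D ∧
      ∀ f, D (ι₂ B E F f) = ι₀ B E F (ξ f) := by
  obtain ⟨D, hD, -, -, h⟩ := exists_isGradedDerivation (R := R) (B := B) (E := E) (F := F) (-2) 0 0
    ((ι₀ B E F).toAddMonoidHom.comp ξ.toAddMonoidHom) (fun _ => rfl)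
    (fun _ => zero_mem _) (fun _ => zero_mem _) (fun f => (ι₀_mem_gr (ξ f) : _ ∈ gr B E F 0))
    (fun b b' => by simp only [AddMonoidHom.zero_apply, zero_mul, mul_zero, add_zero])
    (fun b b' => by simp only [AddMonoidHom.zero_apply, zero_mul, mul_zero, add_zero])
    (fun b x => by
      change ι₀ B E F (ξ (b • x)) = 0 * _ + ι₀ B E F b * ι₀ B E F (ξ x)
      rw [map_smul, smul_eq_mul, map_mul, zero_mul, zero_add])
  exact ⟨D, hD, h⟩

/-- The degree `0` parts of the values of `π♭` on some elements are combinations of those of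
brackets. -/
lemma IsStrictPoisson.r₀_flat_mem (hπ : IsStrictPoisson R δ π) {Z : Type*} (s : Z → GSym B E F)
    (V : Submodule B (Z → B))
    (h : ∀ m, ∀ y ∈ gr B E F m, (fun z => r₀ B E F (π y (s z))) ∈ V) (x : Kaehler R B E F) :
    (fun z => r₀ B E F (hπ.flat x (s z))) ∈ V := by
  have hmem : ∀ y, (fun z => r₀ B E F (π y (s z))) ∈ V := fun y => by
    induction y using homogeneous_induction with
    | h m y hy => exact h m y hy
    | add x y hx hy =>
      simp only [map_add, AddMonoidHom.add_apply]
      exact add_mem hx hy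
  have hx : x ∈ Submodule.span (GSym B E F) (Set.range (kd R (B := B) (E := E) (F := F))) := by
    rw [span_kd]; trivial
  obtain ⟨c, rfl⟩ := (Finsupp.mem_span_range_iff_exists_finsupp).mp hx
  have : (fun z => r₀ B E F (hπ.flat (c.sum fun i a => a • kd R i) (s z))) =
      ∑ i ∈ c.support, r₀ B E F (c i) • fun z => r₀ B E F (π i (s z)) := by
    ext z
    simp only [Finsupp.sum, map_sum, AddMonoidHom.finsetSum_apply, map_smul, hπ.flat_kd,
      AddMonoidHom.smul_apply, Finset.sum_apply, Pi.smul_apply, smul_eq_mul, map_mul]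
  rw [this]
  exact sum_mem fun i _ => Submodule.smul_mem _ _ (hmem i)

/-- A strictly non-degenerate Poisson bracket determines an isomorphism with the tangent sheaf, a
covariant derivative and an inner product. -/
theorem IsStrictPoisson.exists_localData [Module.Finite B E] [Module.Projective B E]
    [Module.Finite B F] [Module.Projective B F] (hπ : IsStrictPoisson R δ π)
    (hflat : ∀ k D, IsGradedDerivation R k D → ∃ x, hπ.flat x = D) :
    ∃ L : LocalData R B E F,
      (∀ f b, π (ι₂ B E F f) (ι₀ B E F b) = ι₀ B E F (L.α f b)) ∧
      (∀ e e', π (ι₁ B E F e) (ι₁ B E F e') = ι₀ B E F (L.Q e e')) ∧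
      ∀ f e, π (ι₂ B E F f) (ι₁ B E F e) = ι₁ B E F (L.cov f e) := by
  have inj₀ := ι₀_injective (B := B) (E := E) (F := F)
  have inj₁ := ι₁_injective (B := B) (E := E) (F := F)
  have h₀₀ : ∀ b b', π (ι₀ B E F b) (ι₀ B E F b') = 0 := fun b b' => gr_of_neg (by norm_num)
    (bracket_mem_gr hπ.right_derivation (ι₀_mem_gr b) (ι₀_mem_gr b'))
  have h₀₁ : ∀ b e, π (ι₀ B E F b) (ι₁ B E F e) = 0 := fun b e => gr_of_neg (by norm_num)
    (bracket_mem_gr hπ.right_derivation (ι₀_mem_gr b) (ι₁_mem_gr e))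
  have h₁₀ : ∀ b e, π (ι₁ B E F e) (ι₀ B E F b) = 0 := fun b e => gr_of_neg (by norm_num)
    (bracket_mem_gr hπ.right_derivation (ι₁_mem_gr e) (ι₀_mem_gr b))
  choose α hα using fun f =>
    (hπ.right_derivation 2 _ (ι₂_mem_gr f)).exists_derivation
  choose q hq using fun e e' => mem_gr_zero (bracket_mem_gr (m := 1) (n := 1) hπ.right_derivation
    (ι₁_mem_gr e) (ι₁_mem_gr e'))
  choose c hc using fun f e => mem_gr_one (bracket_mem_gr (m := 2) (n := 1) hπ.right_derivation
    (ι₂_mem_gr f) (ι₁_mem_gr e))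
  have q_symm : ∀ e e', q e e' = q e' e := fun e e' => inj₀ <| by
    rw [← hq, hπ.skew 1 1 _ (ι₁_mem_gr e) _ (ι₁_mem_gr e'), ← hq, mul_one, Int.negOnePow_one,
      Units.neg_smul, one_smul, neg_neg]
  have q_add : ∀ e e' e'', q e (e' + e'') = q e e' + q e e'' := fun e e' e'' => inj₀ <| by
    rw [map_add, ← hq, ← hq, ← hq, map_add, map_add]
  have q_smul : ∀ (b : B) e e', q e (b • e') = b • q e e' := fun b e e' => inj₀ <| by
    rw [smul_eq_mul, map_mul, ← hq, ← hq, ι₁_smul,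
      (hπ.right_derivation 1 _ (ι₁_mem_gr e)).leibniz 0 _ (ι₀_mem_gr b), h₁₀, zero_mul, zero_add,
      mul_zero, Int.negOnePow_zero, one_smul]
  let Q : LinearMap.BilinForm B E := LinearMap.mk₂ B q
    (fun e e' e'' => by rw [q_symm, q_add, q_symm e, q_symm e'])
    (fun b e e' => by rw [q_symm, q_smul, q_symm e]) q_add q_smul
  let α' : F →ₗ[B] Derivation R B B :=
    { toFun := α
      map_add' := fun f f' => Derivation.ext fun b => inj₀ <| by
        rw [← hα, Derivation.add_apply, map_add (ι₀ B E F), ← hα, ← hα, map_add, map_add,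
          AddMonoidHom.add_apply]
      map_smul' := fun c f => Derivation.ext fun b => inj₀ <| by
        rw [← hα, RingHom.id_apply, Derivation.smul_apply, smul_eq_mul, map_mul, ← hα, ι₂_smul,
          hπ.left_leibniz 0 2 _ (ι₀_mem_gr c) _ (ι₂_mem_gr f), h₀₀, mul_zero, smul_zero,
          add_zero] }
  -- Extend a linear form `ξ` on `F` to a derivation, which is some `flat x`. The degree 0 part of
  -- its value at `f` is a combination of brackets `[b, f]`, zero if `α f = 0`. So every `ξ` kills
  -- `f`, and `F` is projective.
  have hαinj : Function.Injective α' := by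
    rw [injective_iff_map_eq_zero]
    intro f hf
    rw [← Module.forall_dual_apply_eq_zero_iff B]
    intro ξ
    obtain ⟨D, hD, hDξ⟩ := exists_extension_dual_two (R := R) (E := E) ξ
    obtain ⟨x, rfl⟩ := hflat _ D hD
    have := hπ.r₀_flat_mem (fun f : F => ι₂ B E F f)
      (LinearMap.ker (LinearMap.proj f : (F → B) →ₗ[B] B)) (fun m y hy => ?_) x
    · rw [LinearMap.mem_ker, LinearMap.proj_apply, hDξ, r₀_ι₀] at this
      exact this
    · rw [LinearMap.mem_ker, LinearMap.proj_apply]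
      by_cases hm : m = 0
      · subst hm
        obtain ⟨b, rfl⟩ := mem_gr_zero hy
        have h0 : α f b = 0 := DFunLike.congr_fun hf b
        rw [hπ.skew 0 2 _ hy _ (ι₂_mem_gr f), hα, h0, map_zero, smul_zero, neg_zero, map_zero]
      · exact r₀_of_mem_gr (n := m + 2 - 2) (by omega)
          (bracket_mem_gr hπ.right_derivation hy (ι₂_mem_gr f))
  -- A vector field extends to a derivation of degree 0, which is some `flat x`. In degree 0 only
  -- brackets of `b` with elements of degree 2 contribute, and their bivector parts vanish there,
  -- leaving a combination of the `α f`.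
  have hαsurj : Function.Surjective α' := by
    intro v
    obtain ⟨D, hD, hDv⟩ := exists_extension_derivation (E := E) (F := F) v
    obtain ⟨x, rfl⟩ := hflat _ D hD
    have hmem := hπ.r₀_flat_mem (fun b : B => ι₀ B E F b)
      (LinearMap.range ({ toFun := fun f b => α' f b
                          map_add' := fun f f' => by ext; simp
                          map_smul' := fun b f => by ext; simp } : F →ₗ[B] (B → B)))
      (fun m y hy => ?_) x
    · obtain ⟨f, hf⟩ := hmem
      refine ⟨f, Derivation.ext fun b => ?_⟩
      have := congrFun hf b
      rw [hDv, r₀_ι₀] at this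
      exact this
    · by_cases hm : m = 2
      · subst hm
        obtain ⟨f, w, hw, rfl⟩ := mem_gr_two hy
        refine ⟨f, ?_⟩
        ext b
        have hwb : π w (ι₀ B E F b) = 0 := by
          rw [hπ.skew 2 0 _ (sq_range_ι₁_le_gr hw) _ (ι₀_mem_gr b), hπ.bracket_ι₀_sq_range b hw,
            smul_zero, neg_zero]
        rw [map_add, AddMonoidHom.add_apply, hwb, add_zero, hα, r₀_ι₀]
        rfl
      · refine ⟨0, ?_⟩
        rw [map_zero]
        ext b
        exact (r₀_of_mem_gr (n := m + 0 - 2) (by omega)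
          (bracket_mem_gr hπ.right_derivation hy (ι₀_mem_gr b))).symm
  -- The same argument for linear forms on `E`, where only elements of degree 1 contribute.
  have hQsurj : Function.Surjective Q := by
    intro ξ
    obtain ⟨D, hD, hDξ⟩ := exists_extension_dual_one (R := R) (F := F) ξ
    obtain ⟨x, rfl⟩ := hflat _ D hD
    have hmem := hπ.r₀_flat_mem (fun e : E => ι₁ B E F e)
      (LinearMap.range ({ toFun := fun e e' => Q e e'
                          map_add' := fun f f' => by ext; simp
                          map_smul' := fun b f => by ext; simp } : E →ₗ[B] (E → B)))
      (fun m y hy => ?_) x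
    · obtain ⟨e, he⟩ := hmem
      refine ⟨e, LinearMap.ext fun b => ?_⟩
      have := congrFun he b
      rw [hDξ, r₀_ι₀] at this
      exact this
    · by_cases hm : m = 1
      · subst hm
        obtain ⟨e, rfl⟩ := mem_gr_one hy
        refine ⟨e, ?_⟩
        ext e'
        rw [hq, r₀_ι₀]
        rfl
      · refine ⟨0, ?_⟩
        rw [map_zero]
        ext e'
        exact (r₀_of_mem_gr (n := m + 1 - 2) (by omega)
          (bracket_mem_gr hπ.right_derivation hy (ι₁_mem_gr e'))).symm
  -- Every linear form is some `Q e'`, so by symmetry all of them kill an element of the kernel.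
  have hQinj : Function.Injective Q := by
    rw [injective_iff_map_eq_zero]
    intro e he
    rw [← Module.forall_dual_apply_eq_zero_iff B]
    intro ξ
    obtain ⟨e', rfl⟩ := hQsurj ξ
    exact (q_symm e' e).trans (LinearMap.congr_fun he e')
  refine ⟨{ α := LinearEquiv.ofBijective α' ⟨hαinj, hαsurj⟩
            cov := AddMonoidHom.mk' (fun f => AddMonoidHom.mk' (c f) fun e e' => inj₁ ?_)
              fun f f' => AddMonoidHom.ext fun e => inj₁ ?_
            cov_smul_left := fun b f e => inj₁ ?_
            cov_smul := fun f b e => inj₁ ?_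
            Q := Q
            symm := q_symm
            bijective := ⟨hQinj, hQsurj⟩
            compatible := fun f e e' => inj₀ ?_ }, hα, hq, hc⟩
  · rw [map_add, ← hc, ← hc, ← hc, map_add, map_add]
  · change ι₁ B E F (c (f + f') e) = ι₁ B E F (c f e + c f' e)
    rw [map_add, ← hc, ← hc, ← hc, map_add, map_add, AddMonoidHom.add_apply]
  · change ι₁ B E F (c (b • f) e) = ι₁ B E F (b • c f e)
    rw [ι₁_smul, ← hc, ← hc, ι₂_smul, hπ.left_leibniz 0 2 _ (ι₀_mem_gr b) _ (ι₂_mem_gr f), h₀₁,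
      mul_zero, smul_zero, add_zero]
  · change ι₁ B E F (c f (b • e)) = ι₁ B E F (b • c f e + α f b • e)
    rw [map_add, ι₁_smul, ι₁_smul, ← hc, ← hc, ι₁_smul,
      (hπ.right_derivation 2 _ (ι₂_mem_gr f)).leibniz 0 _ (ι₀_mem_gr b), hα, mul_zero,
      Int.negOnePow_zero, one_smul, add_comm]
  · change ι₀ B E F (α f (q e e')) = ι₀ B E F (q (c f e) e' + q e (c f e'))
    rw [map_add, ← hα, ← hq, ← hq, ← hq, ← hc, ← hc,
      hπ.jacobi 2 1 _ (ι₂_mem_gr f) _ (ι₁_mem_gr e), Int.negOnePow_even (2 * 1) (by decide),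
      one_smul]

/-- A differential compatible with the Poisson bracket is determined by a section of `E`. -/
theorem LocalData.exists_section (L : LocalData R B E F) (hδ : IsDifferential R δ)
    (hπ : IsStrictPoisson R δ π)
    (h₂₀ : ∀ f b, π (ι₂ B E F f) (ι₀ B E F b) = ι₀ B E F (L.α f b))
    (h₁₁ : ∀ e e', π (ι₁ B E F e) (ι₁ B E F e') = ι₀ B E F (L.Q e e'))
    (h₂₁ : ∀ f e, π (ι₂ B E F f) (ι₁ B E F e) = ι₁ B E F (L.cov f e)) :
    ∃ s : E, (∀ e, δ (ι₁ B E F e) = ι₀ B E F (L.Q s e)) ∧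
      (∀ f, δ (ι₂ B E F f) = -ι₁ B E F (L.cov f s)) ∧ ∀ f, L.α f (L.Q s s) = 0 := by
  have inj₀ := ι₀_injective (B := B) (E := E) (F := F)
  have inj₁ := ι₁_injective (B := B) (E := E) (F := F)
  have hd := hδ.isGradedDerivation
  have hδ₀ : ∀ b, δ (ι₀ B E F b) = 0 := fun b =>
    gr_of_neg (by norm_num) (hd.map_gr _ _ (ι₀_mem_gr b))
  choose ξ hξ using fun e => mem_gr_zero (hd.map_gr 1 _ (ι₁_mem_gr e))
  choose u hu using fun f => mem_gr_one (hd.map_gr 2 _ (ι₂_mem_gr f))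
  obtain ⟨s, hs⟩ := L.bijective.2
    { toFun := ξ
      map_add' := fun e e' => inj₀ <| by rw [map_add, ← hξ, ← hξ, ← hξ, map_add, map_add]
      map_smul' := fun b e => inj₀ <| by
        rw [RingHom.id_apply, smul_eq_mul, map_mul, ← hξ, ← hξ, ι₁_smul,
          hd.leibniz 0 _ (ι₀_mem_gr b), hδ₀, zero_mul, zero_add, mul_zero, Int.negOnePow_zero,
          one_smul] }
  have hs₁ : ∀ e, δ (ι₁ B E F e) = ι₀ B E F (L.Q s e) := fun e => by
    rw [hξ, hs]; rfl
  -- Apply the differential to `[f, e]` and compare with the compatibility of `Q` and the covariant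
  -- derivative; `Q` detects the difference.
  have hu' : ∀ f, u f = -L.cov f s := fun f => by
    refine L.bijective.1 (LinearMap.ext fun e => inj₀ ?_)
    have h := hπ.differential 2 _ (ι₂_mem_gr f) (ι₁ B E F e)
    rw [h₂₁, hs₁, hs₁, h₂₀, hu, h₁₁, Int.negOnePow_even 2 (by decide), one_smul, L.compatible,
      ← map_add] at h
    have h' := inj₀ h
    congr 1
    rw [map_neg, LinearMap.neg_apply]
    linear_combination -h'
  refine ⟨s, hs₁, fun f => by rw [hu, hu', map_neg], fun f => inj₀ ?_⟩
  -- Applying `δ` twice to `f` gives, up to sign, `Q(s, ∇_f s)`, and twice this value is `α(f)`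
  -- applied to `Q(s, s)`.
  have h := hδ.sq_zero (ι₂ B E F f)
  rw [hu, hs₁, hu', map_neg, map_neg, neg_eq_zero] at h
  rw [L.compatible, L.symm (L.cov f s), map_add, h, add_zero, map_zero]

end LocalDataOfBracket

end GSym

/-! ### Vector bundles have finite projective sections on affine opens. -/

namespace SheafOfModules

open CategoryTheory.Limits

section

universe v₁ u₁

variable {C : Type u₁} [Category.{v₁} C] {J : GrothendieckTopology C} {S : Sheaf J RingCat.{u}}
  [HasSheafify J AddCommGrpCat.{u}] [J.WEqualsLocallyBijective AddCommGrpCat.{u}]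

instance (V : Cᵒᵖ) : (SheafOfModules.evaluation.{u} S V).PreservesZeroMorphisms :=
  ⟨fun _ _ => rfl⟩

/-- Evaluation preserves products, whereas a free sheaf is a coproduct; for finite index sets both
are biproducts. -/
lemma nonempty_free_obj_iso (I : Type u) [Finite I] (V : Cᵒᵖ) :
    ∃ n : ℕ, Nonempty ((SheafOfModules.free (R := S) I).val.obj V ≅
      ModuleCat.of (S.obj.obj V) (Fin n → S.obj.obj V)) := by
  obtain ⟨n, ⟨ε⟩⟩ := Finite.exists_equiv_fin I
  let G := SheafOfModules.evaluation.{u} S V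
  have : HasFiniteBiproducts (SheafOfModules.{u} S) := Abelian.hasFiniteBiproducts
  have := preservesBiproductsOfShape_of_preservesProductsOfShape G (J := Fin n)
  let i₀ : SheafOfModules.free (R := S) I ≅ ∐ fun _ : Fin n => SheafOfModules.unit S :=
    Sigma.whiskerEquiv (f := fun _ : I => SheafOfModules.unit S)
      (g := fun _ => SheafOfModules.unit S) ε fun _ => Iso.refl _
  let i₁ : (∐ fun _ : Fin n => SheafOfModules.unit S) ≅ ⨁ fun _ : Fin n => SheafOfModules.unit S :=
    (biproduct.isoCoproduct _).symm
  let i₂ := G.mapBiproduct (fun _ : Fin n => SheafOfModules.unit S)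
  exact ⟨n, ⟨G.mapIso (i₀ ≪≫ i₁) ≪≫ i₂ ≪≫ ModuleCat.biproductIsoPi _⟩⟩

end

end SheafOfModules

namespace DGScheme

lemma nonempty_linearEquiv_of_generatingSections {X : Scheme.{u}} (M : X.Modules) (W : X.Opens)
    (s : SheafOfModules.GeneratingSections (SheafOfModules.over M W)) [IsIso s.π] [Finite s.I]
    {V : X.Opens} (h : V ≤ W) :
    ∃ n : ℕ, Nonempty (Γ(M, V) ≃ₗ[Γ(X, V)] (Fin n → Γ(X, V))) := by
  obtain ⟨n, ⟨i⟩⟩ := SheafOfModules.nonempty_free_obj_iso (S := X.ringCatSheaf.over W) s.I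
    (.op (Over.mk (homOfLE h)))
  have j := (SheafOfModules.evaluation _ (.op (Over.mk (homOfLE h)))).mapIso (asIso s.π).symm
  exact ⟨n, ⟨(j ≪≫ i).toLinearEquiv⟩⟩

-- Translates scalars of the restricted module on `Spec B` into functions on the image in `X`,
-- through `appIso`.
open Scheme.Modules in
lemma smul_restrict {X : Scheme.{u}} {B : CommRingCat.{u}} (j : Spec B ⟶ X)
    [IsOpenImmersion j] (M : X.Modules) (b : B) (W : (Spec B).Opens)
    (hW : j.opensFunctor.obj W ≤ j.opensFunctor.obj ⊤)
    (s : Γ(M.restrict j, W)) : (M.restrictAppIso j W).hom (b • s) =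
      X.presheaf.map (homOfLE hW).op ((j.appIso ⊤).inv ((Scheme.ΓSpecIso B).inv b)) •
        (M.restrictAppIso j W).hom s := by
  rw [smul_Spec_def]
  change (j.appIso W).inv ((Spec B).presheaf.map W.leTop.op ((Scheme.ΓSpecIso B).inv b)) •
    (M.restrictAppIso j W).hom s = _
  congr 1
  exact congr($(j.appIso_inv_naturality W.leTop.op) ((Scheme.ΓSpecIso B).inv b))

-- On `Spec B` a quasi-coherent sheaf is the tilde of its global sections, so restriction to a basic
-- open is a localization.
open Scheme.Modules in
lemma restrict_localizing {X : Scheme.{u}} {B : CommRingCat.{u}} (j : Spec B ⟶ X)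
    [IsOpenImmersion j] (M : X.Modules) [M.IsQuasicoherent] (b : B) {W : (Spec B).Opens}
    (hW : W = PrimeSpectrum.basicOpen b) (hVU : j.opensFunctor.obj W ≤ j.opensFunctor.obj ⊤)
    {c : Γ(X, j.opensFunctor.obj ⊤)} (hc : (j.appIso ⊤).inv ((Scheme.ΓSpecIso B).inv b) = c) :
    (∀ s : Γ(M, j.opensFunctor.obj W), ∃ (n : ℕ) (t : Γ(M, j.opensFunctor.obj ⊤)),
        M.presheaf.map (homOfLE hVU).op t = (X.presheaf.map (homOfLE hVU).op c) ^ n • s) ∧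
    ∀ t : Γ(M, j.opensFunctor.obj ⊤), M.presheaf.map (homOfLE hVU).op t = 0 →
      ∃ n : ℕ, c ^ n • t = 0 := by
  have h := (isIso_fromTildeΓ_iff_isLocalizing (M.restrict j)).mp
    (isIso_fromTildeΓ_of_isQuasicoherent _) b
  subst hW hc
  refine ⟨fun s => ?_, fun t ht => ?_⟩
  · obtain ⟨⟨t, ⟨_, n, rfl⟩⟩, ht⟩ := IsLocalizedModule.surj (Submonoid.powers b) _ s (self := h)
    refine ⟨n, t, Eq.trans ht.symm ?_⟩
    refine (smul_restrict j M (b ^ n) _ hVU s).trans ?_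
    rw [map_pow, map_pow, map_pow]
    rfl
  · obtain ⟨⟨_, n, rfl⟩, hn⟩ := h.exists_of_eq (x₁ := t) (x₂ := 0) (by rw [map_zero]; exact ht)
    refine ⟨n, ?_⟩
    rw [smul_zero] at hn
    refine Eq.trans ?_ ((smul_restrict j M (b ^ n) ⊤ le_rfl t).symm.trans hn)
    rw [map_pow, map_pow, map_pow]
    have := X.presheaf.map_id (.op (j.opensFunctor.obj ⊤))
    exact congr($this.symm _ ^ n • t)

/-- Sections of a quasi-coherent sheaf over a basic open subset of an affine open are obtained by
localization. -/
lemma exists_of_isAffineOpen {X : Scheme.{u}} (M : X.Modules) [M.IsQuasicoherent] {U : X.Opens}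
    (hU : IsAffineOpen U) (f : Γ(X, U)) (V : X.Opens) (hV : V = X.basicOpen f) (hVU : V ≤ U) :
    (∀ s : Γ(M, V), ∃ (n : ℕ) (t : Γ(M, U)),
      M.presheaf.map (homOfLE hVU).op t = (X.presheaf.map (homOfLE hVU).op f) ^ n • s) ∧
    ∀ t : Γ(M, U), M.presheaf.map (homOfLE hVU).op t = 0 → ∃ n : ℕ, f ^ n • t = 0 := by
  -- Stated for a variable `W` so that it can be replaced by the image of `Spec B`; it is applied to
  -- `hU.fromSpec`, whose range equals `U`.
  have key : ∀ (W : X.Opens) (g : Γ(X, W)) (V : X.Opens) (hV : V = X.basicOpen g) (hVU : V ≤ W)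
      {B : CommRingCat.{u}} (j : Spec B ⟶ X) [IsOpenImmersion j], W = j.opensFunctor.obj ⊤ →
      (∀ s : Γ(M, V), ∃ (n : ℕ) (t : Γ(M, W)),
        M.presheaf.map (homOfLE hVU).op t = (X.presheaf.map (homOfLE hVU).op g) ^ n • s) ∧
      ∀ t : Γ(M, W), M.presheaf.map (homOfLE hVU).op t = 0 → ∃ n : ℕ, g ^ n • t = 0 := by
    rintro _ g V hV hVU B j _ rfl
    obtain ⟨b, rfl⟩ : ∃ b, (j.appIso ⊤).inv ((Scheme.ΓSpecIso B).inv b) = g :=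
      ⟨(Scheme.ΓSpecIso B).hom ((j.appIso ⊤).hom g), by simp⟩
    have : V = j.opensFunctor.obj (PrimeSpectrum.basicOpen b) := by
      rw [hV]
      erw [← Scheme.image_basicOpen]
      congr 1
      rw [basicOpen_eq_of_affine']
      simp
      rfl
    subst this
    exact restrict_localizing j M b rfl hVU rfl
  exact key U f V hV hVU hU.fromSpec
    (by rw [Scheme.Hom.image_top_eq_opensRange, hU.opensRange_fromSpec])

end DGScheme

/-- Finite projectivity is local: it suffices that a module is free of finite rank on the
members of a standard open cover. -/
lemma finite_projective_of_localized_span {B : Type*} [CommRing B] {M : Type*} [AddCommGroup M]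
    [Module B M] (s : Set B) (hs : Ideal.span s = ⊤) {C N : s → Type*} [∀ g, CommRing (C g)]
    [∀ g, Algebra B (C g)] [∀ g : s, IsLocalization.Away g.1 (C g)] [∀ g, AddCommGroup (N g)]
    [∀ g, Module (C g) (N g)] [∀ g, Module.Free (C g) (N g)] [∀ g, Module.Finite (C g) (N g)]
    (ρ : ∀ g, M →ₛₗ[algebraMap B (C g)] N g)
    (hsurj : ∀ g (y : N g), ∃ (n : ℕ) (x : M), ρ g x = algebraMap B (C g) g ^ n • y)
    (hinj : ∀ g (x : M), ρ g x = 0 → ∃ n : ℕ, g.1 ^ n • x = 0) :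
    Module.Finite B M ∧ Module.Projective B M := by
  let _ (g : s) : Module B (N g) := Module.compHom (N g) (algebraMap B (C g))
  have hsc (g : s) : IsScalarTower B (C g) (N g) :=
    ⟨fun b c y => by rw [Algebra.smul_def, mul_smul]; rfl⟩
  let ϕ (g : s) : M →ₗ[B] N g :=
    { toFun := ρ g
      map_add' := map_add _
      map_smul' := fun b x => LinearMap.map_smulₛₗ _ b x }
  have hunit (g : s) (n : ℕ) : IsUnit (algebraMap B (C g) (g.1 ^ n)) :=
    IsLocalization.map_units (M := Submonoid.powers g.1) (C g) ⟨g.1 ^ n, n, rfl⟩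
  have hloc (g : s) : IsLocalizedModule (Submonoid.powers g.1) (ϕ g) := by
    refine ⟨?_, fun y => ?_, fun {x y} h => ?_⟩
    · rintro ⟨_, n, rfl⟩
      rw [Module.End.isUnit_iff]
      exact (hunit g n).smul_bijective
    · obtain ⟨n, x, hx⟩ := hsurj g y
      refine ⟨⟨x, ⟨g.1 ^ n, n, rfl⟩⟩, ?_⟩
      rw [← map_pow] at hx
      exact hx.symm
    · obtain ⟨n, hn⟩ := hinj g (x - y) (by rw [map_sub, sub_eq_zero]; exact h)
      refine ⟨⟨g.1 ^ n, n, rfl⟩, ?_⟩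
      rwa [smul_sub, sub_eq_zero] at hn
  -- Finite presentation and flatness both descend along the cover, and together they give
  -- projectivity.
  have := Module.FinitePresentation.of_localizationSpan' s hs ϕ fun g =>
    Module.finitePresentation_of_projective (C g) (N g)
  have hfl (g : s) : Module.Flat B (N g) :=
    have := IsLocalization.flat (C g) (Submonoid.powers g.1)
    Module.Flat.trans B (C g) (N g)
  have := Module.flat_of_isLocalized_span B M s hs N ϕ hfl
  exact ⟨inferInstance, Module.Flat.projective_of_finitePresentation⟩

/-! ### Restriction between affine opens and gluing. -/

namespace DGScheme

variable {X : Scheme.{u}}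

lemma IsVectorBundle.isQuasicoherent {M : X.Modules} (h : IsVectorBundle M) :
    M.IsQuasicoherent := by
  obtain ⟨q, h₁, h₂⟩ := h
  exact q.quasiCoherentData.isQuasicoherent

lemma exists_resSec_eq (M : X.Modules) [M.IsQuasicoherent] {U V : X.Opens} (hU : IsAffineOpen U)
    (f : Γ(X, U)) (hV : V = X.basicOpen f) (hVU : V ≤ U) (s : Γ(M, V)) :
    ∃ (n : ℕ) (t : Γ(M, U)), resSec M hVU t = (X.presheaf.map (homOfLE hVU).op).hom f ^ n • s :=
  (exists_of_isAffineOpen M hU f V hV hVU).1 s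

lemma exists_pow_smul_eq_zero (M : X.Modules) [M.IsQuasicoherent] {U V : X.Opens}
    (hU : IsAffineOpen U) (f : Γ(X, U)) (hV : V = X.basicOpen f) (hVU : V ≤ U) (t : Γ(M, U))
    (ht : resSec M hVU t = 0) : ∃ n : ℕ, f ^ n • t = 0 :=
  (exists_of_isAffineOpen M hU f V hV hVU).2 t ht

lemma exists_span_eq_top {U : X.Opens} (hU : IsAffineOpen U) {P : Γ(X, U) → Prop}
    (hP : ∀ x ∈ U, ∃ f, x ∈ X.basicOpen f ∧ P f) :
    ∃ s : Set Γ(X, U), Ideal.span s = ⊤ ∧ ∀ f ∈ s, P f := by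
  refine ⟨{f | P f}, ?_, fun f hf => hf⟩
  rw [← hU.self_le_iSup_basicOpen_iff]
  intro x hx
  obtain ⟨f, hxf, hf⟩ := hP x hx
  exact TopologicalSpace.Opens.mem_iSup.mpr ⟨⟨f, hf⟩, hxf⟩

/-- Basic opens inside trivializing opens cover `U`; over them the sections are free of finite rank
and are localizations of those over `U`. -/
lemma IsVectorBundle.finite_projective {M : X.Modules} (h : IsVectorBundle M) {U : X.Opens}
    (hU : IsAffineOpen U) :
    Module.Finite Γ(X, U) Γ(M, U) ∧ Module.Projective Γ(X, U) Γ(M, U) := by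
  have := h.isQuasicoherent
  obtain ⟨q, h₁, h₂⟩ := h
  obtain ⟨s, hs, hsq⟩ := exists_span_eq_top hU (P := fun f => ∃ i, X.basicOpen f ≤ q.X i) (by
    intro x hx
    obtain ⟨i, hi⟩ := TopologicalSpace.Opens.mem_iSup.mp
      (((Opens.coversTop_iff _ _).mp q.coversTop).ge (TopologicalSpace.Opens.mem_top x))
    obtain ⟨f, hf, hxf⟩ := hU.exists_basicOpen_le ⟨x, hi⟩ hx
    exact ⟨f, hxf, i, hf⟩)
  have hfree (g : s) : ∃ n : ℕ, Nonempty (Γ(M, X.basicOpen g.1) ≃ₗ[Γ(X, X.basicOpen g.1)]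
      (Fin n → Γ(X, X.basicOpen g.1))) := by
    obtain ⟨i, hi⟩ := hsq g.1 g.2
    have := (h₂.isFiniteType i).finite
    have := h₁.isIso i
    exact nonempty_linearEquiv_of_generatingSections M (q.X i) (q.generators i) hi
  have (g : s) : Module.Free Γ(X, X.basicOpen g.1) Γ(M, X.basicOpen g.1) := by
    obtain ⟨n, ⟨e⟩⟩ := hfree g
    exact Module.Free.of_equiv e.symm
  have (g : s) : Module.Finite Γ(X, X.basicOpen g.1) Γ(M, X.basicOpen g.1) := by
    obtain ⟨n, ⟨e⟩⟩ := hfree g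
    exact Module.Finite.equiv e.symm
  have (g : s) := hU.isLocalization_basicOpen g.1
  exact finite_projective_of_localized_span s hs
    (C := fun g => Γ(X, X.basicOpen g.1)) (N := fun g => Γ(M, X.basicOpen g.1))
    (fun g => resSec M (X.basicOpen_le g.1))
    (fun g y => exists_resSec_eq M hU g.1 rfl (X.basicOpen_le g.1) y)
    (fun g x hx => exists_pow_smul_eq_zero M hU g.1 rfl (X.basicOpen_le g.1) x hx)

lemma resSec_resSec (M : X.Modules) {U V W : X.Opens} (h : V ≤ U) (h' : W ≤ V) (s : Γ(M, U)) :
    resSec M h' (resSec M h s) = resSec M (h'.trans h) s := by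
  change (M.presheaf.map (homOfLE h).op ≫ M.presheaf.map (homOfLE h').op).hom s = _
  rw [← M.presheaf.map_comp]
  rfl

/-- Over an affine open `V` contained in an affine open `U`, a quasi-coherent sheaf is generated
by its sections over `U`. -/
lemma span_range_resSec (M : X.Modules) [M.IsQuasicoherent] {U V : X.Opens} (hU : IsAffineOpen U)
    (hV : IsAffineOpen V) (h : V ≤ U) :
    Submodule.span Γ(X, V) (Set.range (resSec M h)) = ⊤ := by
  rw [eq_top_iff]
  intro s _
  -- Cover `V` by opens that are basic in both `U` and `V`, so that sections over them are
  -- localizations of those over either one. A power of `g` times `s` then comes from `U`.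
  obtain ⟨T, hT, hTV⟩ := exists_span_eq_top hV
    (P := fun g => ∃ f, g = X.presheaf.map (homOfLE h).op f ∧ X.basicOpen f ≤ V) (by
    intro x hx
    obtain ⟨f, g, hfg, hxf⟩ := exists_basicOpen_le_affine_inter hU hV x ⟨h hx, hx⟩
    have hfV : X.basicOpen f ≤ V := hfg.trans_le (X.basicOpen_le g)
    refine ⟨_, ?_, f, rfl, hfV⟩
    rw [X.basicOpen_res]
    exact ⟨hx, hxf⟩)
  refine Submodule.mem_of_span_eq_top_of_smul_pow_mem _ T hT s ?_
  rintro ⟨g, hg⟩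
  obtain ⟨f, hgf, hfV⟩ := hTV g hg
  have hW : X.basicOpen f = X.basicOpen g := by
    rw [hgf, X.basicOpen_res]
    exact (inf_eq_right.mpr hfV).symm
  obtain ⟨n, t, ht⟩ := exists_resSec_eq M hU f rfl (hfV.trans h) (resSec M hfV s)
  obtain ⟨m, hm⟩ := exists_pow_smul_eq_zero M hV g hW hfV (resSec M h t - g ^ n • s) (by
    rw [map_sub, resSec_resSec, ht, LinearMap.map_smulₛₗ, map_pow, sub_eq_zero]
    congr 2
    rw [hgf]
    exact (congr($(X.presheaf.map_comp (homOfLE h).op (homOfLE hfV).op) f)))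
  refine ⟨m + n, ?_⟩
  rw [smul_sub, sub_eq_zero, ← mul_smul, ← pow_add] at hm
  rw [← hm]
  exact Submodule.smul_mem _ _ (Submodule.subset_span ⟨t, rfl⟩)

variable (R : Type u) [CommRing R] [X.Over (Spec (.of R))]

lemma smooth_sections [Smooth (X ↘ Spec (.of R))] {U : X.Opens} (hU : IsAffineOpen U) :
    Algebra.Smooth R Γ(X, U) := by
  rw [← RingHom.smooth_algebraMap]
  have h := Smooth.smooth_appLE (f := X ↘ Spec (.of R)) (isAffineOpen_top _) hU le_top
  exact RingHom.Smooth.respectsIso.2 _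
    (Scheme.ΓSpecIso (.of R)).symm.commRingCatIsoToRingEquiv h

/-- A derivation on an affine open that kills the functions on a larger affine open is zero. -/
lemma derivation_eq_zero {U V : X.Opens} (hU : IsAffineOpen U) (hV : IsAffineOpen V) (h : V ≤ U)
    (D : Derivation R Γ(X, V) Γ(X, V)) (hD : ∀ a, D (resFun R h a) = 0) : D = 0 := by
  -- `Γ(X, V)` is formally unramified over `Γ(X, U)`, and the hypothesis makes `D` linear over `Γ(X,
  -- U)`.
  have h' := FormallyUnramified.formallyUnramified_appLE (f := 𝟙 X) hU hV h
  let _ : Algebra Γ(X, U) Γ(X, V) := ((𝟙 X : X ⟶ X).appLE U V h).hom.toAlgebra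
  have : Algebra.FormallyUnramified Γ(X, U) Γ(X, V) := h'
  let D' : Derivation Γ(X, U) Γ(X, V) Γ(X, V) := Derivation.mk'
    { toFun := D
      map_add' := map_add D
      map_smul' := fun a b => by
        have : algebraMap Γ(X, U) Γ(X, V) a = resFun R h a := by
          change ((𝟙 X : X ⟶ X).app U ≫ X.presheaf.map (homOfLE h).op).hom a = _
          rw [Scheme.Hom.id_app]
          rfl
        change D (algebraMap Γ(X, U) Γ(X, V) a * b) = algebraMap Γ(X, U) Γ(X, V) a * D b
        rw [this, D.leibniz, hD, smul_zero, add_zero, smul_eq_mul] } (fun a b => D.leibniz a b)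
  ext a
  change D' a = 0
  rw [← D'.liftKaehlerDifferential_comp_D, Subsingleton.elim (KaehlerDifferential.D _ _ a) 0,
    map_zero]

lemma eq_of_resSec_affine (M : X.Modules) {W : X.Opens} (s t : Γ(M, W))
    (hst : ∀ (U : X.affineOpens) (h : U.1 ≤ W), resSec M h s = resSec M h t) : s = t := by
  refine TopCat.Sheaf.eq_of_locally_eq' ⟨M.presheaf, M.isSheaf⟩
    (fun U : {U : X.affineOpens // U.1 ≤ W} => U.1.1) W (fun U => homOfLE U.2) ?_ s t
    fun U => hst U.1 U.2
  intro x hx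
  obtain ⟨U, hU, hxU, hUW⟩ := X.isBasis_affineOpens.exists_subset_of_mem_open hx W.isOpen
  obtain ⟨U, hU, rfl⟩ := hU
  exact TopologicalSpace.Opens.mem_iSup.mpr ⟨⟨⟨U, hU⟩, hUW⟩, hxU⟩

/-- Compatible families of sections over affine opens glue. -/
lemma exists_globalRes_eq (M : X.Modules) (s : ∀ U : X.affineOpens, Γ(M, U.1))
    (hs : ∀ (U V : X.affineOpens) (h : V.1 ≤ U.1), resSec M h (s U) = s V) :
    ∃ φ : Γ(M, ⊤), ∀ U, globalRes φ U = s U := by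
  obtain ⟨φ, hφ, -⟩ := TopCat.Sheaf.existsUnique_gluing' ⟨M.presheaf, M.isSheaf⟩
    (fun U : X.affineOpens => U.1) ⊤ (fun U => homOfLE le_top) (by
      rw [iSup_affineOpens_eq_top]) s (by
      intro U V
      apply eq_of_resSec_affine
      intro W hW
      exact (resSec_resSec M _ _ _).trans
        ((hs U W _).trans ((hs V W _).symm.trans (resSec_resSec M _ _ _).symm)))
  exact ⟨φ, hφ⟩

end DGScheme

/-! ### Contraction of forms with vector fields, and connections. -/

section Forms

variable {R B B' E E' F : Type*} [CommRing R] [CommRing B] [CommRing B'] [Algebra R B]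
  [Algebra R B'] [AddCommGroup E] [Module B E] [AddCommGroup E'] [Module B' E']
  [AddCommGroup F] [Module B F]

@[simp]
lemma contract_tmul (v : Derivation R B B) (e : E) (ω : Ω[B⁄R]) :
    contract v (e ⊗ₜ[B] ω) = v.liftKaehlerDifferential ω • e := by
  simp [contract]

@[simp]
lemma pairForm_tmul (q : E →ₗ[B] B) (e : E) (ω : Ω[B⁄R]) :
    pairForm q (e ⊗ₜ[B] ω) = q e • ω := by
  simp [pairForm]

@[simp]
lemma formsMap_tmul (φ : B →ₐ[R] B') (g : E →ₛₗ[φ.toRingHom] E') (e : E) (ω : Ω[B⁄R]) :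
    formsMap φ g (e ⊗ₜ[B] ω) = g e ⊗ₜ[B'] kaehlerMap φ ω :=
  rfl

lemma liftKaehlerDifferential_add (v w : Derivation R B B) :
    (v + w).liftKaehlerDifferential = v.liftKaehlerDifferential + w.liftKaehlerDifferential :=
  Derivation.liftKaehlerDifferential_unique _ _ (by ext; simp)

lemma liftKaehlerDifferential_smul (b : B) (v : Derivation R B B) :
    (b • v).liftKaehlerDifferential = b • v.liftKaehlerDifferential :=
  Derivation.liftKaehlerDifferential_unique _ _ (by ext; simp)

lemma contract_add (v w : Derivation R B B) (x : E ⊗[B] Ω[B⁄R]) :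
    contract (v + w) x = contract v x + contract w x := by
  simp [contract, liftKaehlerDifferential_add, LinearMap.lTensor_add]

lemma contract_smul (b : B) (v : Derivation R B B) (x : E ⊗[B] Ω[B⁄R]) :
    contract (b • v) x = b • contract v x := by
  simp [contract, liftKaehlerDifferential_smul, LinearMap.lTensor_smul]

lemma liftKaehlerDifferential_pairForm (v : Derivation R B B) (q : E →ₗ[B] B)
    (x : E ⊗[B] Ω[B⁄R]) : v.liftKaehlerDifferential (pairForm q x) = q (contract v x) := by
  induction x using TensorProduct.induction_on with
  | zero => simp
  | tmul e ω => simp [mul_comm]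
  | add x y hx hy => simp [hx, hy]

lemma liftKaehlerDifferential_kaehlerMap (φ : B →ₐ[R] B') {v : Derivation R B B}
    {v' : Derivation R B' B'} (h : ∀ b, φ (v b) = v' (φ b)) (ω : Ω[B⁄R]) :
    v'.liftKaehlerDifferential (kaehlerMap φ ω) = φ (v.liftKaehlerDifferential ω) := by
  have hω : ω ∈ Submodule.span B (Set.range (KaehlerDifferential.D R B)) := by
    rw [KaehlerDifferential.span_range_derivation]; trivial
  induction hω using Submodule.span_induction with
  | mem x hx =>
    obtain ⟨b, rfl⟩ := hx
    rw [kaehlerMap_D, Derivation.liftKaehlerDifferential_comp_D,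
      Derivation.liftKaehlerDifferential_comp_D, h]
  | zero => rw [LinearMap.map_zero, map_zero, map_zero, map_zero]
  | add x y _ _ hx hy => rw [LinearMap.map_add, map_add, map_add, map_add, hx, hy]
  | smul b x _ hx =>
    rw [LinearMap.map_smulₛₗ, map_smul, hx, map_smul, smul_eq_mul, smul_eq_mul, map_mul]
    rfl

lemma contract_formsMap (φ : B →ₐ[R] B') (g : E →ₛₗ[φ.toRingHom] E') {v : Derivation R B B}
    {v' : Derivation R B' B'} (h : ∀ b, φ (v b) = v' (φ b)) (x : E ⊗[B] Ω[B⁄R]) :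
    contract v' (formsMap φ g x) = g (contract v x) := by
  induction x using TensorProduct.induction_on with
  | zero => rw [map_zero, map_zero, map_zero, LinearMap.map_zero]
  | tmul e ω =>
    rw [formsMap_tmul, contract_tmul, contract_tmul, LinearMap.map_smulₛₗ,
      liftKaehlerDifferential_kaehlerMap φ h]
    rfl
  | add x y hx hy => rw [map_add, map_add, map_add, LinearMap.map_add, hx, hy]

variable [Module.Finite B Ω[B⁄R]] [Module.Projective B Ω[B⁄R]]

/-- With finite projective `Ω[B⁄R]`, vector fields separate forms. So identities such as `dQ(φ, φ) =
0` may be checked along the fields `α f`. -/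
lemma kaehlerDifferential_ext {ω ω' : Ω[B⁄R]} (h : ∀ v : Derivation R B B,
    v.liftKaehlerDifferential ω = v.liftKaehlerDifferential ω') : ω = ω' := by
  obtain ⟨n, b, v, hv⟩ := exists_dual_basis_kaehlerDifferential (R := R) (B := B)
  rw [← hv ω, ← hv ω']
  simp [h]

lemma forms_ext {x y : E ⊗[B] Ω[B⁄R]}
    (h : ∀ v : Derivation R B B, contract v x = contract v y) : x = y := by
  obtain ⟨n, b, v, hv⟩ := exists_dual_basis_kaehlerDifferential (R := R) (B := B)
  have key (z : E ⊗[B] Ω[B⁄R]) :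
      ∑ i, contract (v i) z ⊗ₜ[B] KaehlerDifferential.D R B (b i) = z := by
    induction z using TensorProduct.induction_on with
    | zero => simp
    | tmul e ω =>
      conv_rhs => rw [← hv ω]
      simp [TensorProduct.tmul_sum, TensorProduct.smul_tmul]
    | add x y hx hy => simp [TensorProduct.add_tmul, Finset.sum_add_distrib, hx, hy]
  rw [← key x, ← key y]
  simp [h]

/-- A covariant derivative along vector fields comes from a connection. -/
lemma GSym.LocalData.exists_connection (L : LocalData R B E F) :
    ∃ c : E →+ E ⊗[B] Ω[B⁄R], ∀ f e, contract (L.α f) (c e) = L.cov f e := by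
  obtain ⟨n, b, v, hv⟩ := exists_dual_basis_kaehlerDifferential (R := R) (B := B)
  let T (i : Fin n) := (TensorProduct.mk B E Ω[B⁄R]).flip (KaehlerDifferential.D R B (b i))
  -- The connection is `∑ ∇_{v i} ⊗ d (b i)` for a dual basis of `Ω[B⁄R]`.
  refine ⟨∑ i, (T i).toAddMonoidHom.comp (L.cov (L.α.symm (v i))), fun f e => ?_⟩
  conv_rhs => rw [← L.sum_smul_symm hv f]
  simp [T, map_sum, L.cov_smul_left]

end Forms

/-! ### From global data to local data. -/

namespace DGScheme

open GSym

section

variable {R : Type u} [CommRing R] {X : Scheme.{u}} [X.Over (Spec (.of R))] {E F : X.Modules}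

/-- Rationality of the base enters only through one half. -/
lemma exists_add_self_eq_one (R : Type u) [CommRing R] [Algebra ℚ R] [X.Over (Spec (.of R))]
    (U : X.Opens) : ∃ t : Γ(X, U), t + t = 1 :=
  ⟨algebraMap R Γ(X, U) (algebraMap ℚ R (1 / 2)), by
    rw [← map_add, ← map_add, add_halves, map_one, map_one]⟩

lemma isMap_resA {U V : X.affineOpens} (h : V.1 ≤ U.1) :
    IsMap (resA E F h) (resFun R h) (resSec E h) (resSec F h) :=
  isMap_map _ _ _

lemma resA_ι₀ {U V : X.affineOpens} (h : V.1 ≤ U.1) (b : Γ(X, U.1)) :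
    resA E F h (ι₀ _ _ _ b) = ι₀ _ _ _ (resFun R h b) :=
  (isMap_resA h).map_ι₀ b

lemma resA_ι₁ {U V : X.affineOpens} (h : V.1 ≤ U.1) (e : Γ(E, U.1)) :
    resA E F h (ι₁ _ _ _ e) = ι₁ _ _ _ (resSec E h e) :=
  GSym.map_ι₁ _ _ _ e

lemma resA_ι₂ {U V : X.affineOpens} (h : V.1 ≤ U.1) (f : Γ(F, U.1)) :
    resA E F h (ι₂ _ _ _ f) = ι₂ _ _ _ (resSec F h f) :=
  GSym.map_ι₂ _ _ _ f

lemma resSec_globalRes {M : X.Modules} (φ : Γ(M, ⊤)) {U V : X.affineOpens} (h : V.1 ≤ U.1) :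
    resSec M h (globalRes φ U) = globalRes φ V :=
  resSec_resSec M _ _ _

lemma contract_formsMap_resSec {U V : X.Opens} (h : V ≤ U) {v : Derivation R Γ(X, U) Γ(X, U)}
    {v' : Derivation R Γ(X, V) Γ(X, V)} (hv : ∀ a, resFun R h (v a) = v' (resFun R h a))
    (x : Γ(E, U) ⊗[Γ(X, U)] Ω[Γ(X, U)⁄R]) :
    contract v' (formsMap (resFun R h) (resSec E h) x) = resSec E h (contract v x) :=
  contract_formsMap (resFun R h) (resSec E h) hv x

namespace PoissonData

variable (D : PoissonData R E F)

/-- The data induced on the sections over an affine open. -/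
noncomputable def localData (U : X.affineOpens) : LocalData R Γ(X, U.1) Γ(E, U.1) Γ(F, U.1) where
  α := D.α.toEquiv U
  cov :=
    { toFun := fun f => (contract (D.α.toEquiv U f)).toAddMonoidHom.comp (D.conn.toFun U)
      map_zero' := by
        ext e
        simpa using contract_smul (0 : Γ(X, U.1)) (0 : Derivation R Γ(X, U.1) Γ(X, U.1))
          (D.conn.toFun U e)
      map_add' := fun f f' => by
        ext e
        simpa using contract_add _ _ _ }
  cov_smul_left b f e := by
    simpa using contract_smul _ _ _
  cov_smul f b e := by
    simp [D.conn.leibniz]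
  Q := D.Q.form U
  symm := D.Q.symm U
  bijective := D.Q.nondegenerate U
  compatible f e e' := by
    have h := congr((D.α.toEquiv U f).liftKaehlerDifferential $(D.compatible U e e'))
    rw [map_add, liftKaehlerDifferential_pairForm, liftKaehlerDifferential_pairForm,
      Derivation.liftKaehlerDifferential_comp_D] at h
    rw [h, D.Q.symm]
    rfl

lemma resSec_covDeriv {U V : X.affineOpens} (h : V.1 ≤ U.1) (f : Γ(F, U.1)) (e : Γ(E, U.1)) :
    resSec E h (D.covDeriv U f e) = D.covDeriv V (resSec F h f) (resSec E h e) := by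
  rw [covDeriv, covDeriv, ← D.conn.res U V h, contract_formsMap_resSec h (D.α.res U V h f)]

lemma NormClosed.α_eq_zero {D : PoissonData R E F} {φ : Γ(E, ⊤)} (h : D.NormClosed φ)
    (U : X.affineOpens) (f : Γ(F, U.1)) :
    D.α.toEquiv U f (D.Q.form U (globalRes φ U) (globalRes φ U)) = 0 := by
  rw [← Derivation.liftKaehlerDifferential_comp_D, h U, map_zero]

end PoissonData

end

end DGScheme

/-! ### Both directions of the correspondence over the whole scheme. -/

namespace DGScheme

open GSym

variable {R : Type u} [CommRing R] {X : Scheme.{u}} [X.Over (Spec (.of R))] {E F : X.Modules}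

namespace PoissonData

variable (D : PoissonData R E F)

/-- The bracket over an affine open determined by the data `(α, ∇, Q)`. -/
lemma exists_bracket [Algebra ℚ R] (hE : IsVectorBundle E) (U : X.affineOpens) :
    ∃ π : A E F U →+ A E F U →+ A E F U, IsStrictPoisson R 0 π ∧
      (∀ f b, π (ι₂ _ _ _ f) (ι₀ _ _ _ b) = ι₀ _ _ _ (D.α.toEquiv U f b)) ∧
      (∀ e e', π (ι₁ _ _ _ e) (ι₁ _ _ _ e') = ι₀ _ _ _ (D.Q.form U e e')) ∧
      ∀ f e, π (ι₂ _ _ _ f) (ι₁ _ _ _ e) = ι₁ _ _ _ (D.covDeriv U f e) := by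
  obtain ⟨_, _⟩ := hE.finite_projective U.2
  obtain ⟨t, ht⟩ := exists_add_self_eq_one R U.1
  exact (D.localData U).exists_poisson ht

/-- The differential is `[φ, -]` for the local bracket attached to the data. Uniqueness and
compatibility with restriction are checked on generators, where the prescribed formulas are natural.
-/
lemma existsUnique_differential [Algebra ℚ R] (hE : IsVectorBundle E) {φ : Γ(E, ⊤)}
    (hφ : D.NormClosed φ) : ∃! δ : Differential R E F, D.Determines φ δ := by
  choose π hπ h₂₀ h₁₁ h₂₁ using D.exists_bracket hE
  have hδ (U : X.affineOpens) : IsDifferential R (π U (ι₁ _ _ _ (globalRes φ U))) := by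
    obtain ⟨t, ht⟩ := exists_add_self_eq_one R U.1
    exact (hπ U).isDifferential_bracket ht (D.localData U) (h₂₀ U) (h₁₁ U) (hφ.α_eq_zero U)
  have hF (U : X.affineOpens) (f : Γ(F, U.1)) : π U (ι₁ _ _ _ (globalRes φ U)) (ι₂ _ _ _ f) =
      -ι₁ _ _ _ (D.covDeriv U f (globalRes φ U)) := by
    rw [(hπ U).skew 1 2 _ (ι₁_mem_gr _) _ (ι₂_mem_gr f), h₂₁]
    simp [Int.negOnePow_even 2 even_two]
  have hzero {U : X.affineOpens} {d : A E F U →+ A E F U} (hd : IsDifferential R d)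
      (b : Γ(X, U.1)) : d (ι₀ _ _ _ b) = 0 :=
    gr_of_neg (by norm_num) (hd.isGradedDerivation.map_gr _ _ (ι₀_mem_gr b))
  refine ⟨⟨fun U => π U (ι₁ _ _ _ (globalRes φ U)), hδ, fun U V h a => ?_⟩,
    ⟨fun U e => h₁₁ U _ e, hF⟩, ?_⟩
  · refine (isMap_resA (R := R) h).comp_eq_of_generators (hδ U).isGradedDerivation
      (hδ V).isGradedDerivation (fun b => ?_) (fun e => ?_) (fun f => ?_) a
    · rw [hzero (hδ U), hzero (hδ V), map_zero]
    · rw [h₁₁, h₁₁, resA_ι₀ (R := R), D.Q.res U V h, resSec_globalRes]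
    · rw [hF, hF, map_neg, resA_ι₁, D.resSec_covDeriv, resSec_globalRes]
  · rintro ⟨d, hd, hd'⟩ ⟨h₁, h₂⟩
    congr
    funext U
    refine (hd U).isGradedDerivation.ext (hδ U).isGradedDerivation (fun b => ?_) (fun e => ?_)
      fun f => ?_
    · rw [hzero (hδ U), hzero (hd U)]
    · rw [h₁₁]
      exact h₁ U e
    · rw [hF]
      exact h₂ U f

-- The local brackets are built for the zero differential, but `δ` and `[φ, -]` agree on generators,
-- so Jacobi makes them compatible with `δ`. They commute with restriction by `map_bracket`:
-- sections of `E` over `U` generate those over `V`, and derivations on `V` killing functions from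
-- `U` vanish.
set_option maxHeartbeats 1000000 in
lemma existsUnique_strictPoisson [Algebra ℚ R] [Smooth (X ↘ Spec (.of R))]
    (hE : IsVectorBundle E) {φ : Γ(E, ⊤)} {δ : Differential R E F} (hδ : D.Determines φ δ) :
    ∃! π : StrictPoisson δ, π.StrictlyNondegenerate ∧ D.Corresponds π := by
  have := hE.isQuasicoherent
  choose π hπ h₂₀ h₁₁ h₂₁ using D.exists_bracket hE
  have hδπ (U : X.affineOpens) : π U (ι₁ _ _ _ (globalRes φ U)) = δ.d U := by
    have h := (δ.isDifferential U).isGradedDerivation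
    have h' := (hπ U).right_derivation 1 _ (ι₁_mem_gr (globalRes φ U))
    refine IsGradedDerivation.ext (k := -1) h' h (fun b => ?_) (fun e => ?_) fun f => ?_
    · rw [gr_of_neg (by norm_num) (h.map_gr _ _ (ι₀_mem_gr b)),
        gr_of_neg (by norm_num) (h'.map_gr _ _ (ι₀_mem_gr b))]
    · rw [h₁₁, hδ.on_E]
    · rw [(hπ U).skew 1 2 _ (ι₁_mem_gr _) _ (ι₂_mem_gr f), h₂₁, hδ.on_F]
      simp [Int.negOnePow_even 2 even_two]
  have hP (U : X.affineOpens) : IsStrictPoisson R (δ.d U) (π U) := by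
    rw [← hδπ]
    exact (hπ U).of_bracket _
  refine ⟨⟨π, hP, fun U V h => ?_⟩, ⟨fun U => ?_, ⟨h₂₀, h₁₁, h₂₁⟩⟩, ?_⟩
  · obtain ⟨_, _⟩ := hE.finite_projective V.2
    obtain ⟨t, ht⟩ := exists_add_self_eq_one R V.1
    refine (hP U).map_bracket ht (hP V) (isMap_resA (R := R) h) (D.Q.nondegenerate V) (h₁₁ V)
      (fun f hf => ?_) (span_range_resSec E U.2 V.2 h) (fun f b => ?_) (fun e e' => ?_)
      fun f e => ?_
    · refine (D.α.toEquiv V).map_eq_zero_iff.mp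
        (derivation_eq_zero R U.2 V.2 h _ fun a =>
          ι₀_injective (E := Γ(E, V.1)) (F := Γ(F, V.1)) ?_)
      rw [← h₂₀, hf, map_zero]
    · rw [h₂₀, h₂₀, resA_ι₀ (R := R), D.α.res U V h]
    · rw [h₁₁, h₁₁, resA_ι₀ (R := R), D.Q.res U V h]
    · rw [h₂₁, h₂₁, resA_ι₁, D.resSec_covDeriv]
  · obtain ⟨_, _⟩ := hE.finite_projective U.2
    have := smooth_sections R U.2
    exact (D.localData U).strictlyNondegenerate (hP U) (h₂₀ U) (h₁₁ U)
  · rintro ⟨π', hP', hres⟩ ⟨-, h₁, h₂, h₃⟩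
    congr
    funext U
    obtain ⟨_, _⟩ := hE.finite_projective U.2
    obtain ⟨t, ht⟩ := exists_add_self_eq_one R U.1
    exact (hP' U).ext_of_localData ht (hP U) (D.localData U) (h₁ U) (h₂ U) (h₃ U)
      (h₂₀ U) (h₁₁ U) (h₂₁ U)

/-- The local sections glue: after restriction, both pair under `Q` in the same way with sections
coming from `U`, which generate, and `Q` is non-degenerate. -/
lemma existsUnique_section [Smooth (X ↘ Spec (.of R))] (hE : IsVectorBundle E)
    {δ : Differential R E F} {π : StrictPoisson δ} (hD : D.Corresponds π) :
    ∃! φ : Γ(E, ⊤), D.NormClosed φ ∧ D.Determines φ δ := by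
  have := hE.isQuasicoherent
  choose s hs₁ hs₂ hs₃ using fun U : X.affineOpens => (D.localData U).exists_section
    (δ.isDifferential U) (π.isStrictPoisson U) (hD.bracket_F_O U) (hD.bracket_E_E U)
    (hD.bracket_F_E U)
  have hres (U V : X.affineOpens) (h : V.1 ≤ U.1) : resSec E h (s U) = s V := by
    refine (D.Q.nondegenerate V).1 ?_
    refine LinearMap.ext_on_range (span_range_resSec E U.2 V.2 h) fun e => ?_
    rw [← D.Q.res U V h]
    apply ι₀_injective (E := Γ(E, V.1)) (F := Γ(F, V.1))
    rw [← resA_ι₀]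
    refine (congrArg (resA E F h) (hs₁ U e).symm).trans ?_
    rw [δ.res U V h, resA_ι₁]
    exact hs₁ V _
  obtain ⟨φ, hφ⟩ := exists_globalRes_eq E s hres
  refine ⟨φ, ⟨fun U => ?_, fun U e => ?_, fun U f => ?_⟩, ?_⟩
  · have := smooth_sections R U.2
    refine kaehlerDifferential_ext fun v => ?_
    rw [map_zero, Derivation.liftKaehlerDifferential_comp_D, hφ]
    obtain ⟨f, rfl⟩ := (D.α.toEquiv U).surjective v
    exact hs₃ U f
  · rw [hφ]
    exact hs₁ U e
  · rw [hφ]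
    exact hs₂ U f
  · rintro ψ ⟨-, hψ⟩
    refine eq_of_resSec_affine E _ _ fun U _ => ?_
    change globalRes ψ U = globalRes φ U
    refine (D.Q.nondegenerate U).1 (LinearMap.ext fun e => ?_)
    apply ι₀_injective (E := Γ(E, U.1)) (F := Γ(F, U.1))
    rw [← hψ.on_E, hφ]
    exact hs₁ U e

/-- The bracket gives `α`, `Q` and the covariant derivatives by injectivity of the inclusions; the
covariant derivatives along all vector fields `α f` determine the connection. -/
lemma Corresponds.unique [Smooth (X ↘ Spec (.of R))] {δ : Differential R E F}
    {π : StrictPoisson δ} {D D' : PoissonData R E F} (hD : D.Corresponds π)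
    (hD' : D'.Corresponds π) : D = D' := by
  have hα : D.α.toEquiv = D'.α.toEquiv := by
    funext U
    ext f a
    exact ι₀_injective ((hD.bracket_F_O U f a).symm.trans (hD'.bracket_F_O U f a))
  have hQ : D.Q.form = D'.Q.form := by
    funext U
    ext e e'
    exact ι₀_injective ((hD.bracket_E_E U e e').symm.trans (hD'.bracket_E_E U e e'))
  have hc : D.conn.toFun = D'.conn.toFun := by
    funext U
    ext e
    have := smooth_sections R U.2
    refine forms_ext fun v => ?_
    obtain ⟨f, rfl⟩ := (D.α.toEquiv U).surjective v
    have h := ι₁_injective ((hD.bracket_F_E U f e).symm.trans (hD'.bracket_F_E U f e))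
    rw [covDeriv, covDeriv, ← hα] at h
    exact h
  obtain ⟨⟨α, _⟩, ⟨c, _, _⟩, ⟨Q, _, _, _⟩, _⟩ := D
  obtain ⟨⟨α', _⟩, ⟨c', _, _⟩, ⟨Q', _, _, _⟩, _⟩ := D'
  obtain rfl : α = α' := hα
  obtain rfl : Q = Q' := hQ
  obtain rfl : c = c' := hc
  rfl

end PoissonData

/-- Data on the affine opens that are compatible with restriction glue to data `(α, ∇, Q)`. -/
lemma PoissonData.exists_of_localData [Smooth (X ↘ Spec (.of R))] (hF : IsVectorBundle F)
    (L : ∀ U : X.affineOpens, LocalData R Γ(X, U.1) Γ(E, U.1) Γ(F, U.1))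
    (hα : ∀ (U V : X.affineOpens) (h : V.1 ≤ U.1) (f : Γ(F, U.1)) (a : Γ(X, U.1)),
      resFun R h ((L U).α f a) = (L V).α (resSec F h f) (resFun R h a))
    (hcov : ∀ (U V : X.affineOpens) (h : V.1 ≤ U.1) (f : Γ(F, U.1)) (e : Γ(E, U.1)),
      resSec E h ((L U).cov f e) = (L V).cov (resSec F h f) (resSec E h e))
    (hQ : ∀ (U V : X.affineOpens) (h : V.1 ≤ U.1) (e e' : Γ(E, U.1)),
      resFun R h ((L U).Q e e') = (L V).Q (resSec E h e) (resSec E h e')) :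
    ∃ D : PoissonData R E F, (∀ U, D.α.toEquiv U = (L U).α) ∧ (∀ U, D.Q.form U = (L U).Q) ∧
      ∀ U f e, D.covDeriv U f e = (L U).cov f e := by
  have := hF.isQuasicoherent
  have hΩ (U : X.affineOpens) := smooth_sections R U.2
  choose c hc using fun U => (L U).exists_connection
  have leibniz (U : X.affineOpens) (a : Γ(X, U.1)) (e : Γ(E, U.1)) :
      c U (a • e) = a • c U e + e ⊗ₜ KaehlerDifferential.D R Γ(X, U.1) a := by
    refine forms_ext fun v => ?_
    obtain ⟨f, rfl⟩ := (L U).α.surjective v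
    rw [hc, (L U).cov_smul, map_add, LinearMap.map_smul, hc, contract_tmul,
      Derivation.liftKaehlerDifferential_comp_D]
  have res (U V : X.affineOpens) (h : V.1 ≤ U.1) (e : Γ(E, U.1)) :
      formsMap (resFun R h) (resSec E h) (c U e) = c V (resSec E h e) := by
    refine forms_ext fun v => ?_
    obtain ⟨f, rfl⟩ := (L V).α.surjective v
    -- Vector fields over `V` correspond to sections of `F`, which are generated by restrictions
    -- from `U`; contraction is linear in the field, so only those have to be checked.
    have hf : f ∈ Submodule.span Γ(X, V.1) (Set.range (resSec F h)) := by
      rw [span_range_resSec F U.2 V.2 h]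
      trivial
    induction hf using Submodule.span_induction with
    | mem x hx =>
      obtain ⟨f, rfl⟩ := hx
      rw [contract_formsMap_resSec h (hα U V h f), hc, hc, hcov]
    | zero =>
      rw [← zero_smul Γ(X, V.1) (0 : Γ(F, V.1)), map_smul, contract_smul, contract_smul, zero_smul,
        zero_smul]
    | add x y _ _ hx hy => rw [map_add, contract_add, contract_add, hx, hy]
    | smul b x _ hx => rw [map_smul, contract_smul, contract_smul, hx]
  refine ⟨⟨⟨fun U => (L U).α, hα⟩, ⟨c, leibniz, res⟩, ⟨fun U => (L U).Q, fun U => (L U).symm,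
    fun U => (L U).bijective, hQ⟩, fun U e e' => kaehlerDifferential_ext fun v => ?_⟩,
    fun U => rfl, fun U => rfl, hc⟩
  obtain ⟨f, rfl⟩ := (L U).α.surjective v
  rw [map_add, liftKaehlerDifferential_pairForm, liftKaehlerDifferential_pairForm, hc, hc,
    Derivation.liftKaehlerDifferential_comp_D, (L U).compatible, (L U).symm e']

lemma StrictPoisson.StrictlyNondegenerate.exists_corresponds [Smooth (X ↘ Spec (.of R))]
    (hE : IsVectorBundle E) (hF : IsVectorBundle F) {δ : Differential R E F}
    {π : StrictPoisson δ} (hπ : π.StrictlyNondegenerate) :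
    ∃ D : PoissonData R E F, D.Corresponds π := by
  have hL (U : X.affineOpens) := by
    obtain ⟨_, _⟩ := hE.finite_projective U.2
    obtain ⟨_, _⟩ := hF.finite_projective U.2
    exact (π.isStrictPoisson U).exists_localData fun k D hD => by
      -- Of non-degeneracy only surjectivity onto homogeneous derivations is used.
      have : D ∈ (gradedDerivations R Γ(X, U.1) Γ(E, U.1) Γ(F, U.1) : Set _) :=
        AddSubgroup.subset_closure ⟨k, hD⟩
      rwa [← (hπ U).2] at this
  choose L h₂₀ h₁₁ h₂₁ using hL
  obtain ⟨D, hα, hQ, hcov⟩ := PoissonData.exists_of_localData hF L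
    (fun U V h f a => ι₀_injective (E := Γ(E, V.1)) (F := Γ(F, V.1)) (by
      rw [← resA_ι₀, ← h₂₀, ← h₂₀, π.res U V h, resA_ι₂, resA_ι₀ (R := R)]))
    (fun U V h f e => ι₁_injective (B := Γ(X, V.1)) (F := Γ(F, V.1)) (by
      rw [← resA_ι₁, ← h₂₁, ← h₂₁, π.res U V h, resA_ι₂, resA_ι₁]))
    (fun U V h e e' => ι₀_injective (E := Γ(E, V.1)) (F := Γ(F, V.1)) (by
      rw [← resA_ι₀, ← h₁₁, ← h₁₁, π.res U V h, resA_ι₁, resA_ι₁]))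
  refine ⟨D, fun U f a => ?_, fun U e e' => ?_, fun U f e => ?_⟩
  · rw [h₂₀, hα]
  · rw [h₁₁, hQ]
  · rw [h₂₁, hcov]

end DGScheme

theorem lemma2p8 (R : Type u) [CommRing R] [Algebra ℚ R] (X : Scheme.{u})
    [X.Over (Spec (.of R))] [Smooth (X ↘ Spec (.of R))] (E F : X.Modules)
    (hE : DGScheme.IsVectorBundle E) (hF : DGScheme.IsVectorBundle F) :
    (∀ (δ : DGScheme.Differential R E F) (π : DGScheme.StrictPoisson δ),
      π.StrictlyNondegenerate →
        ∃! D : DGScheme.PoissonData R E F, D.Corresponds π) ∧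
    (∀ (δ : DGScheme.Differential R E F) (π : DGScheme.StrictPoisson δ),
      π.StrictlyNondegenerate →
        ∀ D : DGScheme.PoissonData R E F, D.Corresponds π →
          ∃! φ : Γ(E, ⊤), D.NormClosed φ ∧ D.Determines φ δ) ∧
    (∀ (D : DGScheme.PoissonData R E F) (φ : Γ(E, ⊤)), D.NormClosed φ →
      ∃! δ : DGScheme.Differential R E F, D.Determines φ δ) ∧
    (∀ (D : DGScheme.PoissonData R E F) (φ : Γ(E, ⊤)) (δ : DGScheme.Differential R E F),
      D.NormClosed φ → D.Determines φ δ →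
        ∃! π : DGScheme.StrictPoisson δ, π.StrictlyNondegenerate ∧ D.Corresponds π) := by
  refine ⟨fun δ π hπ => ?_, fun δ π _ D hD => D.existsUnique_section hE hD,
    fun D φ hφ => D.existsUnique_differential hE hφ,
    fun D φ δ _ hδ => D.existsUnique_strictPoisson hE hδ⟩
  obtain ⟨D, hD⟩ := hπ.exists_corresponds hE hF
  exact ⟨D, hD, fun D' hD' => hD'.unique hD⟩
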